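/- **Theorem 2.1 (generalized Rankine–Hugoniot conditions).** Let $0<T\le\infty$. *System and generalized solutions.* Consider $$\varrho_t+(\varrho u)_x+(\varrho v)_y=0,\quad (\varrho u)_t+(\varrho u^2)_x+(\varrho uv)_y=0,\quad (\varrho v)_t+(\varrho uv)_x+(\varrho v^2)_y=0 \tag{1}$$ with initial data $\varrho_0,u_0,v_0$. A generalized solution on $(0,T)$ is a family $(P_t,I_t,J_t)_{0<t<T}$ of Radon measures on $\mathbb R^2$, weakly continuous in $t$ (tested on continuous functions with compact support), with $P_t\ge 0$ and $I_t,J_t$ (signed) absolutely continuous with respect to $P_t$ for a.e. $t$, such that, with $u=dI_t/dP_t$, $v=dJ_t/dP_t$, for all $f,g,h\in C^1_0(\mathbb R^2)$ and $0<t_1<t_2<T$, $$\int f\,dP_{t_2}-\int f\,dP_{t_1}=\int_{t_1}^{t_2}\Big\{\int f_x\,dI_\tau+\int f_y\,dJ_\tau\Big\}d\tau,$$ $$\int g\,dI_{t_2}-\int g\,dI_{t_1}=\int_{t_1}^{t_2}\Big\{\int g_x u\,dI_\tau+\int g_y v\,dI_\tau\Big\}d\tau,$$ $$\int h\,dJ_{t_2}-\int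 h\,dJ_{t_1}=\int_{t_1}^{t_2}\Big\{\int h_x u\,dJ_\tau+\int h_y v\,dJ_\tau\Big\}d\tau$$ (all these integrals being required to exist), and $P_t\to\varrho_0\,da\,db$, $I_t\to\varrho_0u_0\,da\,db$, $J_t\to\varrho_0v_0\,da\,db$ weakly as $t\to+0$. *Data.* Let $\mathcal G=\{(A(l),B(l)):l\in\mathbb R\}$ be a $C^1$ curve with $A_l\ge0$, $B_l\ge0$, $A_l^2+B_l^2\ne0$, which is the zero set of some $G\in C^1(\mathbb R^2)$; put $\mathcal G^\pm=\{\pm G>0\}$. Let $\varrho_\pm>0$, $u_\pm$, $v_\pm$ be $C^1$ on $\overline{\mathcal G^\pm}$, let $$\varrho_0=\varrho_-+(\varrho_+-\varrho_-)H(G),\quad u_0=u_-+(u_+-u_-)H(G),\quad v_0=v_-+(v_+-v_-)H(G) \tag{11}$$ with the Heaviside function $H$, and suppose that $A_lv_--B_lu_-<0$ and $A_lv_+-B_lu_+>0$ on $\mathcal G$. *Shock front.* Let $S\in C^1([0,T)\times\mathbb R^2)$ with $\nabla_{(x,y)}S\neq0$ on $\mathcal S=\{S=0\}$ and $\{\pm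 S(0,\cdot)>0\}=\mathcal G^\pm$ (so $\mathcal S\cap\{t=0\}=\mathcal G$). Let $\varrho_j,u_j,v_j\in C^1([0,T)\times\mathbb R^2)$, $j=\pm$, be functions, denoted like the data, that equal the data $\varrho_j,u_j,v_j$ on $\overline{\mathcal G^j}$ at $t=0$ and satisfy (1) classically in $\{jS>0\}$, $0<t<T$. Let $(t,l)\mapsto(t,x^s(t,l),y^s(t,l))$, $(t,l)\in[0,T)\times\mathbb R$, be a regular $C^1$ parametrization of $\mathcal S$ (a homeomorphism onto $\mathcal S$ with $(x^s_l,y^s_l)\ne(0,0)$) with $(x^s,y^s)(0,l)=(A(l),B(l))$; write $\widetilde u=\partial_tx^s$, $\widetilde v=\partial_ty^s$. Let $a_\pm,b_\pm$ be $C^1$ functions on $[0,T)\times\mathbb R$ giving the initial positions of the characteristics that come to the points of $\mathcal S$ from the two sides: with $u_\pm,v_\pm$ denoting the initial velocities, $$x^s=a_\pm+t\,u_\pm(a_\pm,b_\pm),\qquad y^s=b_\pm+t\,v_\pm(a_\pm,b_\pm),$$ and for $0\le\tau<t$ the point $(a_\pm+\tau u_\pm(a_\pm,b_\pm),\,b_\pm+\tau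 v_\pm(a_\pm,b_\pm))$, where $a_\pm=a_\pm(t,l)$, $b_\pm=b_\pm(t,l)$, lies in $\{\pm S(\tau,\cdot)>0\}$. Finally let $\widetilde P_t,\widetilde I_t,\widetilde J_t$ be $C^1$ functions of $(t,l)\in[0,T)\times\mathbb R$. *Claim.* The following are equivalent. (i) There is a generalized solution on $(0,T)$ with data (11) of the form $$\begin{aligned}P_t&=\varrho_-+(\varrho_+-\varrho_-)H(S)+\widetilde P_t\,\delta(S),\\ I_t&=\varrho_-u_-+(\varrho_+u_+-\varrho_-u_-)H(S)+\widetilde I_t\,\delta(S),\\ J_t&=\varrho_-v_-+(\varrho_+v_+-\varrho_-v_-)H(S)+\widetilde J_t\,\delta(S),\end{aligned}\tag{12}$$ where $w\,\delta(S)$ denotes the measure $\varphi\mapsto\int\varphi(x^s(t,l),y^s(t,l))\,w(t,l)\,dl$, and whose velocity on $\mathcal S$ has the curves $t\mapsto(x^s,y^s)(t,l)$ as its integral curves, i.e. $(\widetilde u,\widetilde v)=(dI_t/dP_t,dJ_t/dP_t)$ at $P_t$-almost every point of $\mathcal S\cap\{t\}\times\mathbb R^2$, for a.e. $t$. (ii)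 For all $l$ and $0<t<T$, $\widetilde P_t\neq0$ and $$\widetilde u=\widetilde I_t/\widetilde P_t,\qquad \widetilde v=\widetilde J_t/\widetilde P_t;$$ and for all $l$ and $0\le t<T$, with $\Delta_\pm=(a_\pm)_\tau(b_\pm)_l-(b_\pm)_\tau(a_\pm)_l$ and $\varrho_0^\pm,u_0^\pm,v_0^\pm$ denoting $\varrho_0,u_0,v_0$ at $(a_\pm,b_\pm)(\tau,l)$, $$\widetilde P_t=\int_0^t[\varrho_0^+\Delta_+-\varrho_0^-\Delta_-]\,d\tau,\quad \widetilde I_t=\int_0^t[\varrho_0^+u_0^+\Delta_+-\varrho_0^-u_0^-\Delta_-]\,d\tau,\quad \widetilde J_t=\int_0^t[\varrho_0^+v_0^+\Delta_+-\varrho_0^-v_0^-\Delta_-]\,d\tau.$$ -/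

import Mathlib

open MeasureTheory Set Filter Topology

/-- The time interval `[0, T)`; the value `T = ⊤` gives the half-line `[0, ∞)`. -/
def timeIco (T : EReal) : Set ℝ := {t | 0 ≤ t ∧ (t : EReal) < T}

/-- The time interval `(0, T)`. -/
def timeIoo (T : EReal) : Set ℝ := {t | 0 < t ∧ (t : EReal) < T}

/-- The Heaviside function (its value at `0` is immaterial). -/
noncomputable def heavi (s : ℝ) : ℝ := if 0 < s then 1 else 0

/-- `∂f/∂x` for a function on the plane. -/
noncomputable def partialX (f : ℝ × ℝ → ℝ) (z : ℝ × ℝ) : ℝ := deriv (fun x => f (x, z.2)) z.1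

/-- `∂f/∂y` for a function on the plane. -/
noncomputable def partialY (f : ℝ × ℝ → ℝ) (z : ℝ × ℝ) : ℝ := deriv (fun y => f (z.1, y)) z.2

/-! ### Radon measures and generalized solutions -/

/-- A signed (real) Radon measure on the plane, given by its Jordan decomposition. The total
variation may be infinite, but it is finite on compact sets. -/
structure SignedRadonMeasure where
  pos : Measure (ℝ × ℝ)
  neg : Measure (ℝ × ℝ)
  pos_locallyFinite : IsLocallyFiniteMeasure pos
  neg_locallyFinite : IsLocallyFiniteMeasure neg
  mutuallySingular : pos.MutuallySingular neg

namespace SignedRadonMeasure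

/-- The total variation measure. -/
noncomputable def totalVar (I : SignedRadonMeasure) : Measure (ℝ × ℝ) := I.pos + I.neg

/-- The integral of `φ` against a signed Radon measure. -/
noncomputable def integral (I : SignedRadonMeasure) (φ : ℝ × ℝ → ℝ) : ℝ :=
  (∫ z, φ z ∂I.pos) - ∫ z, φ z ∂I.neg

/-- Absolute continuity with respect to a nonnegative measure. -/
def AbsCont (I : SignedRadonMeasure) (P : Measure (ℝ × ℝ)) : Prop :=
  I.totalVar.AbsolutelyContinuous P

/-- The Radon-Nikodym derivative `dI/dP`. -/
noncomputable def density (I : SignedRadonMeasure) (P : Measure (ℝ × ℝ)) (z : ℝ × ℝ) : ℝ :=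
  (I.pos.rnDeriv P z).toReal - (I.neg.rnDeriv P z).toReal

end SignedRadonMeasure

/-- Generalized solutions, on the time interval `(0, T)`, of the Cauchy problem for the system of
2-D pressureless gas dynamics with initial density `rho0` and initial velocity `(u0, v0)`. The
velocity of the solution is `((I t).density (P t), (J t).density (P t))`. The three
`locallyIntegrable` clauses and the `IntervalIntegrable` clauses say that the integrals occurring
in the three balance laws exist. -/
structure IsGeneralizedSolution (T : EReal) (rho0 u0 v0 : ℝ × ℝ → ℝ)
    (P : ℝ → Measure (ℝ × ℝ)) (I J : ℝ → SignedRadonMeasure) : Prop where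
  radon : ∀ t ∈ timeIoo T, IsLocallyFiniteMeasure (P t)
  weakCont_P : ∀ φ : ℝ × ℝ → ℝ, Continuous φ → HasCompactSupport φ →
    ContinuousOn (fun t => ∫ z, φ z ∂P t) (timeIoo T)
  weakCont_I : ∀ φ : ℝ × ℝ → ℝ, Continuous φ → HasCompactSupport φ →
    ContinuousOn (fun t => (I t).integral φ) (timeIoo T)
  weakCont_J : ∀ φ : ℝ × ℝ → ℝ, Continuous φ → HasCompactSupport φ →
    ContinuousOn (fun t => (J t).integral φ) (timeIoo T)
  absCont : ∀ᵐ t : ℝ, t ∈ timeIoo T → (I t).AbsCont (P t) ∧ (J t).AbsCont (P t)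
  locallyIntegrable_I : ∀ᵐ t : ℝ, t ∈ timeIoo T →
    LocallyIntegrable ((I t).density (P t)) (I t).totalVar ∧
    LocallyIntegrable ((J t).density (P t)) (I t).totalVar
  locallyIntegrable_J : ∀ᵐ t : ℝ, t ∈ timeIoo T →
    LocallyIntegrable ((I t).density (P t)) (J t).totalVar ∧
    LocallyIntegrable ((J t).density (P t)) (J t).totalVar
  mass : ∀ f : ℝ × ℝ → ℝ, ContDiff ℝ 1 f → HasCompactSupport f →
    ∀ t₁ ∈ timeIoo T, ∀ t₂ ∈ timeIoo T, t₁ < t₂ →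
      IntervalIntegrable
        (fun τ => (I τ).integral (partialX f) + (J τ).integral (partialY f)) volume t₁ t₂ ∧
      (∫ z, f z ∂P t₂) - (∫ z, f z ∂P t₁) =
        ∫ τ in t₁..t₂, ((I τ).integral (partialX f) + (J τ).integral (partialY f))
  momentum_x : ∀ g : ℝ × ℝ → ℝ, ContDiff ℝ 1 g → HasCompactSupport g →
    ∀ t₁ ∈ timeIoo T, ∀ t₂ ∈ timeIoo T, t₁ < t₂ →
      IntervalIntegrable
        (fun τ => (I τ).integral (fun z => partialX g z * (I τ).density (P τ) z) +
          (I τ).integral (fun z => partialY g z * (J τ).density (P τ) z)) volume t₁ t₂ ∧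
      (I t₂).integral g - (I t₁).integral g =
        ∫ τ in t₁..t₂, ((I τ).integral (fun z => partialX g z * (I τ).density (P τ) z) +
          (I τ).integral (fun z => partialY g z * (J τ).density (P τ) z))
  momentum_y : ∀ h : ℝ × ℝ → ℝ, ContDiff ℝ 1 h → HasCompactSupport h →
    ∀ t₁ ∈ timeIoo T, ∀ t₂ ∈ timeIoo T, t₁ < t₂ →
      IntervalIntegrable
        (fun τ => (J τ).integral (fun z => partialX h z * (I τ).density (P τ) z) +
          (J τ).integral (fun z => partialY h z * (J τ).density (P τ) z)) volume t₁ t₂ ∧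
      (J t₂).integral h - (J t₁).integral h =
        ∫ τ in t₁..t₂, ((J τ).integral (fun z => partialX h z * (I τ).density (P τ) z) +
          (J τ).integral (fun z => partialY h z * (J τ).density (P τ) z))
  initial_P : ∀ φ : ℝ × ℝ → ℝ, Continuous φ → HasCompactSupport φ →
    Tendsto (fun t => ∫ z, φ z ∂P t) (𝓝[>] 0) (𝓝 (∫ z, φ z * rho0 z))
  initial_I : ∀ φ : ℝ × ℝ → ℝ, Continuous φ → HasCompactSupport φ →
    Tendsto (fun t => (I t).integral φ) (𝓝[>] 0) (𝓝 (∫ z, φ z * (rho0 z * u0 z)))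
  initial_J : ∀ φ : ℝ × ℝ → ℝ, Continuous φ → HasCompactSupport φ →
    Tendsto (fun t => (J t).integral φ) (𝓝[>] 0) (𝓝 (∫ z, φ z * (rho0 z * v0 z)))

/-! ### The piecewise smooth Cauchy data -/

/-- Density and velocity as functions on the plane. -/
structure PlaneState where
  rho : ℝ × ℝ → ℝ
  u : ℝ × ℝ → ℝ
  v : ℝ × ℝ → ℝ

/-- A curve `l ↦ (A l, B l)`, a function `G` that vanishes exactly on it, and the two states on
the two sides `G < 0` (`minus`) and `G > 0` (`plus`). -/
structure CauchyData where
  A : ℝ → ℝ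
  B : ℝ → ℝ
  G : ℝ × ℝ → ℝ
  minus : PlaneState
  plus : PlaneState

namespace CauchyData

/-- The side `G < 0`. -/
def sideMinus (D : CauchyData) : Set (ℝ × ℝ) := {z | D.G z < 0}

/-- The side `G > 0`. -/
def sidePlus (D : CauchyData) : Set (ℝ × ℝ) := {z | 0 < D.G z}

/-- The initial density. -/
noncomputable def rho0 (D : CauchyData) (z : ℝ × ℝ) : ℝ :=
  D.minus.rho z + (D.plus.rho z - D.minus.rho z) * heavi (D.G z)

/-- The first component of the initial velocity. -/
noncomputable def u0 (D : CauchyData) (z : ℝ × ℝ) : ℝ :=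
  D.minus.u z + (D.plus.u z - D.minus.u z) * heavi (D.G z)

/-- The second component of the initial velocity. -/
noncomputable def v0 (D : CauchyData) (z : ℝ × ℝ) : ℝ :=
  D.minus.v z + (D.plus.v z - D.minus.v z) * heavi (D.G z)

end CauchyData

/-- A state on a closed set `K`: `C¹` up to the boundary and with positive density. -/
structure PlaneState.IsSmoothOn (s : PlaneState) (K : Set (ℝ × ℝ)) : Prop where
  rho_smooth : ContDiffOn ℝ 1 s.rho K
  u_smooth : ContDiffOn ℝ 1 s.u K
  v_smooth : ContDiffOn ℝ 1 s.v K
  rho_pos : ∀ z ∈ K, 0 < s.rho z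

/-- The standing conditions on the curve and on the two states. The two `compress` fields say that
the velocities on both sides point towards the curve. -/
structure CauchyData.IsAdmissible (D : CauchyData) : Prop where
  A_smooth : ContDiff ℝ 1 D.A
  B_smooth : ContDiff ℝ 1 D.B
  A_mono : ∀ l, 0 ≤ deriv D.A l
  B_mono : ∀ l, 0 ≤ deriv D.B l
  curve_regular : ∀ l, deriv D.A l ^ 2 + deriv D.B l ^ 2 ≠ 0
  G_smooth : ContDiff ℝ 1 D.G
  G_zero : ∀ z, D.G z = 0 ↔ ∃ l, z = (D.A l, D.B l)
  minus_smooth : D.minus.IsSmoothOn (closure D.sideMinus)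
  plus_smooth : D.plus.IsSmoothOn (closure D.sidePlus)
  compress_minus : ∀ l, deriv D.A l * D.minus.v (D.A l, D.B l)
    - deriv D.B l * D.minus.u (D.A l, D.B l) < 0
  compress_plus : ∀ l, 0 < deriv D.A l * D.plus.v (D.A l, D.B l)
    - deriv D.B l * D.plus.u (D.A l, D.B l)

/-! ### Shock fronts -/

/-- Density and velocity as functions of time and position. -/
structure FlowField where
  rho : ℝ → ℝ × ℝ → ℝ
  u : ℝ → ℝ × ℝ → ℝ
  v : ℝ → ℝ × ℝ → ℝ

/-- The system of pressureless gas dynamics holds at `(t, z)` in the classical sense. -/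
def FlowField.SolvesAt (F : FlowField) (t : ℝ) (z : ℝ × ℝ) : Prop :=
  (deriv (fun s => F.rho s z) t
    + partialX (fun w => F.rho t w * F.u t w) z
    + partialY (fun w => F.rho t w * F.v t w) z = 0) ∧
  (deriv (fun s => F.rho s z * F.u s z) t
    + partialX (fun w => F.rho t w * F.u t w ^ 2) z
    + partialY (fun w => F.rho t w * F.u t w * F.v t w) z = 0) ∧
  (deriv (fun s => F.rho s z * F.v s z) t
    + partialX (fun w => F.rho t w * F.u t w * F.v t w) z
    + partialY (fun w => F.rho t w * F.v t w ^ 2) z = 0)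

/-- The ingredients of a single shock front: the smooth fields `minus`, `plus` on its two sides,
the function `S` whose zero set is the shock surface, the parametrization
`(t, l) ↦ (t, xs t l, ys t l)` of the surface, the initial positions `(am t l, bm t l)` and
`(ap t l, bp t l)` of the characteristics that reach the point `(t, xs t l, ys t l)` from the two
sides, and the surface mass `Pt` and surface momenta `It`, `Jt` (densities with respect
to `dl`). -/
structure ShockFront where
  minus : FlowField
  plus : FlowField
  S : ℝ → ℝ × ℝ → ℝ
  xs : ℝ → ℝ → ℝ
  ys : ℝ → ℝ → ℝ
  am : ℝ → ℝ → ℝ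
  bm : ℝ → ℝ → ℝ
  ap : ℝ → ℝ → ℝ
  bp : ℝ → ℝ → ℝ
  Pt : ℝ → ℝ → ℝ
  It : ℝ → ℝ → ℝ
  Jt : ℝ → ℝ → ℝ

/-- A field `F` on the side `{σ S > 0}` (`σ = 1` or `σ = -1`) of the surface `S = 0`: it is `C¹` up
to `t = 0`, satisfies the system classically on that side, and starts from the state `s` on the
closed set `K`. -/
structure FlowField.IsSideField (F : FlowField) (T : EReal) (S : ℝ → ℝ × ℝ → ℝ) (σ : ℝ)
    (s : PlaneState) (K : Set (ℝ × ℝ)) : Prop where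
  rho_smooth : ContDiffOn ℝ 1 (Function.uncurry F.rho) (timeIco T ×ˢ univ)
  u_smooth : ContDiffOn ℝ 1 (Function.uncurry F.u) (timeIco T ×ˢ univ)
  v_smooth : ContDiffOn ℝ 1 (Function.uncurry F.v) (timeIco T ×ˢ univ)
  solves : ∀ t ∈ timeIoo T, ∀ z, 0 < σ * S t z → F.SolvesAt t z
  rho_initial : ∀ z ∈ K, F.rho 0 z = s.rho z
  u_initial : ∀ z ∈ K, F.u 0 z = s.u z
  v_initial : ∀ z ∈ K, F.v 0 z = s.v z

/-- `(a t l, b t l)` is the initial position of the characteristic line of the initial velocity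
`(s.u, s.v)` that comes to the point `(xs t l, ys t l)` of the surface `S = 0` at time `t` from the
side `{σ S > 0}`. -/
structure IsInitialPosition (T : EReal) (S : ℝ → ℝ × ℝ → ℝ) (σ : ℝ) (s : PlaneState)
    (xs ys a b : ℝ → ℝ → ℝ) : Prop where
  a_smooth : ContDiffOn ℝ 1 (Function.uncurry a) (timeIco T ×ˢ univ)
  b_smooth : ContDiffOn ℝ 1 (Function.uncurry b) (timeIco T ×ˢ univ)
  reach_x : ∀ t ∈ timeIco T, ∀ l, xs t l = a t l + t * s.u (a t l, b t l)
  reach_y : ∀ t ∈ timeIco T, ∀ l, ys t l = b t l + t * s.v (a t l, b t l)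
  from_side : ∀ t ∈ timeIoo T, ∀ l, ∀ τ, 0 ≤ τ → τ < t →
    0 < σ * S τ (a t l + τ * s.u (a t l, b t l), b t l + τ * s.v (a t l, b t l))

namespace ShockFront

/-- The geometry and regularity of a shock front, on the time interval `[0, T)`, that issues from
the discontinuity curve of the data `D`. -/
structure IsFrontFor (F : ShockFront) (T : EReal) (D : CauchyData) : Prop where
  S_smooth : ContDiffOn ℝ 1 (Function.uncurry F.S) (timeIco T ×ˢ univ)
  S_regular : ∀ t ∈ timeIco T, ∀ z, F.S t z = 0 → fderiv ℝ (F.S t) z ≠ 0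
  S_initial_minus : ∀ z, F.S 0 z < 0 ↔ z ∈ D.sideMinus
  S_initial_plus : ∀ z, 0 < F.S 0 z ↔ z ∈ D.sidePlus
  field_minus : F.minus.IsSideField T F.S (-1) D.minus (closure D.sideMinus)
  field_plus : F.plus.IsSideField T F.S 1 D.plus (closure D.sidePlus)
  xs_smooth : ContDiffOn ℝ 1 (Function.uncurry F.xs) (timeIco T ×ˢ univ)
  ys_smooth : ContDiffOn ℝ 1 (Function.uncurry F.ys) (timeIco T ×ˢ univ)
  xs_initial : ∀ l, F.xs 0 l = D.A l
  ys_initial : ∀ l, F.ys 0 l = D.B l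
  surface : ∀ t ∈ timeIco T, ∀ z, F.S t z = 0 ↔ ∃ l, z = (F.xs t l, F.ys t l)
  embedding : IsEmbedding
    (fun p : timeIco T × ℝ => ((p.1 : ℝ), (F.xs p.1 p.2, F.ys p.1 p.2)))
  immersion : ∀ t ∈ timeIco T, ∀ l, (deriv (F.xs t) l, deriv (F.ys t) l) ≠ (0, 0)
  position_minus : IsInitialPosition T F.S (-1) D.minus F.xs F.ys F.am F.bm
  position_plus : IsInitialPosition T F.S 1 D.plus F.xs F.ys F.ap F.bp
  Pt_smooth : ContDiffOn ℝ 1 (Function.uncurry F.Pt) (timeIco T ×ˢ univ)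
  It_smooth : ContDiffOn ℝ 1 (Function.uncurry F.It) (timeIco T ×ˢ univ)
  Jt_smooth : ContDiffOn ℝ 1 (Function.uncurry F.Jt) (timeIco T ×ˢ univ)

/-- The action on `φ` of the measure `m₋ + (m₊ - m₋) H(S) + w δ(S)` at time `t`, where `w` is a
density with respect to the parameter `l` on the curve `l ↦ (xs t l, ys t l)`. -/
noncomputable def action (F : ShockFront) (mMinus mPlus : ℝ × ℝ → ℝ) (w : ℝ → ℝ) (t : ℝ)
    (φ : ℝ × ℝ → ℝ) : ℝ :=
  (∫ z, φ z * (mMinus z + (mPlus z - mMinus z) * heavi (F.S t z)))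
    + ∫ l, φ (F.xs t l, F.ys t l) * w l

/-- The measures `P t`, `I t`, `J t` are the smooth fields on the two sides of the front plus the
delta-functions `Pt δ(S)`, `It δ(S)`, `Jt δ(S)` on the front (Radon measures being determined by
their integrals of continuous functions with compact support). -/
def HasForm (F : ShockFront) (T : EReal) (P : ℝ → Measure (ℝ × ℝ))
    (I J : ℝ → SignedRadonMeasure) : Prop :=
  ∀ t ∈ timeIoo T, ∀ φ : ℝ × ℝ → ℝ, Continuous φ → HasCompactSupport φ →
    (∫ z, φ z ∂P t) = F.action (F.minus.rho t) (F.plus.rho t) (F.Pt t) t φ ∧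
    (I t).integral φ = F.action (fun z => F.minus.rho t z * F.minus.u t z)
      (fun z => F.plus.rho t z * F.plus.u t z) (F.It t) t φ ∧
    (J t).integral φ = F.action (fun z => F.minus.rho t z * F.minus.v t z)
      (fun z => F.plus.rho t z * F.plus.v t z) (F.Jt t) t φ

/-- The curves `t ↦ (xs t l, ys t l)` are integral curves of the velocity `(dI/dP, dJ/dP)` of
the solution on the shock surface. -/
def FollowsVelocity (F : ShockFront) (T : EReal) (P : ℝ → Measure (ℝ × ℝ))
    (I J : ℝ → SignedRadonMeasure) : Prop :=
  ∀ᵐ t : ℝ, t ∈ timeIoo T → ∀ᵐ z ∂P t, ∀ l, z = (F.xs t l, F.ys t l) →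
    deriv (fun s => F.xs s l) t = (I t).density (P t) z ∧
    deriv (fun s => F.ys s l) t = (J t).density (P t) z

/-- `a_τ b_l - b_τ a_l`. -/
noncomputable def jac (a b : ℝ → ℝ → ℝ) (τ l : ℝ) : ℝ :=
  deriv (fun s => a s l) τ * deriv (fun m => b τ m) l
    - deriv (fun s => b s l) τ * deriv (fun m => a τ m) l

/-- The time integral over `[0, t]` of the flux of the quantity with initial density `w` into the
shock front from both sides. -/
noncomputable def influx (F : ShockFront) (w : ℝ × ℝ → ℝ) (t l : ℝ) : ℝ :=
  ∫ τ in (0 : ℝ)..t, (w (F.ap τ l, F.bp τ l) * jac F.ap F.bp τ l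
    - w (F.am τ l, F.bm τ l) * jac F.am F.bm τ l)

end ShockFront

/-! ### Chain rules in terms of partial derivatives -/

/-! Consider a measure made of a smooth density on each side of the front and a sheet with density
`w`, tested against a fixed `f`. Its time derivative can be computed. By the conservation law on
each side and the divergence theorem, the moving boundary contributes only the flux of each field
relative to the front. If the sheet moves with velocity $(x^s_t,y^s_t)$, the derivative is the
action of the currents on $\nabla f$ plus $\int f\,(w_t-Q)\,dl$, where $Q$ is the net flux into the
front (`regionBalanceAt`, `IsFrontFor.hasDerivAt_action`). The front is properly embedded, so test
functions can be concentrated near any of its points. Hence the balance law holds for all `f`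
exactly when $w_t=Q$, and the initial data are attained exactly when $w=0$ at $t=0$; together these
say $w=\int_0^tQ\,d\tau$ (`IsBalanced.eq_integral_of_balance`, `IsBalanced.balance_of_eq_integral`).

It remains to recognize $Q$. Smooth flow moves along straight lines with constant velocity, and the
density times the Jacobian of the family of characteristics is conserved along each of them.
Therefore the flux of mass into the front from either side equals $\varrho_0\Delta$ at the foot of
the characteristic (`IsFrontSide.rho_mul_relativeSweep`), and the momentum flux carries the
additional factor $u_0$ or $v_0$. The density is assumed positive only initially, and the velocity
equations determine the velocity only where the density is nonzero. Both facts are therefore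
propagated together (`coupled_linear_ode`).

Division by $\widetilde P_t$ needs its positivity. Characteristics hit the front from their own
side, which fixes the signs of the two relative fluxes once the orientation of the front is known.
The orientation follows from the compression condition at $t=0$ and persists because the normal
derivative of $S$ never vanishes (`IsFrontFor.normalDeriv_lt_zero`). So $Q\ge0$ for mass, with
strict inequality shortly after $t=0$ (`IsFrontFor.influx_rho0_pos`).

The link with Radon-Nikodym derivatives is made at a fixed time. A functional given by a density on
the plane and a density on a null curve determines both (`eq_zero_of_integral_add_integral_curve`).
Consequently the prescribed velocity on the front means $\widetilde I_t=x^s_t\widetilde P_t$,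
$\widetilde J_t=y^s_t\widetilde P_t$, and the nonlinear fluxes have the expected form
(`IsSheetAt.relation`). Conversely, velocities glued from the two sides and the front, multiplied by
$P_t$, define the required measures (`IsFrontFor.exists_isSheetAt`). -/

theorem hasDerivAt_comp_plane {f : ℝ × ℝ → ℝ} {X Y : ℝ → ℝ} {X' Y' s : ℝ}
    (hf : DifferentiableAt ℝ f (X s, Y s)) (hX : HasDerivAt X X' s) (hY : HasDerivAt Y Y' s) :
    HasDerivAt (fun r => f (X r, Y r))
      (partialX f (X s, Y s) * X' + partialY f (X s, Y s) * Y') s := by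
  have h := hf.hasFDerivAt.comp_hasDerivAt s (hX.prodMk hY)
  have h1 : partialX f (X s, Y s) = fderiv ℝ f (X s, Y s) (1, 0) := by
    have h' : DifferentiableAt ℝ f ((fun x : ℝ => (x, Y s)) (X s)) := hf
    have := (h'.hasFDerivAt.comp_hasDerivAt (X s)
      ((hasDerivAt_id (X s)).prodMk (hasDerivAt_const (X s) (Y s)))).deriv
    exact this
  have h2 : partialY f (X s, Y s) = fderiv ℝ f (X s, Y s) (0, 1) := by
    have h' : DifferentiableAt ℝ f ((fun y : ℝ => (X s, y)) (Y s)) := hf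
    have := (h'.hasFDerivAt.comp_hasDerivAt (Y s)
      ((hasDerivAt_const (Y s) (X s)).prodMk (hasDerivAt_id (Y s)))).deriv
    exact this
  convert! h using 1
  rw [h1, h2]
  have : ((X', Y') : ℝ × ℝ) = X' • ((1 : ℝ), (0 : ℝ)) + Y' • ((0 : ℝ), (1 : ℝ)) := by simp
  rw [this, map_add, map_smul, map_smul]
  simp only [smul_eq_mul]
  ring

theorem partialX_eq_fderiv {f : ℝ × ℝ → ℝ} {z : ℝ × ℝ} (hf : DifferentiableAt ℝ f z) :
    partialX f z = fderiv ℝ f z (1, 0) :=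
  (HasFDerivAt.comp_hasDerivAt (f := fun x : ℝ => (x, z.2)) z.1 (hf.hasFDerivAt)
      ((hasDerivAt_id z.1).prodMk (hasDerivAt_const z.1 z.2))).deriv

theorem partialY_eq_fderiv {f : ℝ × ℝ → ℝ} {z : ℝ × ℝ} (hf : DifferentiableAt ℝ f z) :
    partialY f z = fderiv ℝ f z (0, 1) :=
  (HasFDerivAt.comp_hasDerivAt (f := fun y : ℝ => (z.1, y)) z.2 (hf.hasFDerivAt)
      ((hasDerivAt_const z.2 z.1).prodMk (hasDerivAt_id z.2))).deriv

theorem hasDerivAt_partialX {f : ℝ × ℝ → ℝ} {x y : ℝ} (hf : DifferentiableAt ℝ f (x, y)) :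
    HasDerivAt (fun r => f (r, y)) (partialX f (x, y)) x := by
  simpa using hasDerivAt_comp_plane (X := fun r => r) (Y := fun _ => y) hf (hasDerivAt_id x)
    (hasDerivAt_const x y)

theorem hasDerivAt_partialY {f : ℝ × ℝ → ℝ} {x y : ℝ} (hf : DifferentiableAt ℝ f (x, y)) :
    HasDerivAt (fun r => f (x, r)) (partialY f (x, y)) y := by
  simpa using hasDerivAt_comp_plane (X := fun _ => x) (Y := fun r => r) hf (hasDerivAt_const y x)
    (hasDerivAt_id y)

theorem partialX_mul {f g : ℝ × ℝ → ℝ} {z : ℝ × ℝ} (hf : DifferentiableAt ℝ f z)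
    (hg : DifferentiableAt ℝ g z) :
    partialX (fun w => f w * g w) z = partialX f z * g z + f z * partialX g z :=
  ((hasDerivAt_partialX (x := z.1) (y := z.2) hf).mul
    (hasDerivAt_partialX (x := z.1) (y := z.2) hg)).deriv

theorem partialY_mul {f g : ℝ × ℝ → ℝ} {z : ℝ × ℝ} (hf : DifferentiableAt ℝ f z)
    (hg : DifferentiableAt ℝ g z) :
    partialY (fun w => f w * g w) z = partialY f z * g z + f z * partialY g z :=
  ((hasDerivAt_partialY (x := z.1) (y := z.2) hf).mul
    (hasDerivAt_partialY (x := z.1) (y := z.2) hg)).deriv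

theorem partialX_congr_nhds {f g : ℝ × ℝ → ℝ} {z : ℝ × ℝ} (h : f =ᶠ[𝓝 z] g) :
    partialX f z = partialX g z := by
  refine Filter.EventuallyEq.deriv_eq ?_
  exact (Continuous.tendsto' (by fun_prop) z.1 z rfl :
    Tendsto (fun x : ℝ => (x, z.2)) (𝓝 z.1) (𝓝 z)).eventually h

theorem partialY_congr_nhds {f g : ℝ × ℝ → ℝ} {z : ℝ × ℝ} (h : f =ᶠ[𝓝 z] g) :
    partialY f z = partialY g z := by
  refine Filter.EventuallyEq.deriv_eq ?_
  exact (Continuous.tendsto' (by fun_prop) z.2 z rfl :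
    Tendsto (fun y : ℝ => (z.1, y)) (𝓝 z.2) (𝓝 z)).eventually h

theorem DifferentiableAt.slice {M : ℝ → ℝ × ℝ → ℝ} {t : ℝ} {z : ℝ × ℝ}
    (h : DifferentiableAt ℝ (Function.uncurry M) (t, z)) : DifferentiableAt ℝ (M t) z :=
  DifferentiableAt.comp z (g := Function.uncurry M) (f := fun w : ℝ × ℝ => (t, w)) h (by fun_prop)

theorem DifferentiableAt.timeSlice {E : Type*} [NormedAddCommGroup E] [NormedSpace ℝ E]
    {M : ℝ → E → ℝ} {t : ℝ} {z : E}
    (h : DifferentiableAt ℝ (Function.uncurry M) (t, z)) :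
    DifferentiableAt ℝ (fun s => M s z) t :=
  DifferentiableAt.comp t (g := Function.uncurry M) (f := fun s : ℝ => (s, z)) h (by fun_prop)

theorem hasDerivAt_comp_flow {M : ℝ → ℝ × ℝ → ℝ} {X Y : ℝ → ℝ} {X' Y' t : ℝ}
    (hM : DifferentiableAt ℝ (Function.uncurry M) (t, (X t, Y t)))
    (hX : HasDerivAt X X' t) (hY : HasDerivAt Y Y' t) :
    HasDerivAt (fun r => M r (X r, Y r))
      (deriv (fun s => M s (X t, Y t)) t + partialX (M t) (X t, Y t) * X'
        + partialY (M t) (X t, Y t) * Y') t := by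
  have h := HasFDerivAt.comp_hasDerivAt (f := fun r : ℝ => (r, (X r, Y r))) t hM.hasFDerivAt
    ((hasDerivAt_id t).prodMk (hX.prodMk hY))
  have h0 : deriv (fun s => M s (X t, Y t)) t
      = fderiv ℝ (Function.uncurry M) (t, (X t, Y t)) (1, 0) := by
    exact (HasFDerivAt.comp_hasDerivAt (f := fun r : ℝ => (r, (X t, Y t))) t hM.hasFDerivAt
      ((hasDerivAt_id t).prodMk (hasDerivAt_const t (X t, Y t)))).deriv
  have h1 : ∀ w : ℝ × ℝ, fderiv ℝ (M t) (X t, Y t) w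
      = fderiv ℝ (Function.uncurry M) (t, (X t, Y t)) (0, w) := by
    intro w
    have := (HasFDerivAt.comp (f := fun r : ℝ × ℝ => (t, r)) (X t, Y t) hM.hasFDerivAt
      ((hasFDerivAt_const t (X t, Y t)).prodMk (hasFDerivAt_id (X t, Y t)))).fderiv
    have h2 : fderiv ℝ (M t) (X t, Y t) = _ := this
    rw [h2]; simp
  rw [partialX_eq_fderiv hM.slice, partialY_eq_fderiv hM.slice, h0, h1, h1]
  convert! h using 1
  have : ((1, (X', Y')) : ℝ × (ℝ × ℝ)) = ((1 : ℝ), (0 : ℝ × ℝ))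
      + X' • ((0 : ℝ), ((1 : ℝ), (0 : ℝ))) + Y' • ((0 : ℝ), ((0 : ℝ), (1 : ℝ))) := by simp
  rw [this, map_add, map_add, map_smul, map_smul]
  simp only [smul_eq_mul]
  ring

/-! ### Continuity of the partial derivatives -/

section Slices

variable {E : Type*} [NormedAddCommGroup E] [NormedSpace ℝ E]

theorem fderiv_slice_eq {M : ℝ → E → ℝ} {t : ℝ} {z : E}
    (h : DifferentiableAt ℝ (Function.uncurry M) (t, z)) (w : E) :
    fderiv ℝ (M t) z w = fderiv ℝ (Function.uncurry M) (t, z) (0, w) := by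
  have := (HasFDerivAt.comp (f := fun r : E => (t, r)) z h.hasFDerivAt
      ((hasFDerivAt_const t z).prodMk (hasFDerivAt_id z))).fderiv
  have h2 : fderiv ℝ (M t) z = _ := this
  rw [h2]; simp

theorem deriv_timeSlice_eq {M : ℝ → E → ℝ} {t : ℝ} {z : E}
    (h : DifferentiableAt ℝ (Function.uncurry M) (t, z)) :
    deriv (fun s => M s z) t = fderiv ℝ (Function.uncurry M) (t, z) (1, 0) :=
  (HasFDerivAt.comp_hasDerivAt (f := fun r : ℝ => (r, z)) t h.hasFDerivAt
      ((hasDerivAt_id t).prodMk (hasDerivAt_const t z))).deriv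

theorem continuousOn_deriv_timeSlice {M : ℝ → E → ℝ} {J : Set ℝ} (hJ : IsOpen J)
    (hM : ContDiffOn ℝ 1 (Function.uncurry M) (J ×ˢ univ)) :
    ContinuousOn (fun p : ℝ × E => deriv (fun s => M s p.2) p.1) (J ×ˢ univ) := by
  have ho : IsOpen (J ×ˢ (univ : Set E)) := hJ.prod isOpen_univ
  have h := (hM.continuousOn_fderiv_of_isOpen ho le_rfl).clm_apply
    (continuousOn_const (c := ((1 : ℝ), (0 : E))))
  refine h.congr fun p hp => ?_
  exact deriv_timeSlice_eq ((hM.contDiffAt (ho.mem_nhds hp)).differentiableAt one_ne_zero)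

theorem continuousOn_fderiv_slice {M : ℝ → E → ℝ} {J : Set ℝ} (hJ : IsOpen J)
    (hM : ContDiffOn ℝ 1 (Function.uncurry M) (J ×ˢ univ)) (w : E) :
    ContinuousOn (fun p : ℝ × E => fderiv ℝ (M p.1) p.2 w) (J ×ˢ univ) := by
  have ho : IsOpen (J ×ˢ (univ : Set E)) := hJ.prod isOpen_univ
  have h := (hM.continuousOn_fderiv_of_isOpen ho le_rfl).clm_apply
    (continuousOn_const (c := ((0 : ℝ), w)))
  refine h.congr fun p hp => ?_
  exact fderiv_slice_eq ((hM.contDiffAt (ho.mem_nhds hp)).differentiableAt one_ne_zero) w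

end Slices

theorem continuousOn_partialX_slice {M : ℝ → ℝ × ℝ → ℝ} {J : Set ℝ} (hJ : IsOpen J)
    (hM : ContDiffOn ℝ 1 (Function.uncurry M) (J ×ˢ univ)) :
    ContinuousOn (fun p : ℝ × (ℝ × ℝ) => partialX (M p.1) p.2) (J ×ˢ univ) := by
  refine (continuousOn_fderiv_slice hJ hM (1, 0)).congr fun p hp => ?_
  exact partialX_eq_fderiv ((hM.contDiffAt ((hJ.prod isOpen_univ).mem_nhds hp)).differentiableAt
    one_ne_zero : DifferentiableAt ℝ (Function.uncurry M) (p.1, p.2)).slice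

theorem ContDiff.continuous_partialX {f : ℝ × ℝ → ℝ} (hf : ContDiff ℝ 1 f) :
    Continuous (partialX f) :=
  ((hf.continuous_fderiv one_ne_zero).clm_apply continuous_const).congr fun z =>
    (partialX_eq_fderiv (hf.differentiable one_ne_zero z)).symm

theorem ContDiff.continuous_partialY {f : ℝ × ℝ → ℝ} (hf : ContDiff ℝ 1 f) :
    Continuous (partialY f) :=
  ((hf.continuous_fderiv one_ne_zero).clm_apply continuous_const).congr fun z =>
    (partialY_eq_fderiv (hf.differentiable one_ne_zero z)).symm

theorem partialX_eq_zero_of_notMem_tsupport {f : ℝ × ℝ → ℝ} {z : ℝ × ℝ} (hz : z ∉ tsupport f) :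
    partialX f z = 0 := by
  rw [partialX_congr_nhds (g := fun _ => 0) (notMem_tsupport_iff_eventuallyEq.1 hz)]
  simp [partialX]

theorem partialY_eq_zero_of_notMem_tsupport {f : ℝ × ℝ → ℝ} {z : ℝ × ℝ} (hz : z ∉ tsupport f) :
    partialY f z = 0 := by
  rw [partialY_congr_nhds (g := fun _ => 0) (notMem_tsupport_iff_eventuallyEq.1 hz)]
  simp [partialY]

theorem HasCompactSupport.partialX {f : ℝ × ℝ → ℝ} (hf : HasCompactSupport f) :
    HasCompactSupport (partialX f) :=
  HasCompactSupport.intro hf fun _ h => partialX_eq_zero_of_notMem_tsupport h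

theorem HasCompactSupport.partialY {f : ℝ × ℝ → ℝ} (hf : HasCompactSupport f) :
    HasCompactSupport (partialY f) :=
  HasCompactSupport.intro hf fun _ h => partialY_eq_zero_of_notMem_tsupport h

/-! ### Extending fields that are only defined for some times -/

/-- A bump function cuts off the local domain, so that the implicit function can be treated as
globally $C^1$. -/
theorem exists_contDiff_eventuallyEq {E : Type*} [NormedAddCommGroup E] [NormedSpace ℝ E]
    [HasContDiffBump E] {f : E → ℝ} {x : E} (hf : ContDiffAt ℝ 1 f x) :
    ∃ g : E → ℝ, ContDiff ℝ 1 g ∧ g =ᶠ[𝓝 x] f := by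
  obtain ⟨u, hu, hfu⟩ := hf.contDiffOn' (m := 1) le_rfl (by simp)
  obtain ⟨hxu, hfu⟩ := hfu
  have hfu : ContDiffOn ℝ 1 f u := hfu.mono (by simp)
  obtain ⟨ε, hε, hball⟩ := Metric.isOpen_iff.1 hu x hxu
  let χ : ContDiffBump x := ⟨ε / 4, ε / 2, by positivity, by linarith⟩
  refine ⟨fun y => χ y * f y, ?_, ?_⟩
  · rw [contDiff_iff_contDiffAt]
    intro y
    by_cases hy : y ∈ u
    · exact χ.contDiff.contDiffAt.mul (hfu.contDiffAt (hu.mem_nhds hy))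
    · have : y ∉ tsupport χ := by
        rw [χ.tsupport_eq]
        intro h
        exact hy (hball (Metric.closedBall_subset_ball (by change ε / 2 < ε; linarith) h))
      have h0 : (fun y => χ y * f y) =ᶠ[𝓝 y] fun _ => 0 := by
        filter_upwards [notMem_tsupport_iff_eventuallyEq.1 this] with z hz
        simp [hz]
      exact contDiffAt_const.congr_of_eventuallyEq h0
  · filter_upwards [χ.eventuallyEq_one] with y hy
    simp [hy]

/-- The cutoff depends on time alone, so agreement near `t₀` holds for all points of space at once.
-/
theorem exists_contDiff_extend_time {E : Type*} [NormedAddCommGroup E] [NormedSpace ℝ E]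
    {M : ℝ → E → ℝ} {J : Set ℝ} (hJ : IsOpen J)
    (hM : ContDiffOn ℝ 1 (Function.uncurry M) (J ×ˢ univ)) {t₀ : ℝ} (ht₀ : t₀ ∈ J) :
    ∃ N : ℝ → E → ℝ, ContDiff ℝ 1 (Function.uncurry N) ∧ ∀ᶠ t in 𝓝 t₀, ∀ z, N t z = M t z := by
  obtain ⟨ε, hε, hball⟩ := Metric.isOpen_iff.1 hJ t₀ ht₀
  let χ : ContDiffBump t₀ := ⟨ε / 4, ε / 2, by positivity, by linarith⟩
  refine ⟨fun t z => χ t * M t z, ?_, ?_⟩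
  · rw [contDiff_iff_contDiffAt]
    rintro ⟨t, z⟩
    by_cases hy : t ∈ J
    · exact (χ.contDiff.comp contDiff_fst).contDiffAt.mul
        (hM.contDiffAt ((hJ.prod isOpen_univ).mem_nhds ⟨hy, mem_univ _⟩))
    · have : t ∉ tsupport χ := by
        rw [χ.tsupport_eq]
        intro h
        exact hy (hball (Metric.closedBall_subset_ball (by change ε / 2 < ε; linarith) h))
      have h0 : (Function.uncurry fun t z => χ t * M t z) =ᶠ[𝓝 (t, z)] fun _ => 0 := by
        filter_upwards [continuous_fst.continuousAt.eventually
          (notMem_tsupport_iff_eventuallyEq.1 this : ∀ᶠ s in 𝓝 t, χ s = 0)] with p hp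
        simp [Function.uncurry, hp]
      exact contDiffAt_const.congr_of_eventuallyEq h0
  · filter_upwards [χ.eventuallyEq_one] with y hy z
    simp [hy]

/-! ### Localization of test functions -/

/-- A partition of unity used one bump at a time. In `f = χ f + (1 - χ) f` the first summand lives
in one good neighbourhood, and the support of the second avoids the ball of radius `ε / 4` where `χ
= 1`. So one ball can be dropped from the finite cover of the support. -/
theorem testFunction_induction {p : (ℝ × ℝ → ℝ) → Prop} (h0 : p 0)
    (hadd : ∀ f g, ContDiff ℝ 1 f → HasCompactSupport f → ContDiff ℝ 1 g → HasCompactSupport g →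
      p f → p g → p (f + g))
    (hloc : ∀ z, ∃ U ∈ 𝓝 z, ∀ f, ContDiff ℝ 1 f → HasCompactSupport f → tsupport f ⊆ U → p f) :
    ∀ f, ContDiff ℝ 1 f → HasCompactSupport f → p f := by
  choose U hU hp using hloc
  have hball : ∀ z, ∃ ε > 0, Metric.ball z ε ⊆ U z := fun z => Metric.mem_nhds_iff.1 (hU z)
  choose ε hε hεU using hball
  let χ : ∀ z : ℝ × ℝ, ContDiffBump z := fun z => ⟨ε z / 4, ε z / 2, by have := hε z; positivity,
    by have := hε z; linarith⟩
  have key : ∀ (s : Finset (ℝ × ℝ)) (f : ℝ × ℝ → ℝ), ContDiff ℝ 1 f → HasCompactSupport f →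
      tsupport f ⊆ ⋃ z ∈ s, Metric.ball z (ε z / 4) → p f := by
    intro s
    induction s using Finset.induction_on with
    | empty =>
      intro f _ _ hs
      have : f = 0 := by
        have : tsupport f = ∅ := by simpa using hs
        exact tsupport_eq_empty_iff.1 this
      rw [this]; exact h0
    | insert a s ha ih =>
      intro f hf hfc hs
      have hχ : ContDiff ℝ 1 (χ a) := (χ a).contDiff
      have e : f = (fun z => χ a z * f z) + fun z => (1 - χ a z) * f z := by
        ext z; simp; ring
      have hc1 : HasCompactSupport fun z => χ a z * f z := hfc.mul_left
      have hc2 : HasCompactSupport fun z => (1 - χ a z) * f z := hfc.mul_left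
      rw [e]
      refine hadd _ _ (hχ.mul hf) hc1 ((contDiff_const.sub hχ).mul hf) hc2 ?_ ?_
      · refine hp a _ (hχ.mul hf) hc1 (fun z hz => hεU a ?_)
        have : z ∈ tsupport (χ a) := tsupport_mul_subset_left hz
        rw [(χ a).tsupport_eq] at this
        exact Metric.closedBall_subset_ball (by have := hε a; change ε a / 2 < ε a; linarith) this
      · refine ih _ ((contDiff_const.sub hχ).mul hf) hc2 fun z hz => ?_
        have h1 : z ∈ tsupport f := tsupport_mul_subset_right hz
        have h2 := hs h1
        rw [Finset.set_biUnion_insert] at h2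
        refine h2.resolve_left fun h3 => ?_
        have h4 : (fun z => (1 - χ a z) * f z) =ᶠ[𝓝 z] 0 := by
          filter_upwards [Metric.isOpen_ball.mem_nhds h3] with w hw
          have : χ a w = 1 := (χ a).one_of_mem_closedBall (Metric.ball_subset_closedBall hw)
          simp [this]
        exact notMem_tsupport_iff_eventuallyEq.2 h4 hz
  intro f hf hfc
  obtain ⟨s, hs⟩ := hfc.elim_finite_subcover (fun z => Metric.ball z (ε z / 4))
    (fun z => Metric.isOpen_ball) (fun z _ => mem_iUnion.2 ⟨z, Metric.mem_ball_self
      (by have := hε z; positivity)⟩)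
  exact key s f hf hfc hs

/-! ### Heaviside weights and differentiation under the integral -/

theorem measurable_heavi : Measurable heavi :=
  Measurable.ite measurableSet_Ioi measurable_const measurable_const

theorem abs_heavi_le_one (s : ℝ) : |heavi s| ≤ 1 := by unfold heavi; split_ifs <;> norm_num

theorem heavi_of_pos {s : ℝ} (h : 0 < s) : heavi s = 1 := if_pos h

theorem heavi_of_nonpos {s : ℝ} (h : s ≤ 0) : heavi s = 0 := if_neg h.not_gt

theorem heavi_congr {s r : ℝ} (h : 0 < s ↔ 0 < r) : heavi s = heavi r := by
  unfold heavi; simp only [h]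

/-- Differentiation under the integral sign for integrands with uniformly compact support. -/
theorem hasDerivAt_integral_of_compactSupport {E : Type*} [TopologicalSpace E] [T2Space E]
    [MeasurableSpace E] [BorelSpace E] [SecondCountableTopology E]
    {μ : Measure E} [IsFiniteMeasureOnCompacts μ] {F F' : ℝ → E → ℝ} {w : E → ℝ} {t₀ ε : ℝ}
    (hε : 0 < ε) {K : Set E} (hK : IsCompact K) (hw : Measurable w) (hw1 : ∀ z, |w z| ≤ 1)
    (hF : ∀ t ∈ Metric.closedBall t₀ ε, Continuous (F t))
    (hF0 : ∀ t ∈ Metric.closedBall t₀ ε, ∀ z, z ∉ K → F t z = 0)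
    (hF' : ContinuousOn (Function.uncurry F') (Metric.closedBall t₀ ε ×ˢ univ))
    (hF'0 : ∀ t ∈ Metric.closedBall t₀ ε, ∀ z, z ∉ K → F' t z = 0)
    (hd : ∀ t ∈ Metric.ball t₀ ε, ∀ z, HasDerivAt (fun s => F s z) (F' t z) t) :
    HasDerivAt (fun t => ∫ z, F t z * w z ∂μ) (∫ z, F' t₀ z * w z ∂μ) t₀ := by
  have ht₀ : t₀ ∈ Metric.closedBall t₀ ε := Metric.mem_closedBall_self hε.le
  obtain ⟨C, hC⟩ := ((isCompact_closedBall t₀ ε).prod hK).exists_bound_of_continuousOn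
    (hF'.mono (prod_mono le_rfl (subset_univ _)))
  have hF't : Continuous (F' t₀) := by
    rw [← continuousOn_univ]
    exact hF'.comp (f := fun z => (t₀, z)) (by fun_prop) fun z _ => ⟨ht₀, mem_univ _⟩
  have hb : ∀ z, ∀ t ∈ Metric.ball t₀ ε, ‖F' t z * w z‖ ≤ K.indicator (fun _ => C) z := by
    intro z t ht
    have ht' := Metric.ball_subset_closedBall ht
    by_cases hz : z ∈ K
    · rw [indicator_of_mem hz, norm_mul]
      have := hC (t, z) ⟨ht', hz⟩
      have h1 : ‖w z‖ ≤ 1 := hw1 z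
      calc _ ≤ ‖F' t z‖ * 1 := by gcongr
        _ ≤ C := by simpa using this
    · rw [indicator_of_notMem hz, hF'0 t ht' z hz]; simp
  refine (hasDerivAt_integral_of_dominated_loc_of_deriv_le (F' := fun t z => F' t z * w z)
    (bound := K.indicator fun _ => C) (Metric.ball_mem_nhds t₀ hε) ?_ ?_ ?_ ?_ ?_ ?_).2
  · filter_upwards [Metric.closedBall_mem_nhds t₀ hε] with t ht
    exact ((hF t ht).measurable.mul hw).aestronglyMeasurable
  · have hi : Integrable (F t₀) μ := (hF t₀ ht₀).integrable_of_hasCompactSupport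
      (HasCompactSupport.intro hK fun z hz => hF0 t₀ ht₀ z hz)
    exact hi.mul_bdd (c := 1) hw.aestronglyMeasurable (ae_of_all _ hw1)
  · exact (hF't.measurable.mul hw).aestronglyMeasurable
  · exact ae_of_all _ hb
  · exact (integrable_indicator_iff hK.measurableSet).2
      (integrableOn_const hK.measure_lt_top.ne)
  · exact ae_of_all _ fun z t ht => (hd t ht z).mul_const _

/-! ### Integrals over one side of a moving graph -/

section Graph

variable {s : ℝ}

theorem Continuous.integrable_mul_heavi {A B : ℝ × ℝ → ℝ} (hA : Continuous A)
    (hAc : HasCompactSupport A) (hB : Measurable B) :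
    Integrable (fun z => A z * heavi (B z)) :=
  (hA.integrable_of_hasCompactSupport hAc).mul_bdd (c := 1)
    (measurable_heavi.comp hB).aestronglyMeasurable (ae_of_all _ fun _ => abs_heavi_le_one _)

theorem hasCompactSupport_comp_shear {A : ℝ × ℝ → ℝ} (hAc : HasCompactSupport A)
    {h : ℝ → ℝ} (hh : Continuous h) (hs : s = 1 ∨ s = -1) :
    HasCompactSupport (fun z : ℝ × ℝ => A (h z.2 + s * z.1, z.2)) := by
  have hK : IsCompact ((fun z : ℝ × ℝ => (s * (z.1 - h z.2), z.2)) '' tsupport A) :=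
    IsCompact.image hAc (by fun_prop)
  refine HasCompactSupport.intro hK fun z hz => ?_
  by_contra h0
  refine hz ⟨(h z.2 + s * z.1, z.2), subset_tsupport _ h0, ?_⟩
  rcases hs with rfl | rfl <;> simp

/-- The shear `x = h y + s ξ` preserves area and flattens the boundary. The Heaviside weight then no
longer depends on `h`, which makes differentiation with respect to a moving `h` possible. -/
theorem integral_graph_subst {A : ℝ × ℝ → ℝ} (hA : Continuous A) (hAc : HasCompactSupport A)
    {h : ℝ → ℝ} (hh : Continuous h) (hs : s = 1 ∨ s = -1) :
    ∫ z, A z * heavi (s * (z.1 - h z.2)) =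
      ∫ z : ℝ × ℝ, A (h z.2 + s * z.1, z.2) * heavi z.1 := by
  have i1 : Integrable (fun z => A z * heavi (s * (z.1 - h z.2))) :=
    hA.integrable_mul_heavi hAc (by fun_prop)
  have i2 : Integrable (fun z : ℝ × ℝ => A (h z.2 + s * z.1, z.2) * heavi z.1) :=
    Continuous.integrable_mul_heavi (A := fun z : ℝ × ℝ => A (h z.2 + s * z.1, z.2))
      (by fun_prop) (hasCompactSupport_comp_shear hAc hh hs) (by fun_prop)
  rw [Measure.volume_eq_prod] at i1 i2 ⊢
  rw [integral_prod_symm _ i1, integral_prod_symm _ i2]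
  congr 1
  ext y
  rcases hs with rfl | rfl
  · rw [← integral_add_left_eq_self _ (h y)]
    simp
  · rw [← integral_sub_left_eq_self _ _ (h y)]
    simp [sub_eq_add_neg]

/-- For fixed `y`, the integrand is a multiple of a `ξ`-derivative, so the integral over `ξ > 0`
leaves only the value at `ξ = 0`, a point of the graph. -/
theorem integral_partialX_shear {A : ℝ × ℝ → ℝ} (hA : ContDiff ℝ 1 A) (hAc : HasCompactSupport A)
    {h g : ℝ → ℝ} (hh : Continuous h) (hg : Continuous g) (hs : s = 1 ∨ s = -1) :
    ∫ z : ℝ × ℝ, partialX A (h z.2 + s * z.1, z.2) * g z.2 * heavi z.1 =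
      -s * ∫ y, A (h y, y) * g y := by
  have hA1 : Continuous (partialX A) := hA.continuous_partialX
  have i2 : Integrable (fun z : ℝ × ℝ => partialX A (h z.2 + s * z.1, z.2) * g z.2 * heavi z.1) :=
    Continuous.integrable_mul_heavi
      (A := fun z : ℝ × ℝ => partialX A (h z.2 + s * z.1, z.2) * g z.2)
      (by fun_prop) (hasCompactSupport_comp_shear hAc.partialX hh hs).mul_right (by fun_prop)
  rw [Measure.volume_eq_prod] at i2 ⊢
  rw [integral_prod_symm _ i2, ← integral_const_mul]
  congr 1
  ext y
  have hφ : ContDiff ℝ 1 fun ξ : ℝ => A (h y + s * ξ, y) := by fun_prop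
  have hφc : HasCompactSupport fun ξ : ℝ => A (h y + s * ξ, y) := by
    have := hasCompactSupport_comp_shear hAc hh hs
    exact HasCompactSupport.intro (IsCompact.image this continuous_fst) fun ξ hξ => by
      by_contra h0
      exact hξ ⟨(ξ, y), subset_tsupport _ h0, rfl⟩
  have hd : ∀ ξ, deriv (fun ξ : ℝ => A (h y + s * ξ, y)) ξ = partialX A (h y + s * ξ, y) * s := by
    intro ξ
    have := hasDerivAt_comp_plane (f := A) (X := fun ξ => h y + s * ξ) (Y := fun _ => y)
      (hA.differentiable one_ne_zero _) (((hasDerivAt_id ξ).const_mul s).const_add (h y))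
      (hasDerivAt_const ξ y)
    simpa using this.deriv
  have key := hφc.integral_Ioi_deriv_eq hφ 0
  simp only [hd, mul_zero, add_zero] at key
  have e : ∀ ξ : ℝ, partialX A (h y + s * ξ, y) * g y * heavi ξ =
      (Ioi (0 : ℝ)).indicator (fun ξ => (s * g y) * (partialX A (h y + s * ξ, y) * s)) ξ := by
    intro ξ
    by_cases h0 : 0 < ξ
    · rw [indicator_of_mem (mem_Ioi.2 h0), heavi_of_pos h0]
      rcases hs with rfl | rfl <;> ring
    · rw [indicator_of_notMem (by simpa using h0), heavi_of_nonpos (not_lt.1 h0), mul_zero]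
  simp only [e]
  rw [integral_indicator measurableSet_Ioi, integral_const_mul, key]
  ring

/-- Leibniz's rule with a moving boundary. After flattening, the motion of the graph appears in the
integrand as the term $M_x h_t$, and integrating this term in the direction across the graph turns
it into the boundary integral. -/
theorem hasDerivAt_integral_graph {h : ℝ × ℝ → ℝ} (hh : ContDiff ℝ 1 h) (hs : s = 1 ∨ s = -1)
    {M : ℝ → ℝ × ℝ → ℝ} (hM : ContDiff ℝ 1 (Function.uncurry M)) {t₀ ε : ℝ} (hε : 0 < ε)
    {K : Set (ℝ × ℝ)} (hK : IsCompact K)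
    (hM0 : ∀ t ∈ Metric.ball t₀ ε, ∀ z, z ∉ K → M t z = 0) :
    HasDerivAt (fun t => ∫ z, M t z * heavi (s * (z.1 - h (t, z.2))))
      ((∫ z, deriv (fun t => M t z) t₀ * heavi (s * (z.1 - h (t₀, z.2))))
        - s * ∫ y, M t₀ (h (t₀, y), y) * partialX h (t₀, y)) t₀ := by
  have hMd : ∀ p, DifferentiableAt ℝ (Function.uncurry M) p := hM.differentiable one_ne_zero
  have hMt : ∀ t, ContDiff ℝ 1 (M t) := fun t =>
    hM.comp (f := fun z : ℝ × ℝ => (t, z)) (by fun_prop)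
  have hcont : Continuous fun p : ℝ × (ℝ × ℝ) => M p.1 p.2 := hM.continuous
  have hMc : ∀ t ∈ Metric.ball t₀ ε, HasCompactSupport (M t) := fun t ht =>
    HasCompactSupport.intro hK (hM0 t ht)
  have hMct : ContDiffOn ℝ 1 (Function.uncurry M) (univ ×ˢ univ) := hM.contDiffOn
  have cT : Continuous fun p : ℝ × (ℝ × ℝ) => deriv (fun t => M t p.2) p.1 := by
    simpa [continuousOn_univ] using continuousOn_deriv_timeSlice isOpen_univ hMct
  have cX : Continuous fun p : ℝ × (ℝ × ℝ) => partialX (M p.1) p.2 := by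
    simpa [continuousOn_univ] using continuousOn_partialX_slice isOpen_univ hMct
  have hh1 : Continuous (partialX h) := hh.continuous_partialX
  have hhc := hh.continuous
  set B : ℝ → ℝ × ℝ → ℝ := fun t z => M t (h (t, z.2) + s * z.1, z.2) with hB
  set B' : ℝ → ℝ × ℝ → ℝ := fun t z => deriv (fun t => M t (h (t, z.2) + s * z.1, z.2)) t with hB'
  let zz : ℝ → ℝ × ℝ → ℝ × ℝ := fun t z => (h (t, z.2) + s * z.1, z.2)
  have hBd : ∀ t z, HasDerivAt (fun t => B t z) (deriv (fun r => M r (zz t z)) t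
      + partialX (M t) (zz t z) * partialX h (t, z.2)) t := by
    intro t z
    have h1 : HasDerivAt (fun r => h (r, z.2) + s * z.1) (partialX h (t, z.2)) t :=
      (hasDerivAt_partialX (hh.differentiable one_ne_zero _)).add_const _
    have := hasDerivAt_comp_flow (M := M) (hMd _) h1 (hasDerivAt_const t z.2)
    simpa using this
  have hdt : ∀ t ∈ Metric.ball t₀ ε, ∀ z ∉ K, deriv (fun r => M r z) t = 0 := by
    intro t ht z hz
    have : (fun r => M r z) =ᶠ[𝓝 t] fun _ => 0 := by
      filter_upwards [Metric.isOpen_ball.mem_nhds ht] with r hr using hM0 r hr z hz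
    rw [this.deriv_eq]; simp
  have hdx : ∀ t ∈ Metric.ball t₀ ε, ∀ z ∉ K, partialX (M t) z = 0 := by
    intro t ht z hz
    have : (M t) =ᶠ[𝓝 z] fun _ => 0 := by
      filter_upwards [hK.isClosed.isOpen_compl.mem_nhds hz] with w hw using hM0 t ht w hw
    rw [partialX_congr_nhds this]; simp [partialX]
  have hsub : Metric.closedBall t₀ (ε / 2) ⊆ Metric.ball t₀ ε :=
    Metric.closedBall_subset_ball (by linarith)
  -- After the shear the support depends on time; for times in a smaller closed ball it stays in one
  -- compact set.
  have hK' : IsCompact ((fun p : ℝ × (ℝ × ℝ) => (s * (p.2.1 - h (p.1, p.2.2)), p.2.2)) ''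
      (Metric.closedBall t₀ (ε / 2) ×ˢ K)) :=
    IsCompact.image ((isCompact_closedBall _ _).prod hK) (by fun_prop)
  have hKm : ∀ t ∈ Metric.closedBall t₀ (ε / 2), ∀ z,
      z ∉ ((fun p : ℝ × (ℝ × ℝ) => (s * (p.2.1 - h (p.1, p.2.2)), p.2.2)) ''
        (Metric.closedBall t₀ (ε / 2) ×ˢ K)) → zz t z ∉ K := by
    intro t ht z hz hzK
    refine hz ⟨(t, zz t z), ⟨ht, hzK⟩, ?_⟩
    rcases hs with rfl | rfl <;> simp [zz]
  have main := hasDerivAt_integral_of_compactSupport (μ := (volume : Measure (ℝ × ℝ))) (F := B)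
    (F' := fun t z => deriv (fun r => M r (zz t z)) t
      + partialX (M t) (zz t z) * partialX h (t, z.2)) (w := fun z => heavi z.1)
    (half_pos hε) hK' (measurable_heavi.comp measurable_fst) (fun z => abs_heavi_le_one _)
    (fun t ht => by
      have := (hMt t).continuous
      simp only [hB]; fun_prop)
    (fun t ht z hz => hM0 t (hsub ht) _ (hKm t ht z hz))
    (by
      have hz : Continuous fun p : ℝ × (ℝ × ℝ) => zz p.1 p.2 := by simp only [zz]; fun_prop
      have h1 := cT.comp (continuous_fst.prodMk hz)
      have h2 := cX.comp (continuous_fst.prodMk hz)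
      have h3 : Continuous fun p : ℝ × (ℝ × ℝ) => partialX h (p.1, p.2.2) := by fun_prop
      exact (h1.add (h2.mul h3)).continuousOn)
    (fun t ht z hz => by
      have := hKm t ht z hz
      rw [hdt t (hsub ht) _ this, hdx t (hsub ht) _ this]; simp)
    (fun t ht z => hBd t z)
  have e1 : (fun t => ∫ z, M t z * heavi (s * (z.1 - h (t, z.2))))
      =ᶠ[𝓝 t₀] fun t => ∫ z, B t z * heavi z.1 := by
    filter_upwards [Metric.ball_mem_nhds t₀ hε] with t ht
    exact integral_graph_subst (hMt t).continuous (hMc t ht) (h := fun y => h (t, y))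
      (by fun_prop) hs
  have ht₀ : t₀ ∈ Metric.ball t₀ ε := Metric.mem_ball_self hε
  obtain ⟨MT, hMT⟩ : ∃ MT : ℝ × ℝ → ℝ, ∀ z, deriv (fun r => M r z) t₀ = MT z := ⟨_, fun _ => rfl⟩
  have cT0 : Continuous MT := (cT.comp (by fun_prop : Continuous fun z : ℝ × ℝ => (t₀, z))).congr
    fun z => hMT z
  have hTc : HasCompactSupport MT :=
    HasCompactSupport.intro hK fun z hz => by rw [← hMT, hdt t₀ ht₀ z hz]
  have hht : Continuous fun y => h (t₀, y) := by fun_prop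
  have hht1 : Continuous fun y => partialX h (t₀, y) := by fun_prop
  refine (main.congr_of_eventuallyEq e1).congr_deriv ?_
  simp only [hMT]
  rw [integral_graph_subst cT0 hTc (h := fun y => h (t₀, y)) hht hs]
  have e2 := integral_partialX_shear (hMt t₀) (hMc t₀ ht₀) (h := fun y => h (t₀, y))
    (g := fun y => partialX h (t₀, y)) hht hht1 hs
  have i1 : Integrable fun z : ℝ × ℝ => MT (h (t₀, z.2) + s * z.1, z.2) * heavi z.1 :=
    Continuous.integrable_mul_heavi (A := fun z : ℝ × ℝ => MT (h (t₀, z.2) + s * z.1, z.2))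
      (by fun_prop) (hasCompactSupport_comp_shear hTc hht hs) (by fun_prop)
  have c1 := (hMt t₀).continuous_partialX
  have i2 : Integrable fun z : ℝ × ℝ => partialX (M t₀) (h (t₀, z.2) + s * z.1, z.2)
      * partialX h (t₀, z.2) * heavi z.1 :=
    Continuous.integrable_mul_heavi
      (A := fun z : ℝ × ℝ => partialX (M t₀) (h (t₀, z.2) + s * z.1, z.2) * partialX h (t₀, z.2))
      (by fun_prop) (hasCompactSupport_comp_shear (hMc t₀ ht₀).partialX hht hs).mul_right
      (by fun_prop)
  rw [sub_eq_add_neg, ← neg_mul, ← e2, ← integral_add i1 i2]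
  congr 1; ext z; simp only [zz]; ring

theorem integral_partialX_graph {A : ℝ × ℝ → ℝ} (hA : ContDiff ℝ 1 A) (hAc : HasCompactSupport A)
    {h : ℝ → ℝ} (hh : Continuous h) (hs : s = 1 ∨ s = -1) :
    ∫ z, partialX A z * heavi (s * (z.1 - h z.2)) = -s * ∫ y, A (h y, y) := by
  rw [integral_graph_subst hA.continuous_partialX hAc.partialX hh hs]
  simpa using integral_partialX_shear hA hAc hh (continuous_const (y := (1 : ℝ))) hs

/-- Translation in `y` does not change the integral of `A` over the region. Translating both `A` and
the graph by `τ` and applying the Leibniz rule at `τ = 0` therefore gives zero, as the sum of the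
area term with $A_y$ and a boundary term with $h'$. -/
theorem integral_partialY_graph {A : ℝ × ℝ → ℝ} (hA : ContDiff ℝ 1 A) (hAc : HasCompactSupport A)
    {h : ℝ → ℝ} (hh : ContDiff ℝ 1 h) (hs : s = 1 ∨ s = -1) :
    ∫ z, partialY A z * heavi (s * (z.1 - h z.2)) = s * ∫ y, A (h y, y) * deriv h y := by
  have hK : IsCompact ((fun p : ℝ × (ℝ × ℝ) => (p.2.1, p.2.2 - p.1)) ''
      (Metric.closedBall (0 : ℝ) 1 ×ˢ tsupport A)) :=
    IsCompact.image ((isCompact_closedBall _ _).prod hAc) (by fun_prop)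
  have hM : ContDiff ℝ 1 (Function.uncurry fun (τ : ℝ) (z : ℝ × ℝ) => A (z.1, z.2 + τ)) := by
    have : (Function.uncurry fun (τ : ℝ) (z : ℝ × ℝ) => A (z.1, z.2 + τ)) =
      A ∘ fun p : ℝ × (ℝ × ℝ) => (p.2.1, p.2.2 + p.1) := rfl
    rw [this]
    exact hA.comp (by fun_prop)
  have main := hasDerivAt_integral_graph (h := fun p => h (p.2 + p.1))
    (hh.comp (by fun_prop)) hs (M := fun τ z => A (z.1, z.2 + τ)) hM (t₀ := 0) one_pos hK
    (fun τ hτ z hz => by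
      by_contra h0
      exact hz ⟨(τ, (z.1, z.2 + τ)), ⟨Metric.ball_subset_closedBall hτ, subset_tsupport _ h0⟩,
        by simp⟩)
  have hc : (fun τ : ℝ => ∫ z : ℝ × ℝ, A (z.1, z.2 + τ) * heavi (s * (z.1 - h (z.2 + τ)))) =
      fun _ => ∫ z : ℝ × ℝ, A z * heavi (s * (z.1 - h z.2)) := by
    ext τ
    rw [← integral_add_right_eq_self (fun z : ℝ × ℝ => A z * heavi (s * (z.1 - h z.2))) (0, τ)]
    have : ∀ z : ℝ × ℝ, z + (0, τ) = (z.1, z.2 + τ) := fun z => by ext <;> simp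
    simp only [this]
  -- The differentiated function is constant in `τ`, so its derivative, computed in `main`,
  -- vanishes.
  simp only [] at main
  rw [hc] at main
  have h0 := main.unique (hasDerivAt_const _ _)
  have h1 : ∀ z : ℝ × ℝ, deriv (fun τ : ℝ => A (z.1, z.2 + τ)) 0 = partialY A z := by
    intro z
    have := hasDerivAt_comp_plane (f := A) (X := fun _ => z.1) (Y := fun τ => z.2 + τ) (s := 0)
      (hA.differentiable one_ne_zero _) (hasDerivAt_const _ _) ((hasDerivAt_id _).const_add _)
    simpa using this.deriv
  have h2 : ∀ y : ℝ, partialX (fun p : ℝ × ℝ => h (p.2 + p.1)) (0, y) = deriv h y := by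
    intro y
    have h3 : HasDerivAt h (deriv h y) (y + 0) := by
      simpa using (hh.differentiable one_ne_zero y).hasDerivAt
    have := (h3.comp (0 : ℝ) ((hasDerivAt_id (0 : ℝ)).const_add y)).deriv
    simpa [partialX, Function.comp_def] using this
  simp only [h1, h2, add_zero] at h0
  linarith

end Graph

/-! ### Local form of a regular level set -/

theorem ContinuousLinearMap.isInvertible_of_apply_one_ne_zero (L : ℝ →L[ℝ] ℝ) (h : L 1 ≠ 0) :
    L.IsInvertible := by
  refine ⟨ContinuousLinearEquiv.unitsEquivAut ℝ (Units.mk0 _ h), ?_⟩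
  ext; simp

/-- Locally the positivity set of a regular family of functions is the region on one side of a
moving graph over the second coordinate. -/
theorem exists_moving_graph {S : ℝ → ℝ × ℝ → ℝ} {J : Set ℝ} (hJ : IsOpen J)
    (hS : ContDiffOn ℝ 1 (Function.uncurry S) (J ×ˢ univ)) {t₀ : ℝ} (ht₀ : t₀ ∈ J) {z₀ : ℝ × ℝ}
    (hz₀ : S t₀ z₀ = 0 → partialX (S t₀) z₀ ≠ 0) :
    ∃ s : ℝ, (s = 1 ∨ s = -1) ∧ ∃ h : ℝ × ℝ → ℝ, ContDiff ℝ 1 h ∧ ∃ U, IsOpen U ∧ z₀ ∈ U ∧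
      ∀ᶠ t in 𝓝 t₀, ∀ z ∈ U, (0 < S t z ↔ 0 < s * (z.1 - h (t, z.2))) ∧
        (S t z = 0 ↔ z.1 = h (t, z.2)) ∧ (S t z = 0 → 0 < s * partialX (S t) z) := by
  obtain ⟨x₀, y₀⟩ := z₀
  have ho : IsOpen (J ×ˢ (univ : Set (ℝ × ℝ))) := hJ.prod isOpen_univ
  have hmem : (t₀, (x₀, y₀)) ∈ J ×ˢ (univ : Set (ℝ × ℝ)) := ⟨ht₀, mem_univ _⟩
  have hSc : ContinuousAt (Function.uncurry S) (t₀, (x₀, y₀)) :=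
    (hS.continuousOn.continuousAt (ho.mem_nhds hmem))
  have split : ∀ {p : ℝ × (ℝ × ℝ) → Prop}, (∀ᶠ q in 𝓝 (t₀, (x₀, y₀)), p q) →
      ∃ δ > 0, ∀ t x y, |t - t₀| < δ → |x - x₀| < δ → |y - y₀| < δ → p (t, (x, y)) := by
    intro p hp
    obtain ⟨δ, hδ, h⟩ := Metric.eventually_nhds_iff.1 hp
    refine ⟨δ, hδ, fun t x y ht hx hy => h ?_⟩
    simp only [Prod.dist_eq, Real.dist_eq]
    exact max_lt ht (max_lt hx hy)
  have evt : ∀ {δ : ℝ}, 0 < δ → ∀ᶠ t in 𝓝 t₀, |t - t₀| < δ := fun {δ} hδ => by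
    filter_upwards [Metric.ball_mem_nhds t₀ hδ] with t ht using by simpa [Real.dist_eq] using ht
  have box : ∀ {δ δ' : ℝ}, 0 < δ → 0 < δ' →
      IsOpen (Metric.ball x₀ δ ×ˢ Metric.ball y₀ δ') ∧ (x₀, y₀) ∈ Metric.ball x₀ δ ×ˢ Metric.ball y₀ δ' :=
    fun hδ hδ' => ⟨Metric.isOpen_ball.prod Metric.isOpen_ball, Metric.mem_ball_self hδ,
      Metric.mem_ball_self hδ'⟩
  rcases lt_trichotomy (S t₀ (x₀, y₀)) 0 with hneg | hzero | hpos
  · obtain ⟨δ, hδ, h⟩ := split (hSc.eventually (gt_mem_nhds hneg))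
    -- Off the level set the graph is a vertical line at the edge of the box, outside the open box;
    -- which edge encodes the sign of `S`.
    refine ⟨1, .inl rfl, fun _ => x₀ + δ, contDiff_const, _, (box hδ hδ).1, (box hδ hδ).2, ?_⟩
    filter_upwards [evt hδ] with t ht z hz
    have h1 : S t z < 0 := h t z.1 z.2 ht hz.1 hz.2
    have h2 : |z.1 - x₀| < δ := hz.1
    have h3 := (abs_lt.1 h2).2
    refine ⟨⟨fun h => absurd h h1.not_gt, fun h => ?_⟩, ⟨fun h => absurd h h1.ne, fun h => ?_⟩,
      fun h => absurd h h1.ne⟩ <;> linarith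
  · have hx := hz₀ hzero
    have hSa := hS.contDiffAt (ho.mem_nhds hmem)
    have hd : DifferentiableAt ℝ (Function.uncurry S) (t₀, (x₀, y₀)) :=
      hSa.differentiableAt one_ne_zero
    -- The variables are regrouped so that the implicit function theorem solves for `x` in terms of
    -- `(t, y)`.
    let φ : (ℝ × ℝ) × ℝ → ℝ := fun q => S q.1.1 (q.2, q.1.2)
    have hφ : ContDiffAt ℝ 1 φ ((t₀, y₀), x₀) :=
      ContDiffAt.comp (g := Function.uncurry S)
        (f := fun q : (ℝ × ℝ) × ℝ => (q.1.1, (q.2, q.1.2))) ((t₀, y₀), x₀) hSa (by fun_prop)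
    have hinv : (fderiv ℝ φ ((t₀, y₀), x₀) ∘L .inr ℝ (ℝ × ℝ) ℝ).IsInvertible := by
      apply ContinuousLinearMap.isInvertible_of_apply_one_ne_zero
      have h1 : HasDerivAt (fun x => φ ((t₀, y₀), x))
          (fderiv ℝ φ ((t₀, y₀), x₀) ((0, 0), 1)) x₀ :=
        HasFDerivAt.comp_hasDerivAt (f := fun x : ℝ => (((t₀, y₀), x) : (ℝ × ℝ) × ℝ)) x₀
          (hφ.differentiableAt one_ne_zero).hasFDerivAt
          ((hasDerivAt_const x₀ (t₀, y₀)).prodMk (hasDerivAt_id x₀))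
      have h2 := h1.unique (hasDerivAt_partialX hd.slice)
      intro h0
      apply hx
      rw [← h2]
      exact h0
    obtain ⟨h, hh, hheq⟩ := exists_contDiff_eventuallyEq
      (hφ.contDiffAt_implicitFunction one_ne_zero hinv)
    have hself : h (t₀, y₀) = x₀ := by
      rw [hheq.eq_of_nhds]; exact hφ.implicitFunction_apply_self one_ne_zero hinv
    have hzero' : ∀ᶠ q in 𝓝 (t₀, y₀), S q.1 (h q, q.2) = 0 := by
      filter_upwards [hheq, hφ.eventually_apply_implicitFunction one_ne_zero hinv] with q h1 h2
      rw [h1]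
      rw [show φ ((t₀, y₀), x₀) = 0 from hzero] at h2
      exact h2
    obtain ⟨s, hs, hspos⟩ : ∃ s : ℝ, (s = 1 ∨ s = -1) ∧ 0 < s * partialX (S t₀) (x₀, y₀) := by
      rcases lt_or_gt_of_ne hx with h | h
      · exact ⟨-1, .inr rfl, by linarith⟩
      · exact ⟨1, .inl rfl, by linarith⟩
    have hcx : ContinuousAt (fun p : ℝ × (ℝ × ℝ) => s * partialX (S p.1) p.2) (t₀, (x₀, y₀)) :=
      ((continuousOn_partialX_slice hJ hS).continuousAt (ho.mem_nhds hmem)).const_mul s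
    obtain ⟨δ, hδ, hbox⟩ := split ((hcx.eventually (lt_mem_nhds hspos)).and (ho.mem_nhds hmem))
    obtain ⟨δ₁, hδ₁, hbox₁⟩ : ∃ δ₁ > 0, ∀ t y, |t - t₀| < δ₁ → |y - y₀| < δ₁ →
        S t (h (t, y), y) = 0 ∧ |h (t, y) - x₀| < δ := by
      have hc : ∀ᶠ q in 𝓝 (t₀, y₀), |h q - x₀| < δ := by
        have : ContinuousAt h (t₀, y₀) := hh.continuous.continuousAt
        have := this.eventually (Metric.ball_mem_nhds _ hδ)
        rw [hself] at this
        exact this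
      obtain ⟨δ₁, hδ₁, h1⟩ := Metric.eventually_nhds_iff.1 (hzero'.and hc)
      refine ⟨δ₁, hδ₁, fun t y ht hy => h1 (y := (t, y)) ?_⟩
      simp only [Prod.dist_eq, Real.dist_eq]
      exact max_lt ht hy
    have hm : 0 < min δ δ₁ := lt_min hδ hδ₁
    refine ⟨s, hs, h, hh, _, (box hδ hm).1, (box hδ hm).2, ?_⟩
    filter_upwards [evt hm] with t ht
    rintro ⟨x, y⟩ ⟨hxx, hyy⟩
    have hy' : |y - y₀| < min δ δ₁ := hyy
    have hx' : |x - x₀| < δ := hxx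
    obtain ⟨h1, h2⟩ := hbox₁ t y (ht.trans_le (min_le_right _ _)) (hy'.trans_le (min_le_right _ _))
    have hder : ∀ x' ∈ Metric.ball x₀ δ, HasDerivAt (fun x => s * S t (x, y))
        (s * partialX (S t) (x', y)) x' ∧ 0 < s * partialX (S t) (x', y) := by
      intro x' hx''
      obtain ⟨h3, h4⟩ := hbox t x' y (ht.trans_le (min_le_left _ _)) hx''
        (hy'.trans_le (min_le_left _ _))
      refine ⟨(hasDerivAt_partialX ?_).const_mul s, h3⟩
      have : DifferentiableAt ℝ (Function.uncurry S) (t, (x', y)) :=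
        (hS.contDiffAt (ho.mem_nhds h4)).differentiableAt one_ne_zero
      exact this.slice
    -- Strict monotonicity of `s * S` in `x` over the whole box makes the implicit solution the only
    -- zero and decides the sign of `S` on either side of it.
    have hmono : StrictMonoOn (fun x => s * S t (x, y)) (Metric.ball x₀ δ) := by
      refine strictMonoOn_of_deriv_pos (convex_ball _ _)
        (fun x' h' => (hder x' h').1.continuousAt.continuousWithinAt) fun x' h' => ?_
      rw [interior_eq_iff_isOpen.2 Metric.isOpen_ball] at h'
      rw [(hder x' h').1.deriv]; exact (hder x' h').2
    have hxm : x ∈ Metric.ball x₀ δ := hxx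
    have hhm : h (t, y) ∈ Metric.ball x₀ δ := h2
    have c1 := hmono.lt_iff_lt hhm hxm
    have c2 := hmono.lt_iff_lt hxm hhm
    have c3 := hmono.injOn.eq_iff hxm hhm
    simp only [h1, mul_zero] at c1 c2 c3
    refine ⟨?_, ?_, fun _ => (hder x hxm).2⟩
    · rcases hs with rfl | rfl
      · simp only [one_mul, sub_pos] at c1 ⊢; exact c1
      · simp only [neg_one_mul, neg_neg_iff_pos] at c2
        rw [c2]
        constructor <;> intro h <;> linarith
    · rw [← c3]
      rcases hs with rfl | rfl <;> simp
  · obtain ⟨δ, hδ, h⟩ := split (hSc.eventually (lt_mem_nhds hpos))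
    refine ⟨1, .inl rfl, fun _ => x₀ - δ, contDiff_const, _, (box hδ hδ).1, (box hδ hδ).2, ?_⟩
    filter_upwards [evt hδ] with t ht z hz
    have h1 : 0 < S t z := h t z.1 z.2 ht hz.1 hz.2
    have h2 : |z.1 - x₀| < δ := hz.1
    have h3 := (abs_lt.1 h2).1
    refine ⟨⟨fun _ => by linarith, fun _ => h1⟩, ⟨fun h => absurd h h1.ne', fun h => ?_⟩,
      fun h => absurd h h1.ne'⟩
    linarith

/-! ### Balance in the region bounded by a moving curve -/

/-- A moving curve `S t = 0` of class `C¹`, parametrized by `l ↦ (xs t l, ys t l)`, for the times in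
`J`. -/
structure IsMovingCurve (J : Set ℝ) (S : ℝ → ℝ × ℝ → ℝ) (xs ys : ℝ → ℝ → ℝ) : Prop where
  S_smooth : ContDiffOn ℝ 1 (Function.uncurry S) (J ×ˢ univ)
  regular : ∀ t ∈ J, ∀ z, S t z = 0 → fderiv ℝ (S t) z ≠ 0
  xs_smooth : ContDiffOn ℝ 1 (Function.uncurry xs) (J ×ˢ univ)
  ys_smooth : ContDiffOn ℝ 1 (Function.uncurry ys) (J ×ˢ univ)
  surface : ∀ t ∈ J, ∀ z, S t z = 0 ↔ ∃ l, z = (xs t l, ys t l)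
  inj : ∀ t ∈ J, Function.Injective fun l => (xs t l, ys t l)
  immersion : ∀ t ∈ J, ∀ l, (deriv (xs t) l, deriv (ys t) l) ≠ (0, 0)

/-- The derivative of `S t` in the direction of the left normal of the curve. -/
noncomputable def normalDeriv (S : ℝ → ℝ × ℝ → ℝ) (xs ys : ℝ → ℝ → ℝ) (t l : ℝ) : ℝ :=
  partialY (S t) (xs t l, ys t l) * deriv (xs t) l - partialX (S t) (xs t l, ys t l) * deriv (ys t) l

/-- The flux of the density `m` with current `(p, q)` relative to the moving curve, through the
element `dl` of the curve. -/
noncomputable def curveFlux (xs ys : ℝ → ℝ → ℝ) (m p q : ℝ → ℝ × ℝ → ℝ) (t l : ℝ) : ℝ :=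
  m t (xs t l, ys t l) * (deriv (fun s => xs s l) t * deriv (ys t) l
      - deriv (fun s => ys s l) t * deriv (xs t) l)
    - (p t (xs t l, ys t l) * deriv (ys t) l - q t (xs t l, ys t l) * deriv (xs t) l)

/-- The rate of change of the amount `∫ f m` of a conserved quantity in the region `0 < S`. -/
def RegionBalanceAt (S : ℝ → ℝ × ℝ → ℝ) (xs ys : ℝ → ℝ → ℝ) (m p q : ℝ → ℝ × ℝ → ℝ) (θ t₀ : ℝ)
    (f : ℝ × ℝ → ℝ) : Prop :=
  HasDerivAt (fun t => ∫ z, f z * m t z * heavi (S t z))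
    ((∫ z, (partialX f z * p t₀ z + partialY f z * q t₀ z) * heavi (S t₀ z))
      - θ * ∫ l, f (xs t₀ l, ys t₀ l) * curveFlux xs ys m p q t₀ l) t₀

theorem integral_sub_sub {α : Type*} [MeasurableSpace α] {μ : Measure α} {f g k : α → ℝ}
    (hf : Integrable f μ) (hg : Integrable g μ) (hk : Integrable k μ) :
    ∫ x, (f x - g x - k x) ∂μ = (∫ x, f x ∂μ) - (∫ x, g x ∂μ) - ∫ x, k x ∂μ := by
  rw [← integral_sub hf hg]
  exact integral_sub (hf.sub hg) hk

theorem ContDiffOn.differentiableAt_slab {E : Type*} [NormedAddCommGroup E] [NormedSpace ℝ E]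
    {M : ℝ → E → ℝ} {J : Set ℝ} (hM : ContDiffOn ℝ 1 (Function.uncurry M) (J ×ˢ univ))
    (hJ : IsOpen J) {t : ℝ} (ht : t ∈ J) (z : E) :
    DifferentiableAt ℝ (Function.uncurry M) (t, z) :=
  (hM.contDiffAt ((hJ.prod isOpen_univ).mem_nhds ⟨ht, mem_univ _⟩)).differentiableAt one_ne_zero

theorem hasDerivAt_slice_line {x : ℝ → ℝ → ℝ} {t l : ℝ}
    (h : DifferentiableAt ℝ (Function.uncurry x) (t, l)) :
    HasDerivAt (x t) (deriv (x t) l) l :=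
  (DifferentiableAt.comp l (g := Function.uncurry x) (f := fun m : ℝ => (t, m)) h
    (by fun_prop) : DifferentiableAt ℝ (x t) l).hasDerivAt

/-- Near a point that is off the curve, or where $S_x\ne0$, the region is one side of a moving
graph. Leibniz's rule handles the time derivative, integration by parts in `x` and `y` handles the
currents, and the conservation law cancels the area terms. The remaining boundary integral in `dy`
is changed to `dl`; there the density and current combine into the flux relative to the moving
curve. -/
theorem regionBalanceAt_of_graph {J : Set ℝ} (hJ : IsOpen J) {S : ℝ → ℝ × ℝ → ℝ} {xs ys : ℝ → ℝ → ℝ}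
    (hC : IsMovingCurve J S xs ys) {m p q : ℝ → ℝ × ℝ → ℝ}
    (hm : ContDiffOn ℝ 1 (Function.uncurry m) (J ×ˢ univ))
    (hp : ContDiffOn ℝ 1 (Function.uncurry p) (J ×ˢ univ))
    (hq : ContDiffOn ℝ 1 (Function.uncurry q) (J ×ˢ univ))
    {t₀ : ℝ} (ht₀ : t₀ ∈ J)
    (heq : ∀ z, 0 < S t₀ z →
      deriv (fun s => m s z) t₀ + partialX (p t₀) z + partialY (q t₀) z = 0)
    {θ : ℝ} (hθ : θ = 1 ∨ θ = -1) (hor : ∀ l, θ * normalDeriv S xs ys t₀ l < 0)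
    {z₀ : ℝ × ℝ} (hz₀ : S t₀ z₀ = 0 → partialX (S t₀) z₀ ≠ 0) :
    ∃ U ∈ 𝓝 z₀, ∀ f, ContDiff ℝ 1 f → HasCompactSupport f → tsupport f ⊆ U →
      RegionBalanceAt S xs ys m p q θ t₀ f := by
  obtain ⟨s, hs, h, hh, U, hU, hzU, hev⟩ := exists_moving_graph hJ hC.S_smooth ht₀ hz₀
  refine ⟨U, hU.mem_nhds hzU, fun f hf hfc hfU => ?_⟩
  have hfU' : ∀ z, z ∉ U → f z = 0 := fun z hz => by
    by_contra h0
    exact hz (hfU (subset_tsupport _ h0))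
  -- `m` is smooth only for times in `J`, whereas the Leibniz rule is stated for globally smooth
  -- integrands; `N` replaces it near `t₀`.
  obtain ⟨N, hN, hNm⟩ := exists_contDiff_extend_time hJ hm ht₀
  have hev₀ := hev.self_of_nhds
  have hpt : ContDiff ℝ 1 (p t₀) := by
    rw [← contDiffOn_univ]
    exact hp.comp (f := fun z : ℝ × ℝ => (t₀, z)) (by fun_prop) fun z _ => ⟨ht₀, mem_univ _⟩
  have hqt : ContDiff ℝ 1 (q t₀) := by
    rw [← contDiffOn_univ]
    exact hq.comp (f := fun z : ℝ × ℝ => (t₀, z)) (by fun_prop) fun z _ => ⟨ht₀, mem_univ _⟩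
  have hht : ContDiff ℝ 1 fun y => h (t₀, y) := by fun_prop
  have hfd : ∀ z, DifferentiableAt ℝ f z := hf.differentiable one_ne_zero
  have hpd : ∀ z, DifferentiableAt ℝ (p t₀) z := hpt.differentiable one_ne_zero
  have hqd : ∀ z, DifferentiableAt ℝ (q t₀) z := hqt.differentiable one_ne_zero
  have hhd : ∀ y, DifferentiableAt ℝ h y := hh.differentiable one_ne_zero
  have hMM : ContDiff ℝ 1 (Function.uncurry fun t z => f z * N t z) :=
    (hf.comp contDiff_snd).mul hN
  have k1 := hasDerivAt_integral_graph hh hs (M := fun t z => f z * N t z) hMM (t₀ := t₀) one_pos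
    hfc (fun t _ z hz => by simp [image_eq_zero_of_notMem_tsupport hz])
  have k2 := integral_partialX_graph (A := fun z => f z * p t₀ z) (hf.mul hpt) hfc.mul_right
    hht.continuous hs
  have k3 := integral_partialY_graph (A := fun z => f z * q t₀ z) (hf.mul hqt) hfc.mul_right
    hht hs
  have e1 : (fun t => ∫ z, f z * m t z * heavi (S t z)) =ᶠ[𝓝 t₀]
      fun t => ∫ z, f z * N t z * heavi (s * (z.1 - h (t, z.2))) := by
    filter_upwards [hev, hNm] with t h1 h2
    congr 1
    ext z
    by_cases hz : z ∈ U
    · rw [h2 z, heavi_congr (h1 z hz).1]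
    · rw [hfU' z hz]; simp
  unfold RegionBalanceAt
  refine (k1.congr_of_eventuallyEq e1).congr_deriv ?_
  have hNt : ∀ z, deriv (fun t => N t z) t₀ = deriv (fun t => m t z) t₀ := fun z => by
    refine Filter.EventuallyEq.deriv_eq ?_
    filter_upwards [hNm] with t ht using ht z
  have hNdt : ∀ z, deriv (fun t => f z * N t z) t₀ = f z * deriv (fun t => m t z) t₀ := fun z => by
    rw [deriv_const_mul _ (hN.differentiable one_ne_zero (t₀, z)).timeSlice, hNt]
  have hder : ∀ y, deriv (fun y => h (t₀, y)) y = partialY h (t₀, y) := fun y => rfl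
  simp only [partialX_mul (hfd _) (hpd _), partialY_mul (hfd _) (hqd _), hder] at k2 k3
  simp only [hNdt, hNm.self_of_nhds]
  have hbd : ∀ z, f z * deriv (fun t => m t z) t₀ * heavi (s * (z.1 - h (t₀, z.2))) =
      (partialX f z * p t₀ z + partialY f z * q t₀ z) * heavi (S t₀ z)
      - (partialX f z * p t₀ z + f z * partialX (p t₀) z) * heavi (s * (z.1 - h (t₀, z.2)))
      - (partialY f z * q t₀ z + f z * partialY (q t₀) z) * heavi (s * (z.1 - h (t₀, z.2))) := by
    intro z
    by_cases hz : z ∈ U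
    · rw [heavi_congr (hev₀ z hz).1]
      by_cases hp0 : 0 < s * (z.1 - h (t₀, z.2))
      · have := heq z ((hev₀ z hz).1.2 hp0)
        linear_combination (f z * heavi (s * (z.1 - h (t₀, z.2)))) * this
      · rw [heavi_of_nonpos (not_lt.1 hp0)]; ring
    · have hz' : z ∉ tsupport f := fun h => hz (hfU h)
      rw [hfU' z hz, partialX_eq_zero_of_notMem_tsupport hz',
        partialY_eq_zero_of_notMem_tsupport hz']
      ring
  have cS : Continuous (S t₀) := by
    rw [← continuousOn_univ]
    exact hC.S_smooth.continuousOn.comp (f := fun z : ℝ × ℝ => (t₀, z)) (by fun_prop)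
      fun z _ => ⟨ht₀, mem_univ _⟩
  have cfx := hf.continuous_partialX
  have cfy := hf.continuous_partialY
  have cpx := hpt.continuous_partialX
  have cqy := hqt.continuous_partialY
  have cp := hpt.continuous
  have cq := hqt.continuous
  have cf := hf.continuous
  have ch := hht.continuous
  have hmeas : Measurable fun z : ℝ × ℝ => s * (z.1 - h (t₀, z.2)) := by
    have : Continuous fun z : ℝ × ℝ => s * (z.1 - h (t₀, z.2)) := by
      have := hh.continuous
      fun_prop
    exact this.measurable
  have j1 : Integrable fun z => (partialX f z * p t₀ z + partialY f z * q t₀ z) * heavi (S t₀ z) :=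
    Continuous.integrable_mul_heavi (by fun_prop)
      (hfc.partialX.mul_right.add hfc.partialY.mul_right) cS.measurable
  have j2 : Integrable fun z => (partialX f z * p t₀ z + f z * partialX (p t₀) z)
      * heavi (s * (z.1 - h (t₀, z.2))) :=
    Continuous.integrable_mul_heavi (by fun_prop)
      (hfc.partialX.mul_right.add hfc.mul_right) hmeas
  have j3 : Integrable fun z => (partialY f z * q t₀ z + f z * partialY (q t₀) z)
      * heavi (s * (z.1 - h (t₀, z.2))) :=
    Continuous.integrable_mul_heavi (by fun_prop)
      (hfc.partialY.mul_right.add hfc.mul_right) hmeas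
  have e3 : ∫ z, f z * deriv (fun t => m t z) t₀ * heavi (s * (z.1 - h (t₀, z.2))) =
      (∫ z, (partialX f z * p t₀ z + partialY f z * q t₀ z) * heavi (S t₀ z))
      - (∫ z, (partialX f z * p t₀ z + f z * partialX (p t₀) z)
          * heavi (s * (z.1 - h (t₀, z.2))))
      - ∫ z, (partialY f z * q t₀ z + f z * partialY (q t₀) z)
          * heavi (s * (z.1 - h (t₀, z.2))) := by
    rw [← integral_sub_sub j1 j2 j3]
    exact integral_congr_ae (ae_of_all _ hbd)
  rw [e3, k2, k3]
  have mt : Continuous (m t₀) := by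
    rw [← continuousOn_univ]
    exact hm.continuousOn.comp (f := fun z : ℝ × ℝ => (t₀, z)) (by fun_prop)
      fun z _ => ⟨ht₀, mem_univ _⟩
  have chx : Continuous fun y => partialX h (t₀, y) := by
    have := hh.continuous_partialX
    fun_prop
  have chy : Continuous fun y => partialY h (t₀, y) := by
    have := hh.continuous_partialY
    fun_prop
  have compY : ∀ {g : ℝ × ℝ → ℝ}, Continuous g → Integrable fun y =>
      f (h (t₀, y), y) * g (h (t₀, y), y) := by
    intro g hg
    refine Continuous.integrable_of_hasCompactSupport (by fun_prop) ?_
    refine HasCompactSupport.intro (IsCompact.image hfc continuous_snd) fun y hy => ?_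
    have : f (h (t₀, y), y) = 0 := by
      by_contra h0
      exact hy ⟨_, subset_tsupport _ h0, rfl⟩
    rw [this, zero_mul]
  -- The integrand of the three boundary terms together: `f` times $p-q\,h_y-m\,h_t$ on the graph.
  let E : ℝ → ℝ := fun y => f (h (t₀, y), y) * (p t₀ (h (t₀, y), y)
    - q t₀ (h (t₀, y), y) * partialY h (t₀, y) - m t₀ (h (t₀, y), y) * partialX h (t₀, y))
  have i1 := compY cp
  have i2 : Integrable fun y => f (h (t₀, y), y) * q t₀ (h (t₀, y), y) * partialY h (t₀, y) := by
    have := compY (g := fun z => q t₀ z * partialY h (t₀, z.2)) (cq.mul (chy.comp continuous_snd))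
    simpa [mul_assoc] using this
  have i3 : Integrable fun y => f (h (t₀, y), y) * m t₀ (h (t₀, y), y) * partialX h (t₀, y) := by
    have := compY (g := fun z => m t₀ z * partialX h (t₀, z.2)) (mt.mul (chx.comp continuous_snd))
    simpa [mul_assoc] using this
  have e4 : ∫ y, E y = (∫ y, f (h (t₀, y), y) * p t₀ (h (t₀, y), y))
      - (∫ y, f (h (t₀, y), y) * q t₀ (h (t₀, y), y) * partialY h (t₀, y))
      - ∫ y, f (h (t₀, y), y) * m t₀ (h (t₀, y), y) * partialX h (t₀, y) := by
    rw [← integral_sub_sub i1 i2 i3]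
    congr 1; ext y; simp only [E]; ring
  have hxd : ∀ l, DifferentiableAt ℝ (Function.uncurry xs) (t₀, l) :=
    hC.xs_smooth.differentiableAt_slab hJ ht₀
  have hyd : ∀ l, DifferentiableAt ℝ (Function.uncurry ys) (t₀, l) :=
    hC.ys_smooth.differentiableAt_slab hJ ht₀
  have hxl : ∀ l, HasDerivAt (xs t₀) (deriv (xs t₀) l) l := fun l => hasDerivAt_slice_line (hxd l)
  have hyl : ∀ l, HasDerivAt (ys t₀) (deriv (ys t₀) l) l := fun l => hasDerivAt_slice_line (hyd l)
  have cX : Continuous fun l => (xs t₀ l, ys t₀ l) :=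
    continuous_iff_continuousAt.2 fun l => (hxl l).continuousAt.prodMk (hyl l).continuousAt
  let L : Set ℝ := (fun l => (xs t₀ l, ys t₀ l)) ⁻¹' U
  have hL : IsOpen L := hU.preimage cX
  have hSl : ∀ l, S t₀ (xs t₀ l, ys t₀ l) = 0 := fun l => (hC.surface t₀ ht₀ _).2 ⟨l, rfl⟩
  have hLh : ∀ l ∈ L, xs t₀ l = h (t₀, ys t₀ l) := fun l hl => (hev₀ _ hl).2.1.1 (hSl l)
  have hinj : InjOn (ys t₀) L := by
    intro l hl l' hl' hll
    apply hC.inj t₀ ht₀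
    simp only [hLh l hl, hLh l' hl', hll]
  -- With injectivity on `L`, this says that the piece of the curve inside `U` traces the piece of
  -- the graph inside `U` exactly once.
  have himg : ys t₀ '' L = {y | (h (t₀, y), y) ∈ U} := by
    ext y
    constructor
    · rintro ⟨l, hl, rfl⟩
      have : (xs t₀ l, ys t₀ l) ∈ U := hl
      rw [hLh l hl] at this
      exact this
    · intro hy
      obtain ⟨l, hl⟩ := (hC.surface t₀ ht₀ (h (t₀, y), y)).1 ((hev₀ _ hy).2.1.2 rfl)
      refine ⟨l, ?_, (congrArg Prod.snd hl).symm⟩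
      change (xs t₀ l, ys t₀ l) ∈ U
      rw [← hl]; exact hy
  have hptw : ∀ l ∈ L, |deriv (ys t₀) l| * E (ys t₀ l) * s =
      -(θ * (f (xs t₀ l, ys t₀ l) * curveFlux xs ys m p q t₀ l)) := by
    intro l hl
    -- The identity $x^s=h(t,y^s)$ is differentiated along the curve in `l` here, and in `t` below,
    -- to express the slopes of the graph by derivatives of the parametrization.
    have d1 : partialY h (t₀, ys t₀ l) * deriv (ys t₀) l = deriv (xs t₀) l := by
      have a1 := hasDerivAt_comp_plane (X := fun _ => t₀) (hhd (t₀, ys t₀ l))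
        (hasDerivAt_const l t₀) (hyl l)
      have a2 : xs t₀ =ᶠ[𝓝 l] fun r => h (t₀, ys t₀ r) := by
        filter_upwards [hL.mem_nhds hl] with r hr using hLh r hr
      have := (a1.congr_of_eventuallyEq a2).unique (hxl l)
      simpa using this
    have d2 : partialX h (t₀, ys t₀ l) + partialY h (t₀, ys t₀ l) * deriv (fun r => ys r l) t₀
        = deriv (fun r => xs r l) t₀ := by
      have a1 := hasDerivAt_comp_plane (X := fun r => r) (Y := fun r => ys r l)
        (hhd (t₀, ys t₀ l)) (hasDerivAt_id t₀) (hyd l).timeSlice.hasDerivAt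
      have a3 : ContinuousAt (fun r => (xs r l, ys r l)) t₀ :=
        (hxd l).timeSlice.continuousAt.prodMk (hyd l).timeSlice.continuousAt
      have a2 : (fun r => xs r l) =ᶠ[𝓝 t₀] fun r => h (r, ys r l) := by
        filter_upwards [hJ.mem_nhds ht₀, hev, a3.eventually (hU.mem_nhds hl)] with r h1 h2 h3
        exact (h2 _ h3).2.1.1 ((hC.surface r h1 _).2 ⟨l, rfl⟩)
      have := (a1.congr_of_eventuallyEq a2).unique (hxd l).timeSlice.hasDerivAt
      simpa using this
    have d3 : partialX (S t₀) (xs t₀ l, ys t₀ l) * deriv (xs t₀) l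
        + partialY (S t₀) (xs t₀ l, ys t₀ l) * deriv (ys t₀) l = 0 := by
      have a1 := hasDerivAt_comp_plane
        (hC.S_smooth.differentiableAt_slab hJ ht₀ (xs t₀ l, ys t₀ l)).slice (hxl l) (hyl l)
      simp only [hSl] at a1
      exact a1.unique (hasDerivAt_const _ _)
    have d4 := (hev₀ _ hl).2.2 (hSl l)
    have d5 := hor l
    have him := hC.immersion t₀ ht₀ l
    have hE : E (ys t₀ l) = f (xs t₀ l, ys t₀ l) * (p t₀ (xs t₀ l, ys t₀ l)
      - q t₀ (xs t₀ l, ys t₀ l) * partialY h (t₀, ys t₀ l)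
      - m t₀ (xs t₀ l, ys t₀ l) * partialX h (t₀, ys t₀ l)) := by
      simp only [E, ← hLh l hl]
    rw [hE]
    unfold normalDeriv at d5
    unfold curveFlux
    generalize partialX (S t₀) (xs t₀ l, ys t₀ l) = Sx at *
    generalize partialY (S t₀) (xs t₀ l, ys t₀ l) = Sy at *
    generalize deriv (xs t₀) l = xl at *
    generalize deriv (ys t₀) l = yl at *
    generalize deriv (fun r => ys r l) t₀ = yt at *
    have hpos : 0 < xl ^ 2 + yl ^ 2 := by
      rcases eq_or_ne yl 0 with h0 | h0
      · have : xl ≠ 0 := fun h1 => him (by rw [h0, h1])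
        positivity
      · positivity
    -- By `d3` the gradient of `S` is normal to the curve. Since $sS_x>0$ and the oriented normal
    -- derivative is negative, this identity forces $s\theta y_l>0$, which removes the absolute
    -- value from the Jacobian.
    have hid : (θ * (Sy * xl - Sx * yl)) * (s * θ * yl) = -(s * Sx) * (xl ^ 2 + yl ^ 2) := by
      have : θ * θ = 1 := by rcases hθ with rfl | rfl <;> norm_num
      linear_combination (s * yl * (Sy * xl - Sx * yl)) * this + s * xl * d3
    have hsy : 0 < s * θ * yl := by
      by_contra hc
      have h1 : 0 ≤ (θ * (Sy * xl - Sx * yl)) * (s * θ * yl) :=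
        mul_nonneg_of_nonpos_of_nonpos d5.le (not_lt.1 hc)
      have h2 : 0 < (s * Sx) * (xl ^ 2 + yl ^ 2) := mul_pos d4 hpos
      linarith
    have hab : |yl| * s = θ * yl := by
      rcases hs with rfl | rfl <;> rcases hθ with rfl | rfl <;>
        simp only [one_mul, mul_one, neg_mul, neg_neg, mul_neg] at hsy ⊢
      · rw [abs_of_pos hsy]
      · rw [abs_of_neg (by linarith)]
      · rw [abs_of_neg (by linarith), neg_neg]
      · rw [abs_of_pos hsy]
    rw [← d2, ← d1]
    linear_combination (f (xs t₀ l, ys t₀ l) * (p t₀ (xs t₀ l, ys t₀ l)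
      - q t₀ (xs t₀ l, ys t₀ l) * partialY h (t₀, ys t₀ l)
      - m t₀ (xs t₀ l, ys t₀ l) * partialX h (t₀, ys t₀ l))) * hab
  have hE0 : ∀ y, y ∉ ys t₀ '' L → E y = 0 := fun y hy => by
    rw [himg] at hy
    simp only [E]
    rw [hfU' _ hy, zero_mul]
  -- Both integrands vanish outside the parts in `U`, so the change of variables from `y` to `l` is
  -- needed only on `L`.
  have e5 : s * ∫ y, E y = -(θ * ∫ l, f (xs t₀ l, ys t₀ l) * curveFlux xs ys m p q t₀ l) := by
    rw [← setIntegral_eq_integral_of_forall_compl_eq_zero hE0,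
      integral_image_eq_integral_abs_deriv_smul hL.measurableSet
        (fun l _ => (hyl l).hasDerivWithinAt) hinj,
      ← integral_const_mul,
      ← setIntegral_eq_integral_of_forall_compl_eq_zero (s := L)
        (f := fun l => f (xs t₀ l, ys t₀ l) * curveFlux xs ys m p q t₀ l)
        (fun l hl => by rw [hfU' _ hl, zero_mul]), ← integral_const_mul, ← integral_neg]
    refine setIntegral_congr_fun hL.measurableSet fun l hl => ?_
    have := hptw l hl
    simp only [smul_eq_mul]
    linarith
  rw [e4] at e5
  linear_combination e5

theorem partialX_comp_swap (f : ℝ × ℝ → ℝ) (z : ℝ × ℝ) :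
    partialX (fun w => f w.swap) z = partialY f z.swap := rfl

theorem partialY_comp_swap (f : ℝ × ℝ → ℝ) (z : ℝ × ℝ) :
    partialY (fun w => f w.swap) z = partialX f z.swap := rfl

theorem ContDiffOn.comp_swap {M : ℝ → ℝ × ℝ → ℝ} {J : Set ℝ}
    (hM : ContDiffOn ℝ 1 (Function.uncurry M) (J ×ˢ univ)) :
    ContDiffOn ℝ 1 (Function.uncurry fun t (z : ℝ × ℝ) => M t z.swap) (J ×ˢ univ) :=
  hM.comp (f := fun p : ℝ × (ℝ × ℝ) => (p.1, p.2.swap))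
    ((contDiff_fst.prodMk ((contDiff_snd.comp contDiff_snd).prodMk
      (contDiff_fst.comp contDiff_snd))).contDiffOn) fun _ hp => ⟨hp.1, mem_univ _⟩

/-- Exchange of the coordinates reduces points with $S_x=0$, where then $S_y\ne0$, to the graph
case. -/
theorem IsMovingCurve.swap {J : Set ℝ} (hJ : IsOpen J) {S : ℝ → ℝ × ℝ → ℝ} {xs ys : ℝ → ℝ → ℝ}
    (hC : IsMovingCurve J S xs ys) : IsMovingCurve J (fun t z => S t z.swap) ys xs where
  S_smooth := hC.S_smooth.comp_swap
  regular := fun t ht z hz h0 => by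
    have hd : DifferentiableAt ℝ (S t) z.swap := (hC.S_smooth.differentiableAt_slab hJ ht _).slice
    have hd' : DifferentiableAt ℝ (fun w : ℝ × ℝ => S t w.swap) z :=
      (hC.S_smooth.comp_swap.differentiableAt_slab hJ ht z).slice
    refine hC.regular t ht z.swap hz ?_
    have hx : fderiv ℝ (S t) z.swap (1, 0) = 0 := by
      rw [← partialX_eq_fderiv hd, ← partialY_comp_swap, partialY_eq_fderiv hd', h0]; rfl
    have hy : fderiv ℝ (S t) z.swap (0, 1) = 0 := by
      rw [← partialY_eq_fderiv hd, ← partialX_comp_swap, partialX_eq_fderiv hd', h0]; rfl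
    ext
    · simpa using hx
    · simpa using hy
  xs_smooth := hC.ys_smooth
  ys_smooth := hC.xs_smooth
  surface := fun t ht z => by
    rw [hC.surface t ht z.swap]
    refine exists_congr fun l => ?_
    rw [Prod.swap_eq_iff_eq_swap]; rfl
  inj := fun t ht l l' h => hC.inj t ht (by
    simp only [Prod.mk.injEq] at h ⊢
    exact h.symm)
  immersion := fun t ht l h => hC.immersion t ht l (by
    simp only [Prod.mk.injEq] at h ⊢
    exact h.symm)

/-- With `-S` the minus side also becomes a region of positivity. -/
theorem IsMovingCurve.neg {J : Set ℝ} {S : ℝ → ℝ × ℝ → ℝ} {xs ys : ℝ → ℝ → ℝ}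
    (hC : IsMovingCurve J S xs ys) : IsMovingCurve J (fun t z => -S t z) xs ys where
  S_smooth := hC.S_smooth.neg
  regular := fun t ht z hz h0 => hC.regular t ht z (neg_eq_zero.1 hz) (by
    have : fderiv ℝ (fun z => -S t z) z = -fderiv ℝ (S t) z := fderiv_fun_neg
    rw [this] at h0
    exact neg_eq_zero.1 h0)
  xs_smooth := hC.xs_smooth
  ys_smooth := hC.ys_smooth
  surface := fun t ht z => by rw [neg_eq_zero]; exact hC.surface t ht z
  inj := hC.inj
  immersion := hC.immersion

theorem normalDeriv_neg (S : ℝ → ℝ × ℝ → ℝ) (xs ys : ℝ → ℝ → ℝ) (t l : ℝ) :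
    normalDeriv (fun t z => -S t z) xs ys t l = -normalDeriv S xs ys t l := by
  simp only [normalDeriv, partialX, partialY, deriv.fun_neg]
  ring

/-- Reflection in the diagonal reverses orientation: the flux through `dl` and the sign `θ` both
change, and their product does not. -/
theorem RegionBalanceAt.of_swap {S : ℝ → ℝ × ℝ → ℝ} {xs ys : ℝ → ℝ → ℝ} {m p q : ℝ → ℝ × ℝ → ℝ}
    {θ t₀ : ℝ} {f : ℝ × ℝ → ℝ}
    (h : RegionBalanceAt (fun t z => S t z.swap) ys xs (fun t z => m t z.swap)
      (fun t z => q t z.swap) (fun t z => p t z.swap) (-θ) t₀ fun z => f z.swap) :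
    RegionBalanceAt S xs ys m p q θ t₀ f := by
  unfold RegionBalanceAt at h ⊢
  have e1 : ∀ t, ∫ z : ℝ × ℝ, f z.swap * m t z.swap * heavi (S t z.swap)
      = ∫ z, f z * m t z * heavi (S t z) := fun t => by
    rw [Measure.volume_eq_prod]
    exact integral_prod_swap (fun z => f z * m t z * heavi (S t z))
  have e2 : ∫ z : ℝ × ℝ, (partialY f z.swap * q t₀ z.swap + partialX f z.swap * p t₀ z.swap)
        * heavi (S t₀ z.swap)
      = ∫ z, (partialX f z * p t₀ z + partialY f z * q t₀ z) * heavi (S t₀ z) := by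
    rw [Measure.volume_eq_prod]
    rw [integral_prod_swap
      (fun z => (partialY f z * q t₀ z + partialX f z * p t₀ z) * heavi (S t₀ z))]
    congr 1; ext z; ring
  have e3 : ∀ l, curveFlux ys xs (fun t z => m t z.swap)
      (fun t z => q t z.swap) (fun t z => p t z.swap) t₀ l = -curveFlux xs ys m p q t₀ l := by
    intro l; simp only [curveFlux, Prod.swap_prod_mk]; ring
  simp only [e1, e3, partialX_comp_swap, partialY_comp_swap, e2, Prod.swap_prod_mk, mul_neg,
    integral_neg, neg_mul, neg_neg] at h
  exact h

/-! ### Properness of the curve and functions on time slabs -/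

/-- Points of the curve in a compact set have parameters in a bounded interval, locally uniformly
in time. -/
def IsUniformlyProper (J : Set ℝ) (xs ys : ℝ → ℝ → ℝ) : Prop :=
  ∀ t₀ ∈ J, ∀ K : Set (ℝ × ℝ), IsCompact K →
    ∃ L : ℝ, ∀ᶠ t in 𝓝[J] t₀, ∀ l, (xs t l, ys t l) ∈ K → l ∈ Icc (-L) L

theorem IsUniformlyProper.mono {J J' : Set ℝ} {xs ys : ℝ → ℝ → ℝ} (h : IsUniformlyProper J xs ys)
    (hJ : J' ⊆ J) : IsUniformlyProper J' xs ys := fun t₀ ht₀ K hK => by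
  obtain ⟨L, hL⟩ := h t₀ (hJ ht₀) K hK
  exact ⟨L, hL.filter_mono (nhdsWithin_mono _ hJ)⟩

theorem IsUniformlyProper.hasCompactSupport {J : Set ℝ} {xs ys : ℝ → ℝ → ℝ}
    (h : IsUniformlyProper J xs ys) {t : ℝ} (ht : t ∈ J) {f : ℝ × ℝ → ℝ}
    (hf : HasCompactSupport f) : HasCompactSupport fun l => f (xs t l, ys t l) := by
  obtain ⟨L, hL⟩ := h t ht _ hf
  refine HasCompactSupport.intro (isCompact_Icc (a := -L) (b := L)) fun l hl => ?_
  by_contra h0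
  exact hl (hL.self_of_nhdsWithin ht l (subset_tsupport _ h0))

section Slab

variable {E : Type*} [TopologicalSpace E]

theorem ContinuousOn.slab_slice {k : ℝ → E → ℝ} {J : Set ℝ}
    (hk : ContinuousOn (Function.uncurry k) (J ×ˢ univ)) {t : ℝ} (ht : t ∈ J) :
    Continuous (k t) := by
  rw [← continuousOn_univ]
  exact hk.comp (f := fun z : E => (t, z)) (by fun_prop) fun z _ => ⟨ht, mem_univ _⟩

theorem ContinuousOn.slab_time {k : ℝ → E → ℝ} {J : Set ℝ}
    (hk : ContinuousOn (Function.uncurry k) (J ×ˢ univ)) (z : E) :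
    ContinuousOn (fun t => k t z) J :=
  hk.comp (f := fun t : ℝ => (t, z)) (by fun_prop) fun _ ht => ⟨ht, mem_univ _⟩

/-- A tube argument around the compact slice at time `t₀`; it supplies the dominating constants for
continuity of integrals in time. -/
theorem exists_bound_nhdsWithin_slab {k : ℝ → E → ℝ} {J : Set ℝ}
    (hk : ContinuousOn (Function.uncurry k) (J ×ˢ univ)) {t₀ : ℝ} (ht₀ : t₀ ∈ J) {K : Set E}
    (hK : IsCompact K) : ∃ C, ∀ᶠ t in 𝓝[J] t₀, ∀ z ∈ K, |k t z| ≤ C := by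
  obtain ⟨C, hC⟩ := hK.exists_bound_of_continuousOn (hk.slab_slice ht₀).continuousOn
  refine ⟨C + 1, ?_⟩
  have : ∀ᶠ t in 𝓝 t₀, ∀ z ∈ K, t ∈ J → |k t z| ≤ C + 1 := by
    refine hK.eventually_forall_of_forall_eventually fun z hz => ?_
    have h1 := (hk (t₀, z) ⟨ht₀, mem_univ _⟩).abs
    have h2 : |Function.uncurry k (t₀, z)| < C + 1 := by
      have : |k t₀ z| ≤ C := hC z hz
      change |k t₀ z| < C + 1
      linarith
    have h3 := eventually_nhdsWithin_iff.1 (h1.eventually (gt_mem_nhds h2))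
    filter_upwards [h3] with p hp hpJ
    exact (hp ⟨hpJ, mem_univ _⟩).le
  rw [eventually_nhdsWithin_iff]
  filter_upwards [this] with t ht htJ z hz using ht z hz htJ

end Slab

theorem ContDiffOn.slab_slice {E : Type*} [NormedAddCommGroup E] [NormedSpace ℝ E]
    {k : ℝ → E → ℝ} {J : Set ℝ}
    (hk : ContDiffOn ℝ 1 (Function.uncurry k) (J ×ˢ univ)) {t : ℝ} (ht : t ∈ J) :
    ContDiff ℝ 1 (k t) := by
  rw [← contDiffOn_univ]
  exact hk.comp (f := fun z : E => (t, z)) (by fun_prop) fun z _ => ⟨ht, mem_univ _⟩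

theorem continuousOn_deriv_slice_line {x : ℝ → ℝ → ℝ} {J : Set ℝ} (hJ : IsOpen J)
    (hx : ContDiffOn ℝ 1 (Function.uncurry x) (J ×ˢ univ)) :
    ContinuousOn (fun p : ℝ × ℝ => deriv (x p.1) p.2) (J ×ˢ univ) :=
  (continuousOn_fderiv_slice hJ hx 1).congr fun _ _ => fderiv_apply_one_eq_deriv.symm

theorem continuousOn_curve_comp {J : Set ℝ} {xs ys : ℝ → ℝ → ℝ}
    (hx : ContinuousOn (Function.uncurry xs) (J ×ˢ univ))
    (hy : ContinuousOn (Function.uncurry ys) (J ×ˢ univ)) {m : ℝ → ℝ × ℝ → ℝ}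
    (hm : ContinuousOn (Function.uncurry m) (J ×ˢ univ)) :
    ContinuousOn (fun p : ℝ × ℝ => m p.1 (xs p.1 p.2, ys p.1 p.2)) (J ×ˢ univ) :=
  hm.comp (f := fun p : ℝ × ℝ => (p.1, (xs p.1 p.2, ys p.1 p.2)))
    (continuousOn_fst.prodMk (hx.prodMk hy)) fun _ hp => ⟨hp.1, mem_univ _⟩

theorem IsMovingCurve.continuousOn_curveFlux {J : Set ℝ} (hJ : IsOpen J) {S : ℝ → ℝ × ℝ → ℝ}
    {xs ys : ℝ → ℝ → ℝ} (hC : IsMovingCurve J S xs ys) {m p q : ℝ → ℝ × ℝ → ℝ}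
    (hm : ContinuousOn (Function.uncurry m) (J ×ˢ univ))
    (hp : ContinuousOn (Function.uncurry p) (J ×ˢ univ))
    (hq : ContinuousOn (Function.uncurry q) (J ×ˢ univ)) :
    ContinuousOn (Function.uncurry (curveFlux xs ys m p q)) (J ×ˢ univ) := by
  have hx := hC.xs_smooth.continuousOn
  have hy := hC.ys_smooth.continuousOn
  have a1 := continuousOn_deriv_slice_line hJ hC.xs_smooth
  have a2 := continuousOn_deriv_slice_line hJ hC.ys_smooth
  exact ((continuousOn_curve_comp hx hy hm).mul
    (((continuousOn_deriv_timeSlice hJ hC.xs_smooth).mul a2).sub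
      ((continuousOn_deriv_timeSlice hJ hC.ys_smooth).mul a1))).sub
    (((continuousOn_curve_comp hx hy hp).mul a2).sub ((continuousOn_curve_comp hx hy hq).mul a1))

/-- The identity is additive in `f`, and so needs proof only for small supports. Regularity of the
level set makes one of the two coordinate directions transversal at every point of the curve.
Properness provides the integrability along the curve that additivity uses. -/
theorem regionBalanceAt {J : Set ℝ} (hJ : IsOpen J) {S : ℝ → ℝ × ℝ → ℝ} {xs ys : ℝ → ℝ → ℝ}
    (hC : IsMovingCurve J S xs ys) (hprop : IsUniformlyProper J xs ys) {m p q : ℝ → ℝ × ℝ → ℝ}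
    (hm : ContDiffOn ℝ 1 (Function.uncurry m) (J ×ˢ univ))
    (hp : ContDiffOn ℝ 1 (Function.uncurry p) (J ×ˢ univ))
    (hq : ContDiffOn ℝ 1 (Function.uncurry q) (J ×ˢ univ))
    {t₀ : ℝ} (ht₀ : t₀ ∈ J)
    (heq : ∀ z, 0 < S t₀ z →
      deriv (fun s => m s z) t₀ + partialX (p t₀) z + partialY (q t₀) z = 0)
    {θ : ℝ} (hθ : θ = 1 ∨ θ = -1) (hor : ∀ l, θ * normalDeriv S xs ys t₀ l < 0)
    {f : ℝ × ℝ → ℝ} (hf : ContDiff ℝ 1 f) (hfc : HasCompactSupport f) :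
    RegionBalanceAt S xs ys m p q θ t₀ f := by
  refine testFunction_induction (p := RegionBalanceAt S xs ys m p q θ t₀) ?_ ?_ ?_ f hf hfc
  · unfold RegionBalanceAt
    simpa [partialX, partialY] using hasDerivAt_const t₀ (0 : ℝ)
  · intro f g hf hfc hg hgc hbf hbg
    have cS : ∀ t ∈ J, Measurable (S t) := fun t ht =>
      (hC.S_smooth.continuousOn.slab_slice ht).measurable
    have cm : ∀ t ∈ J, Continuous (m t) := fun t ht => hm.continuousOn.slab_slice ht
    have cp := hp.continuousOn.slab_slice ht₀
    have cq := hq.continuousOn.slab_slice ht₀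
    have cκ := (hC.continuousOn_curveFlux hJ hm.continuousOn hp.continuousOn
      hq.continuousOn).slab_slice ht₀
    have cX : Continuous fun l => (xs t₀ l, ys t₀ l) :=
      (hC.xs_smooth.continuousOn.slab_slice ht₀).prodMk (hC.ys_smooth.continuousOn.slab_slice ht₀)
    have i1 : ∀ {f : ℝ × ℝ → ℝ}, ContDiff ℝ 1 f → HasCompactSupport f → ∀ t ∈ J,
        Integrable fun z => f z * m t z * heavi (S t z) := fun hf hfc t ht =>
      Continuous.integrable_mul_heavi (hf.continuous.mul (cm t ht)) hfc.mul_right (cS t ht)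
    have i2 : ∀ {f : ℝ × ℝ → ℝ}, ContDiff ℝ 1 f → HasCompactSupport f →
        Integrable fun z => (partialX f z * p t₀ z + partialY f z * q t₀ z) * heavi (S t₀ z) :=
      fun hf hfc => Continuous.integrable_mul_heavi
        ((hf.continuous_partialX.mul cp).add (hf.continuous_partialY.mul cq))
        (hfc.partialX.mul_right.add hfc.partialY.mul_right) (cS t₀ ht₀)
    have i3 : ∀ {f : ℝ × ℝ → ℝ}, ContDiff ℝ 1 f → HasCompactSupport f →
        Integrable fun l => f (xs t₀ l, ys t₀ l) * curveFlux xs ys m p q t₀ l :=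
      fun hf hfc => ((hf.continuous.comp cX).mul cκ).integrable_of_hasCompactSupport
        (hprop.hasCompactSupport ht₀ hfc).mul_right
    unfold RegionBalanceAt at hbf hbg ⊢
    have e1 : (fun t => ∫ z, (f + g) z * m t z * heavi (S t z)) =ᶠ[𝓝 t₀]
        fun t => (∫ z, f z * m t z * heavi (S t z)) + ∫ z, g z * m t z * heavi (S t z) := by
      filter_upwards [hJ.mem_nhds ht₀] with t ht
      rw [← integral_add (i1 hf hfc t ht) (i1 hg hgc t ht)]
      congr 1; ext z; simp only [Pi.add_apply]; ring
    have e2 : ∫ z, (partialX (f + g) z * p t₀ z + partialY (f + g) z * q t₀ z) * heavi (S t₀ z)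
        = (∫ z, (partialX f z * p t₀ z + partialY f z * q t₀ z) * heavi (S t₀ z))
          + ∫ z, (partialX g z * p t₀ z + partialY g z * q t₀ z) * heavi (S t₀ z) := by
      rw [← integral_add (i2 hf hfc) (i2 hg hgc)]
      congr 1; ext z
      have a1 := hf.differentiable one_ne_zero z
      have a2 := hg.differentiable one_ne_zero z
      rw [partialX_eq_fderiv (a1.add a2), partialY_eq_fderiv (a1.add a2), fderiv_add a1 a2,
        partialX_eq_fderiv a1, partialX_eq_fderiv a2, partialY_eq_fderiv a1, partialY_eq_fderiv a2]
      simp only [add_apply]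
      ring
    have e3 : ∫ l, (f + g) (xs t₀ l, ys t₀ l) * curveFlux xs ys m p q t₀ l
        = (∫ l, f (xs t₀ l, ys t₀ l) * curveFlux xs ys m p q t₀ l)
          + ∫ l, g (xs t₀ l, ys t₀ l) * curveFlux xs ys m p q t₀ l := by
      rw [← integral_add (i3 hf hfc) (i3 hg hgc)]
      congr 1; ext l; simp only [Pi.add_apply]; ring
    refine ((hbf.add hbg).congr_of_eventuallyEq e1).congr_deriv ?_
    rw [e2, e3]; ring
  · intro z₀
    by_cases hz₀ : S t₀ z₀ = 0 → partialX (S t₀) z₀ ≠ 0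
    · exact regionBalanceAt_of_graph hJ hC hm hp hq ht₀ heq hθ hor hz₀
    · push Not at hz₀
      have hd : DifferentiableAt ℝ (S t₀) z₀ := (hC.S_smooth.differentiableAt_slab hJ ht₀ _).slice
      have hy : partialY (S t₀) z₀ ≠ 0 := by
        intro hy
        refine hC.regular t₀ ht₀ z₀ hz₀.1 ?_
        rw [partialY_eq_fderiv hd] at hy
        have hx := hz₀.2
        rw [partialX_eq_fderiv hd] at hx
        ext
        · simpa using hx
        · simpa using hy
      -- In swapped coordinates the two currents change roles and the orientation sign is reversed.
      obtain ⟨U, hU, h⟩ := regionBalanceAt_of_graph hJ (hC.swap hJ) hm.comp_swap hq.comp_swap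
        hp.comp_swap ht₀ (z₀ := z₀.swap) (θ := -θ)
        (fun z hz => by
          rw [partialX_comp_swap, partialY_comp_swap]
          have := heq z.swap hz
          linarith)
        (by rcases hθ with rfl | rfl <;> simp)
        (fun l => by
          have := hor l
          simp only [normalDeriv, partialX_comp_swap, partialY_comp_swap, Prod.swap_prod_mk] at this ⊢
          linarith)
        (fun _ => by rw [partialX_comp_swap, Prod.swap_swap]; exact hy)
      refine ⟨Prod.swap ⁻¹' U, continuous_swap.continuousAt.preimage_mem_nhds hU,
        fun f hf hfc hfU => RegionBalanceAt.of_swap (h _ ?_ ?_ ?_)⟩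
      · exact hf.comp (contDiff_snd.prodMk contDiff_fst)
      · exact hfc.comp_homeomorph (Homeomorph.prodComm ℝ ℝ)
      · intro z hz
        have h1 : z.swap ∈ tsupport f := by
          have := tsupport_comp_subset_preimage f (continuous_swap (X := ℝ) (Y := ℝ)) hz
          exact this
        have := hfU h1
        simpa using this

/-! ### Time intervals, and integrals over the sides and the curve as functions of time -/

theorem isOpen_timeIoo (T : EReal) : IsOpen (timeIoo T) :=
  (isOpen_lt continuous_const continuous_id).inter
    (isOpen_lt continuous_coe_real_ereal continuous_const)

theorem timeIoo_subset_timeIco (T : EReal) : timeIoo T ⊆ timeIco T := fun _ h => ⟨h.1.le, h.2⟩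

theorem exists_gt_mem_timeIoo {T : EReal} {t : ℝ} (ht : t ∈ timeIco T) :
    ∃ t₁ ∈ timeIoo T, t < t₁ := by
  obtain ⟨x, hx, hxT⟩ := EReal.lt_iff_exists_real_btwn.1 ht.2
  have : t < x := by exact_mod_cast hx
  exact ⟨x, ⟨ht.1.trans_lt this, hxT⟩, this⟩

theorem mem_timeIco_of_le {T : EReal} {t s : ℝ} (ht : t ∈ timeIco T) (hs : 0 ≤ s) (hst : s ≤ t) :
    s ∈ timeIco T := ⟨hs, (EReal.coe_le_coe_iff.2 hst).trans_lt ht.2⟩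

theorem mem_timeIoo_of_le {T : EReal} {t s : ℝ} (ht : t ∈ timeIco T) (hs : 0 < s) (hst : s ≤ t) :
    s ∈ timeIoo T := ⟨hs, (EReal.coe_le_coe_iff.2 hst).trans_lt ht.2⟩

theorem zero_mem_timeIco {T : EReal} (hT : 0 < T) : (0 : ℝ) ∈ timeIco T := ⟨le_rfl, by simpa using hT⟩

theorem ContDiffOn.timeIoo {E : Type*} [NormedAddCommGroup E] [NormedSpace ℝ E] {T : EReal}
    {M : ℝ → E → ℝ} (h : ContDiffOn ℝ 1 (Function.uncurry M) (timeIco T ×ˢ univ)) :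
    ContDiffOn ℝ 1 (Function.uncurry M) (timeIoo T ×ˢ univ) :=
  h.mono (prod_mono (timeIoo_subset_timeIco T) le_rfl)

theorem ContinuousOn.timeIoo {E : Type*} [TopologicalSpace E] {T : EReal}
    {M : ℝ → E → ℝ} (h : ContinuousOn (Function.uncurry M) (timeIco T ×ˢ univ)) :
    ContinuousOn (Function.uncurry M) (timeIoo T ×ˢ univ) :=
  h.mono (prod_mono (timeIoo_subset_timeIco T) le_rfl)

/-- A `C¹` curve in the plane is a null set. -/
theorem volume_range_curve_eq_zero {x y : ℝ → ℝ} (hx : ContDiff ℝ 1 x) (hy : ContDiff ℝ 1 y) :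
    volume (range fun l => (x l, y l)) = 0 := by
  -- The curve is viewed as the image of the plane under a map that ignores the second coordinate.
  -- Its derivative is everywhere singular, so the image is null.
  have h1 : (range fun l => (x l, y l)) = (fun p : ℝ × ℝ => (x p.1, y p.1)) '' univ := by
    ext z
    constructor
    · rintro ⟨l, rfl⟩; exact ⟨(l, 0), mem_univ _, rfl⟩
    · rintro ⟨p, -, rfl⟩; exact ⟨p.1, rfl⟩
  rw [h1]
  have hd : Differentiable ℝ fun p : ℝ × ℝ => (x p.1, y p.1) := by
    have a1 := hx.differentiable one_ne_zero
    have a2 := hy.differentiable one_ne_zero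
    fun_prop
  refine addHaar_image_eq_zero_of_det_fderivWithin_eq_zero volume
    (fun p _ => (hd p).hasFDerivAt.hasFDerivWithinAt) fun p _ => ?_
  have hker : (fderiv ℝ (fun p : ℝ × ℝ => (x p.1, y p.1)) p) (0, 1) = 0 := by
    have h2 := HasFDerivAt.comp_hasDerivAt (f := fun r : ℝ => (p.1, r)) p.2
      (hd p).hasFDerivAt ((hasDerivAt_const p.2 p.1).prodMk (hasDerivAt_id p.2))
    exact h2.unique (hasDerivAt_const p.2 (x p.1, y p.1))
  change LinearMap.det _ = 0
  rw [LinearMap.det_eq_zero_iff_ker_ne_bot, Submodule.ne_bot_iff]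
  exact ⟨(0, 1), hker, by simp⟩

/-- Dominated convergence: for times close to `t₀`, properness confines the integrand to a fixed
bounded interval of parameters. -/
theorem continuousOn_integral_curve {J : Set ℝ} {xs ys : ℝ → ℝ → ℝ}
    (hx : ContinuousOn (Function.uncurry xs) (J ×ˢ univ))
    (hy : ContinuousOn (Function.uncurry ys) (J ×ˢ univ)) (hprop : IsUniformlyProper J xs ys)
    {k : ℝ → ℝ → ℝ} (hk : ContinuousOn (Function.uncurry k) (J ×ˢ univ)) {φ : ℝ × ℝ → ℝ}
    (hφ : Continuous φ) (hφc : HasCompactSupport φ) :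
    ContinuousOn (fun t => ∫ l, φ (xs t l, ys t l) * k t l) J := by
  intro t₀ ht₀
  obtain ⟨L, hL⟩ := hprop t₀ ht₀ _ hφc
  obtain ⟨C, hC⟩ := exists_bound_nhdsWithin_slab hk ht₀ (isCompact_Icc (a := -L) (b := L))
  obtain ⟨B, hB⟩ := hφc.exists_bound_of_continuous hφ
  refine continuousWithinAt_of_dominated (bound := (Icc (-L) L).indicator fun _ => B * C)
    ?_ ?_ ?_ ?_
  · filter_upwards [self_mem_nhdsWithin] with t ht
    exact ((hφ.comp ((hx.slab_slice ht).prodMk (hy.slab_slice ht))).mul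
      (hk.slab_slice ht)).aestronglyMeasurable
  · filter_upwards [hL, hC] with t h1 h2
    refine ae_of_all _ fun l => ?_
    by_cases hl : l ∈ Icc (-L) L
    · rw [indicator_of_mem hl, norm_mul]
      exact mul_le_mul (hB _) (h2 l hl) (norm_nonneg _) ((norm_nonneg _).trans (hB (0, 0)))
    · rw [indicator_of_notMem hl, image_eq_zero_of_notMem_tsupport fun h => hl (h1 l h)]
      simp
  · exact (integrable_indicator_iff measurableSet_Icc).2
      (integrableOn_const isCompact_Icc.measure_lt_top.ne)
  · exact ae_of_all _ fun l => (hφ.comp_continuousOn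
      ((hx.slab_time l).prodMk (hy.slab_time l)) t₀ ht₀).mul (hk.slab_time l t₀ ht₀)

/-- The Heaviside factor is continuous in time at every point where `S t₀` is nonzero, hence almost
everywhere because the level set is null; dominated convergence does the rest. -/
theorem continuousOn_integral_region {J : Set ℝ} {S mm mp : ℝ → ℝ × ℝ → ℝ}
    (hS : ContinuousOn (Function.uncurry S) (J ×ˢ univ))
    (hS0 : ∀ t ∈ J, volume {z | S t z = 0} = 0)
    (hmm : ContinuousOn (Function.uncurry mm) (J ×ˢ univ))
    (hmp : ContinuousOn (Function.uncurry mp) (J ×ˢ univ)) {φ : ℝ × ℝ → ℝ}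
    (hφ : Continuous φ) (hφc : HasCompactSupport φ) :
    ContinuousOn (fun t => ∫ z, φ z * (mm t z + (mp t z - mm t z) * heavi (S t z))) J := by
  intro t₀ ht₀
  obtain ⟨C, hC⟩ := exists_bound_nhdsWithin_slab hmm ht₀ hφc
  obtain ⟨C', hC'⟩ := exists_bound_nhdsWithin_slab hmp ht₀ hφc
  obtain ⟨B, hB⟩ := hφc.exists_bound_of_continuous hφ
  refine continuousWithinAt_of_dominated
    (bound := (tsupport φ).indicator fun _ => B * (C + (C' + C))) ?_ ?_ ?_ ?_
  · filter_upwards [self_mem_nhdsWithin] with t ht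
    have a1 := (hmm.slab_slice ht).measurable
    have a2 := (hmp.slab_slice ht).measurable
    have a3 := measurable_heavi.comp (hS.slab_slice ht).measurable
    exact (hφ.measurable.mul (a1.add ((a2.sub a1).mul a3))).aestronglyMeasurable
  · filter_upwards [hC, hC'] with t h1 h2
    refine ae_of_all _ fun z => ?_
    by_cases hz : z ∈ tsupport φ
    · rw [indicator_of_mem hz, norm_mul]
      refine mul_le_mul (hB _) ?_ (norm_nonneg _) ((norm_nonneg _).trans (hB (0, 0)))
      have b1 := h1 z hz
      have b2 := h2 z hz
      have b3 := abs_heavi_le_one (S t z)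
      calc ‖mm t z + (mp t z - mm t z) * heavi (S t z)‖
          ≤ |mm t z| + |(mp t z - mm t z) * heavi (S t z)| := abs_add_le _ _
        _ = |mm t z| + |mp t z - mm t z| * |heavi (S t z)| := by rw [abs_mul]
        _ ≤ C + (C' + C) * 1 := by
          have b4 : |mp t z - mm t z| ≤ C' + C := (abs_sub _ _).trans (add_le_add b2 b1)
          gcongr
          exact (abs_nonneg _).trans b4
        _ = C + (C' + C) := by ring
    · rw [indicator_of_notMem hz, image_eq_zero_of_notMem_tsupport hz]
      simp
  · exact (integrable_indicator_iff (isClosed_tsupport φ).measurableSet).2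
      (integrableOn_const (IsCompact.measure_lt_top hφc).ne)
  · have hne : ∀ᵐ z, S t₀ z ≠ 0 := by
      rw [ae_iff]; simpa using hS0 t₀ ht₀
    filter_upwards [hne] with z hz
    have c1 := hmm.slab_time z t₀ ht₀
    have c2 := hmp.slab_time z t₀ ht₀
    have c3 : ContinuousWithinAt (fun t => heavi (S t z)) J t₀ := by
      have c4 := hS.slab_time z t₀ ht₀
      rcases lt_or_gt_of_ne hz with h | h
      · refine (continuousWithinAt_const (b := (0 : ℝ))).congr_of_eventuallyEq ?_
          (heavi_of_nonpos h.le)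
        filter_upwards [c4.eventually (gt_mem_nhds h)] with t ht using heavi_of_nonpos ht.le
      · refine (continuousWithinAt_const (b := (1 : ℝ))).congr_of_eventuallyEq ?_ (heavi_of_pos h)
        filter_upwards [c4.eventually (lt_mem_nhds h)] with t ht using heavi_of_pos ht
    exact continuousWithinAt_const.mul (c1.add ((c2.sub c1).mul c3))

/-- No boundary terms arise: near `t₀` properness keeps the support in one compact interval of
parameters, so one differentiates under the integral. -/
theorem hasDerivAt_integral_curve {J : Set ℝ} (hJ : IsOpen J) {xs ys : ℝ → ℝ → ℝ}
    (hx : ContDiffOn ℝ 1 (Function.uncurry xs) (J ×ˢ univ))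
    (hy : ContDiffOn ℝ 1 (Function.uncurry ys) (J ×ˢ univ)) (hprop : IsUniformlyProper J xs ys)
    {w : ℝ → ℝ → ℝ} (hw : ContDiffOn ℝ 1 (Function.uncurry w) (J ×ˢ univ)) {f : ℝ × ℝ → ℝ}
    (hf : ContDiff ℝ 1 f) (hfc : HasCompactSupport f) {t₀ : ℝ} (ht₀ : t₀ ∈ J) :
    HasDerivAt (fun t => ∫ l, f (xs t l, ys t l) * w t l)
      (∫ l, ((partialX f (xs t₀ l, ys t₀ l) * deriv (fun s => xs s l) t₀
        + partialY f (xs t₀ l, ys t₀ l) * deriv (fun s => ys s l) t₀) * w t₀ l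
        + f (xs t₀ l, ys t₀ l) * deriv (fun s => w s l) t₀)) t₀ := by
  obtain ⟨L, hL⟩ := hprop t₀ ht₀ _ hfc
  rw [hJ.nhdsWithin_eq ht₀] at hL
  obtain ⟨δ, hδ, hball⟩ := Metric.mem_nhds_iff.1 (inter_mem (hJ.mem_nhds ht₀) hL)
  have hsub : Metric.closedBall t₀ (δ / 2) ⊆ Metric.ball t₀ δ :=
    Metric.closedBall_subset_ball (by linarith)
  have hcJ : ∀ t ∈ Metric.closedBall t₀ (δ / 2), t ∈ J := fun t ht => (hball (hsub ht)).1
  have hcL : ∀ t ∈ Metric.closedBall t₀ (δ / 2), ∀ l ∉ Icc (-L) L,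
      (xs t l, ys t l) ∉ tsupport f := fun t ht l hl h => hl ((hball (hsub ht)).2 l h)
  have c0 : ContinuousOn (fun p : ℝ × ℝ => (xs p.1 p.2, ys p.1 p.2)) (J ×ˢ univ) :=
    hx.continuousOn.prodMk hy.continuousOn
  have main := hasDerivAt_integral_of_compactSupport (μ := (volume : Measure ℝ))
    (F := fun t l => f (xs t l, ys t l) * w t l)
    (F' := fun t l => (partialX f (xs t l, ys t l) * deriv (fun s => xs s l) t
        + partialY f (xs t l, ys t l) * deriv (fun s => ys s l) t) * w t l
        + f (xs t l, ys t l) * deriv (fun s => w s l) t) (w := fun _ => 1)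
    (half_pos hδ) (isCompact_Icc (a := -L) (b := L)) measurable_const (by simp)
    (fun t ht => (hf.continuous.comp ((hx.continuousOn.slab_slice (hcJ t ht)).prodMk
      (hy.continuousOn.slab_slice (hcJ t ht)))).mul (hw.continuousOn.slab_slice (hcJ t ht)))
    (fun t ht l hl => by
      rw [image_eq_zero_of_notMem_tsupport (hcL t ht l hl), zero_mul])
    (by
      have : ContinuousOn (fun p : ℝ × ℝ => (partialX f (xs p.1 p.2, ys p.1 p.2)
          * deriv (fun s => xs s p.2) p.1
        + partialY f (xs p.1 p.2, ys p.1 p.2) * deriv (fun s => ys s p.2) p.1) * w p.1 p.2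
        + f (xs p.1 p.2, ys p.1 p.2) * deriv (fun s => w s p.2) p.1) (J ×ˢ univ) :=
        ((((hf.continuous_partialX.comp_continuousOn c0).mul
            (continuousOn_deriv_timeSlice hJ hx)).add
          ((hf.continuous_partialY.comp_continuousOn c0).mul
            (continuousOn_deriv_timeSlice hJ hy))).mul hw.continuousOn).add
          ((hf.continuous.comp_continuousOn c0).mul (continuousOn_deriv_timeSlice hJ hw))
      exact this.mono (prod_mono hcJ le_rfl))
    (fun t ht l hl => by
      have h1 := hcL t ht l hl
      rw [image_eq_zero_of_notMem_tsupport h1, partialX_eq_zero_of_notMem_tsupport h1,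
        partialY_eq_zero_of_notMem_tsupport h1]
      ring)
    (fun t ht l => by
      have htJ := hcJ t (Metric.ball_subset_closedBall ht)
      have h1 := hasDerivAt_comp_plane (f := f) (X := fun s => xs s l) (Y := fun s => ys s l)
        (hf.differentiable one_ne_zero _) (hx.differentiableAt_slab hJ htJ l).timeSlice.hasDerivAt
        (hy.differentiableAt_slab hJ htJ l).timeSlice.hasDerivAt
      exact h1.mul (hw.differentiableAt_slab hJ htJ l).timeSlice.hasDerivAt)
  simpa using main

/-- Off the null set `S = 0` one has $1-H(S)=H(-S)$, which allows the two sides to be treated as two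
regions of positivity. -/
theorem region_integral_split {S mm mp φ : ℝ × ℝ → ℝ} (hS : Measurable S)
    (hS0 : volume {z | S z = 0} = 0) (hmm : Continuous mm) (hmp : Continuous mp)
    (hφ : Continuous φ) (hφc : HasCompactSupport φ) :
    ∫ z, φ z * (mm z + (mp z - mm z) * heavi (S z)) =
      (∫ z, φ z * mp z * heavi (S z)) + ∫ z, φ z * mm z * heavi (-S z) := by
  have i1 : Integrable fun z => φ z * mp z * heavi (S z) :=
    Continuous.integrable_mul_heavi (hφ.mul hmp) hφc.mul_right hS
  have i2 : Integrable fun z => φ z * mm z * heavi (-S z) :=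
    Continuous.integrable_mul_heavi (hφ.mul hmm) hφc.mul_right hS.neg
  rw [← integral_add i1 i2]
  refine integral_congr_ae ?_
  have hne : ∀ᵐ z, S z ≠ 0 := by rw [ae_iff]; simpa using hS0
  filter_upwards [hne] with z hz
  rcases lt_or_gt_of_ne hz with h | h
  · rw [heavi_of_nonpos h.le, heavi_of_pos (neg_pos.2 h)]; ring
  · rw [heavi_of_pos h, heavi_of_nonpos (neg_neg_of_pos h).le]; ring

/-! ### The front as a properly embedded moving curve -/

namespace ShockFront

variable {F : ShockFront} {T : EReal} {D : CauchyData}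

/-- The part of the surface over a compact time interval and a compact `K` is a closed level set in
a compact set. The parametrization is an embedding onto the surface, so the parameters of this part
form a compact set. A time `t₁` beyond `t₀` makes the bound uniform near `t₀`. -/
theorem IsFrontFor.isUniformlyProper (hF : F.IsFrontFor T D) :
    IsUniformlyProper (timeIco T) F.xs F.ys := by
  intro t₀ ht₀ K hK
  obtain ⟨t₁, ht₁, htt⟩ := exists_gt_mem_timeIoo ht₀
  have hsub : Icc 0 t₁ ×ˢ K ⊆ timeIco T ×ˢ (univ : Set (ℝ × ℝ)) := fun p hp =>
    ⟨mem_timeIco_of_le (timeIoo_subset_timeIco T ht₁) hp.1.1 hp.1.2, mem_univ _⟩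
  let C : Set (ℝ × (ℝ × ℝ)) := (Icc 0 t₁ ×ˢ K) ∩ Function.uncurry F.S ⁻¹' {0}
  have hcK : IsCompact (Icc 0 t₁ ×ˢ K) := isCompact_Icc.prod hK
  have hC : IsCompact C := hcK.of_isClosed_subset
    ((hF.S_smooth.continuousOn.mono hsub).preimage_isClosed_of_isClosed hcK.isClosed
      isClosed_singleton) inter_subset_left
  have hCr : C ⊆ range fun p : timeIco T × ℝ => ((p.1 : ℝ), (F.xs p.1 p.2, F.ys p.1 p.2)) := by
    rintro ⟨t, z⟩ ⟨h1, h2⟩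
    obtain ⟨l, hl⟩ := (hF.surface t (hsub h1).1 z).1 h2
    exact ⟨(⟨t, (hsub h1).1⟩, l), by simp [hl]⟩
  have hpre := hF.embedding.isInducing.isCompact_preimage' hC hCr
  obtain ⟨L, hL⟩ := (hpre.image continuous_snd).isBounded.subset_closedBall (0 : ℝ)
  refine ⟨L, ?_⟩
  rw [eventually_nhdsWithin_iff]
  filter_upwards [gt_mem_nhds htt] with t ht htI l hl
  have hmem : l ∈ Metric.closedBall (0 : ℝ) L :=
    hL ⟨(⟨t, htI⟩, l), ⟨⟨⟨htI.1, ht.le⟩, hl⟩, (hF.surface t htI _).2 ⟨l, rfl⟩⟩, rfl⟩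
  simpa [Real.closedBall_eq_Icc] using hmem

theorem IsFrontFor.injective (hF : F.IsFrontFor T D) {t : ℝ} (ht : t ∈ timeIco T) :
    Function.Injective fun l => (F.xs t l, F.ys t l) := fun l l' h => by
  have := hF.embedding.injective (a₁ := (⟨t, ht⟩, l)) (a₂ := (⟨t, ht⟩, l'))
    (by simpa using h)
  exact (Prod.mk.inj this).2

theorem IsFrontFor.isMovingCurve (hF : F.IsFrontFor T D) :
    IsMovingCurve (timeIoo T) F.S F.xs F.ys where
  S_smooth := hF.S_smooth.timeIoo
  regular := fun _ ht => hF.S_regular _ (timeIoo_subset_timeIco T ht)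
  xs_smooth := hF.xs_smooth.timeIoo
  ys_smooth := hF.ys_smooth.timeIoo
  surface := fun _ ht => hF.surface _ (timeIoo_subset_timeIco T ht)
  inj := fun _ ht => hF.injective (timeIoo_subset_timeIco T ht)
  immersion := fun _ ht => hF.immersion _ (timeIoo_subset_timeIco T ht)

theorem IsFrontFor.volume_surface (hF : F.IsFrontFor T D) {t : ℝ} (ht : t ∈ timeIco T) :
    volume {z | F.S t z = 0} = 0 := by
  have : {z | F.S t z = 0} = range fun l => (F.xs t l, F.ys t l) := by
    ext z
    refine (hF.surface t ht z).trans ?_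
    simp only [mem_range, eq_comm]
  rw [this]
  exact volume_range_curve_eq_zero (hF.xs_smooth.slab_slice ht) (hF.ys_smooth.slab_slice ht)

theorem IsFrontFor.continuousOn_action (hF : F.IsFrontFor T D) {mm mp : ℝ → ℝ × ℝ → ℝ}
    {w : ℝ → ℝ → ℝ} (hmm : ContinuousOn (Function.uncurry mm) (timeIco T ×ˢ univ))
    (hmp : ContinuousOn (Function.uncurry mp) (timeIco T ×ˢ univ))
    (hw : ContinuousOn (Function.uncurry w) (timeIco T ×ˢ univ)) {φ : ℝ × ℝ → ℝ}
    (hφ : Continuous φ) (hφc : HasCompactSupport φ) :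
    ContinuousOn (fun t => F.action (mm t) (mp t) (w t) t φ) (timeIco T) :=
  (continuousOn_integral_region hF.S_smooth.continuousOn (fun _ => hF.volume_surface) hmm hmp hφ
    hφc).add (continuousOn_integral_curve hF.xs_smooth.continuousOn hF.ys_smooth.continuousOn
      hF.isUniformlyProper hw hφ hφc)

theorem IsFrontFor.continuousOn_action_Ioo (hF : F.IsFrontFor T D) {mm mp : ℝ → ℝ × ℝ → ℝ}
    {w : ℝ → ℝ → ℝ} (hmm : ContinuousOn (Function.uncurry mm) (timeIoo T ×ˢ univ))
    (hmp : ContinuousOn (Function.uncurry mp) (timeIoo T ×ˢ univ))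
    (hw : ContinuousOn (Function.uncurry w) (timeIoo T ×ˢ univ)) {φ : ℝ × ℝ → ℝ}
    (hφ : Continuous φ) (hφc : HasCompactSupport φ) :
    ContinuousOn (fun t => F.action (mm t) (mp t) (w t) t φ) (timeIoo T) :=
  (continuousOn_integral_region hF.S_smooth.continuousOn.timeIoo
    (fun _ ht => hF.volume_surface (timeIoo_subset_timeIco T ht)) hmm hmp hφ
    hφc).add (continuousOn_integral_curve hF.xs_smooth.continuousOn.timeIoo
      hF.ys_smooth.continuousOn.timeIoo
      (hF.isUniformlyProper.mono (timeIoo_subset_timeIco T)) hw hφ hφc)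

/-- The time derivative of the action of a measure carried by the two sides of the front and by
the front itself. -/
theorem IsFrontFor.hasDerivAt_action (hF : F.IsFrontFor T D)
    (hor : ∀ t ∈ timeIoo T, ∀ l, normalDeriv F.S F.xs F.ys t l < 0)
    {mm mp pm pp qm qp : ℝ → ℝ × ℝ → ℝ} {w : ℝ → ℝ → ℝ}
    (hmm : ContDiffOn ℝ 1 (Function.uncurry mm) (timeIoo T ×ˢ univ))
    (hmp : ContDiffOn ℝ 1 (Function.uncurry mp) (timeIoo T ×ˢ univ))
    (hpm : ContDiffOn ℝ 1 (Function.uncurry pm) (timeIoo T ×ˢ univ))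
    (hpp : ContDiffOn ℝ 1 (Function.uncurry pp) (timeIoo T ×ˢ univ))
    (hqm : ContDiffOn ℝ 1 (Function.uncurry qm) (timeIoo T ×ˢ univ))
    (hqp : ContDiffOn ℝ 1 (Function.uncurry qp) (timeIoo T ×ˢ univ))
    (hw : ContDiffOn ℝ 1 (Function.uncurry w) (timeIoo T ×ˢ univ))
    {t : ℝ} (ht : t ∈ timeIoo T)
    (hem : ∀ z, 0 < -F.S t z →
      deriv (fun s => mm s z) t + partialX (pm t) z + partialY (qm t) z = 0)
    (hep : ∀ z, 0 < F.S t z →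
      deriv (fun s => mp s z) t + partialX (pp t) z + partialY (qp t) z = 0)
    {f : ℝ × ℝ → ℝ} (hf : ContDiff ℝ 1 f) (hfc : HasCompactSupport f) :
    HasDerivAt (fun s => F.action (mm s) (mp s) (w s) s f)
      (F.action (pm t) (pp t) (fun l => deriv (fun s => F.xs s l) t * w t l) t (partialX f)
        + F.action (qm t) (qp t) (fun l => deriv (fun s => F.ys s l) t * w t l) t (partialY f)
        + ∫ l, f (F.xs t l, F.ys t l) * (deriv (fun s => w s l) t
          - (curveFlux F.xs F.ys mp pp qp t l - curveFlux F.xs F.ys mm pm qm t l))) t := by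
  have hJ := isOpen_timeIoo T
  have hC := hF.isMovingCurve
  have hpr := hF.isUniformlyProper.mono (timeIoo_subset_timeIco T)
  have rp := regionBalanceAt hJ hC hpr hmp hpp hqp ht hep (θ := 1) (.inl rfl)
    (fun l => by rw [one_mul]; exact hor t ht l) hf hfc
  -- The minus side is the positivity region of `-S`. Its normal derivative has the opposite sign,
  -- hence `θ = -1`, and the two fluxes enter the result as a difference.
  have rm := regionBalanceAt hJ hC.neg hpr hmm hpm hqm ht hem (θ := -1) (.inr rfl)
    (fun l => by rw [normalDeriv_neg]; have := hor t ht l; linarith) hf hfc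
  have rc := hasDerivAt_integral_curve hJ hC.xs_smooth hC.ys_smooth hpr hw hf hfc ht
  unfold RegionBalanceAt at rp rm
  have cS : ∀ s ∈ timeIoo T, Measurable (F.S s) := fun s hs =>
    (hC.S_smooth.continuousOn.slab_slice hs).measurable
  have hnull : ∀ s ∈ timeIoo T, volume {z | F.S s z = 0} = 0 := fun s hs =>
    hF.volume_surface (timeIoo_subset_timeIco T hs)
  have e1 : (fun s => F.action (mm s) (mp s) (w s) s f) =ᶠ[𝓝 t] fun s =>
      (∫ z, f z * mp s z * heavi (F.S s z)) + (∫ z, f z * mm s z * heavi (-F.S s z))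
        + ∫ l, f (F.xs s l, F.ys s l) * w s l := by
    filter_upwards [hJ.mem_nhds ht] with s hs
    unfold action
    rw [region_integral_split (cS s hs) (hnull s hs) (hmm.continuousOn.slab_slice hs)
      (hmp.continuousOn.slab_slice hs) hf.continuous hfc]
  refine (((rp.add rm).add rc).congr_of_eventuallyEq e1).congr_deriv ?_
  unfold action
  have cfx := hf.continuous_partialX
  have cfy := hf.continuous_partialY
  have cpm := hpm.continuousOn.slab_slice ht
  have cpp := hpp.continuousOn.slab_slice ht
  have cqm := hqm.continuousOn.slab_slice ht
  have cqp := hqp.continuousOn.slab_slice ht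
  rw [region_integral_split (cS t ht) (hnull t ht) cpm cpp cfx hfc.partialX,
    region_integral_split (cS t ht) (hnull t ht) cqm cqp cfy hfc.partialY]
  have cX : Continuous fun l => (F.xs t l, F.ys t l) :=
    (hC.xs_smooth.continuousOn.slab_slice ht).prodMk (hC.ys_smooth.continuousOn.slab_slice ht)
  have integ : ∀ {φ : ℝ × ℝ → ℝ} {k : ℝ → ℝ}, Continuous φ → HasCompactSupport φ → Continuous k →
      Integrable fun l => φ (F.xs t l, F.ys t l) * k l := fun hφ hφc hk =>
    ((hφ.comp cX).mul hk).integrable_of_hasCompactSupport (hpr.hasCompactSupport ht hφc).mul_right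
  have cxt := (continuousOn_deriv_timeSlice hJ hC.xs_smooth).slab_slice
    (k := fun t l => deriv (fun s => F.xs s l) t) ht
  have cyt := (continuousOn_deriv_timeSlice hJ hC.ys_smooth).slab_slice
    (k := fun t l => deriv (fun s => F.ys s l) t) ht
  have cwt := (continuousOn_deriv_timeSlice hJ hw).slab_slice
    (k := fun t l => deriv (fun s => w s l) t) ht
  have cw := hw.continuousOn.slab_slice ht
  have cκp := (hC.continuousOn_curveFlux hJ hmp.continuousOn hpp.continuousOn
    hqp.continuousOn).slab_slice ht
  have cκm := (hC.continuousOn_curveFlux hJ hmm.continuousOn hpm.continuousOn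
    hqm.continuousOn).slab_slice ht
  have i1 : Integrable fun l => partialX f (F.xs t l, F.ys t l)
      * (deriv (fun s => F.xs s l) t * w t l) := integ cfx hfc.partialX (cxt.mul cw)
  have i2 : Integrable fun l => partialY f (F.xs t l, F.ys t l)
      * (deriv (fun s => F.ys s l) t * w t l) := integ cfy hfc.partialY (cyt.mul cw)
  have i3 := integ hf.continuous hfc cwt
  have i4 := integ hf.continuous hfc cκp
  have i5 := integ hf.continuous hfc cκm
  have s1 : ∫ l, ((partialX f (F.xs t l, F.ys t l) * deriv (fun s => F.xs s l) t
        + partialY f (F.xs t l, F.ys t l) * deriv (fun s => F.ys s l) t) * w t l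
        + f (F.xs t l, F.ys t l) * deriv (fun s => w s l) t)
      = (∫ l, partialX f (F.xs t l, F.ys t l) * (deriv (fun s => F.xs s l) t * w t l))
        + (∫ l, partialY f (F.xs t l, F.ys t l) * (deriv (fun s => F.ys s l) t * w t l))
        + ∫ l, f (F.xs t l, F.ys t l) * deriv (fun s => w s l) t := by
    have i12 : Integrable fun l => partialX f (F.xs t l, F.ys t l)
        * (deriv (fun s => F.xs s l) t * w t l)
        + partialY f (F.xs t l, F.ys t l) * (deriv (fun s => F.ys s l) t * w t l) := i1.add i2
    rw [← integral_add i1 i2, ← integral_add i12 i3]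
    congr 1; ext l; ring
  have s2 : ∫ l, f (F.xs t l, F.ys t l) * (deriv (fun s => w s l) t
          - (curveFlux F.xs F.ys mp pp qp t l - curveFlux F.xs F.ys mm pm qm t l))
      = (∫ l, f (F.xs t l, F.ys t l) * deriv (fun s => w s l) t)
        - (∫ l, f (F.xs t l, F.ys t l) * curveFlux F.xs F.ys mp pp qp t l)
        - -∫ l, f (F.xs t l, F.ys t l) * curveFlux F.xs F.ys mm pm qm t l := by
    have i6 : Integrable fun l => -(f (F.xs t l, F.ys t l) * curveFlux F.xs F.ys mm pm qm t l) :=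
      i5.neg
    rw [← integral_neg, ← integral_sub_sub i3 i4 i6]
    congr 1; ext l; ring
  have split : ∀ {p q : ℝ × ℝ → ℝ} {B : ℝ × ℝ → ℝ}, Continuous p → Continuous q → Measurable B →
      ∫ z, (partialX f z * p z + partialY f z * q z) * heavi (B z)
        = (∫ z, partialX f z * p z * heavi (B z)) + ∫ z, partialY f z * q z * heavi (B z) := by
    intro p q B hp hq hB
    have i1 : Integrable fun z => partialX f z * p z * heavi (B z) :=
      Continuous.integrable_mul_heavi (cfx.mul hp) hfc.partialX.mul_right hB
    have i2 : Integrable fun z => partialY f z * q z * heavi (B z) :=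
      Continuous.integrable_mul_heavi (cfy.mul hq) hfc.partialY.mul_right hB
    rw [← integral_add i1 i2]
    congr 1; ext z; ring
  rw [s1, s2, split cpp cqp (cS t ht), split cpm cqm (B := fun z => -F.S t z) (cS t ht).neg]
  ring

end ShockFront

/-! ### Two Gronwall type lemmas -/

/-- The function $f(s)e^{-Cs}$ is nonincreasing. Neither `f` nor `C` needs a sign, so the lemma also
gives lower bounds when applied to a negative function. -/
theorem le_mul_exp_of_hasDerivAt_le {f f' : ℝ → ℝ} {α β C : ℝ} (hαβ : α ≤ β)
    (hf : ContinuousOn f (Icc α β)) (hd : ∀ s ∈ Ioo α β, HasDerivAt f (f' s) s)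
    (hle : ∀ s ∈ Ioo α β, f' s ≤ C * f s) : f β ≤ f α * Real.exp (C * (β - α)) := by
  have hanti : AntitoneOn (fun s => f s * Real.exp (-C * s)) (Icc α β) := by
    have hder : ∀ s ∈ Ioo α β, HasDerivAt (fun s => f s * Real.exp (-C * s))
        (f' s * Real.exp (-C * s) + f s * (Real.exp (-C * s) * -C)) s := by
      intro s hs
      have h1 : HasDerivAt (fun s => Real.exp (-C * s)) (Real.exp (-C * s) * -C) s := by
        simpa using ((hasDerivAt_id s).const_mul (-C)).exp
      exact (hd s hs).mul h1
    refine antitoneOn_of_deriv_nonpos (convex_Icc α β) (hf.mul (by fun_prop)) ?_ ?_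
    · rw [interior_Icc]
      exact fun s hs => (hder s hs).differentiableAt.differentiableWithinAt
    · rw [interior_Icc]
      intro s hs
      rw [(hder s hs).deriv]
      have h2 := Real.exp_pos (-C * s)
      have h3 := hle s hs
      have : f' s * Real.exp (-C * s) + f s * (Real.exp (-C * s) * -C)
        = (f' s - C * f s) * Real.exp (-C * s) := by ring
      rw [this]
      exact mul_nonpos_of_nonpos_of_nonneg (by linarith) h2.le
  have h := hanti (left_mem_Icc.2 hαβ) (right_mem_Icc.2 hαβ) hαβ
  have e : Real.exp (C * (β - α)) = Real.exp (-C * α) * Real.exp (C * β) := by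
    rw [← Real.exp_add]; congr 1; ring
  have e2 : Real.exp (-C * β) * Real.exp (C * β) = 1 := by
    rw [← Real.exp_add]; simp
  calc f β = f β * Real.exp (-C * β) * Real.exp (C * β) := by rw [mul_assoc, e2, mul_one]
    _ ≤ f α * Real.exp (-C * α) * Real.exp (C * β) :=
      mul_le_mul_of_nonneg_right h (Real.exp_pos _).le
    _ = _ := by rw [e]; ring

/-- A coupled uniqueness statement: `w₁, w₂` satisfy a linear system as long as `R ≠ 0`, and `R`
satisfies a linear equation as long as `w₁ = w₂ = 0`. -/
theorem coupled_linear_ode {w₁ w₂ R : ℝ → ℝ} {α β C : ℝ}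
    (hw₁ : ContinuousOn w₁ (Icc α β)) (hw₂ : ContinuousOn w₂ (Icc α β))
    (hR : ContinuousOn R (Icc α β))
    (hw : ∀ s ∈ Ioo α β, R s ≠ 0 → ∃ d₁ d₂, HasDerivAt w₁ d₁ s ∧ HasDerivAt w₂ d₂ s ∧
      |d₁| ≤ C * (|w₁ s| + |w₂ s|) ∧ |d₂| ≤ C * (|w₁ s| + |w₂ s|))
    (hR' : ∀ s ∈ Ioo α β, w₁ s = 0 → w₂ s = 0 → ∃ d, HasDerivAt R d s ∧ |d| ≤ C * |R s|)
    (h₁ : w₁ α = 0) (h₂ : w₂ α = 0) (hRα : R α ≠ 0) :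
    ∀ s ∈ Icc α β, w₁ s = 0 ∧ w₂ s = 0 ∧ R s ≠ 0 := by
  -- Until `R` vanishes, $w_1^2+w_2^2$ satisfies a linear differential inequality and starts from
  -- zero.
  have step1 : ∀ τ ∈ Icc α β, (∀ s ∈ Ioo α τ, R s ≠ 0) → w₁ τ = 0 ∧ w₂ τ = 0 := by
    intro τ hτ hne
    have hsub : Ioo α τ ⊆ Ioo α β := Ioo_subset_Ioo_right hτ.2
    have hsub' : Icc α τ ⊆ Icc α β := Icc_subset_Icc_right hτ.2
    have hex : ∀ s ∈ Ioo α τ, ∃ d, HasDerivAt (fun s => w₁ s ^ 2 + w₂ s ^ 2) d s ∧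
        d ≤ (4 * |C|) * (w₁ s ^ 2 + w₂ s ^ 2) := by
      intro s hs
      obtain ⟨d₁, d₂, a1, a2, b1, b2⟩ := hw s (hsub hs) (hne s hs)
      refine ⟨2 * w₁ s * d₁ + 2 * w₂ s * d₂, ?_, ?_⟩
      · exact ((a1.pow 2).add (a2.pow 2)).congr_deriv (by simp)
      · have n1 := abs_nonneg (w₁ s)
        have n2 := abs_nonneg (w₂ s)
        have hCC : C * (|w₁ s| + |w₂ s|) ≤ |C| * (|w₁ s| + |w₂ s|) :=
          mul_le_mul_of_nonneg_right (le_abs_self C) (by positivity)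
        have c1 : w₁ s * d₁ ≤ |w₁ s| * (|C| * (|w₁ s| + |w₂ s|)) :=
          (le_abs_self _).trans (by rw [abs_mul]; exact mul_le_mul_of_nonneg_left (b1.trans hCC) n1)
        have c2 : w₂ s * d₂ ≤ |w₂ s| * (|C| * (|w₁ s| + |w₂ s|)) :=
          (le_abs_self _).trans (by rw [abs_mul]; exact mul_le_mul_of_nonneg_left (b2.trans hCC) n2)
        have e1 : w₁ s ^ 2 = |w₁ s| ^ 2 := (sq_abs _).symm
        have e2 : w₂ s ^ 2 = |w₂ s| ^ 2 := (sq_abs _).symm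
        have hC0 := abs_nonneg C
        rw [e1, e2]
        nlinarith [mul_nonneg hC0 (sq_nonneg (|w₁ s| - |w₂ s|))]
    choose! d hd hle using hex
    have := le_mul_exp_of_hasDerivAt_le (f := fun s => w₁ s ^ 2 + w₂ s ^ 2) hτ.1
      (((hw₁.mono hsub').pow 2).add ((hw₂.mono hsub').pow 2)) hd hle
    simp only [h₁, h₂] at this
    have h0 : w₁ τ ^ 2 + w₂ τ ^ 2 ≤ 0 := by simpa using this
    constructor <;> nlinarith [sq_nonneg (w₁ τ), sq_nonneg (w₂ τ)]
  -- At a first zero `τ` of `R`, the functions `w₁`, `w₂` would vanish on the whole interval before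
  -- it. Then $R^2$ decays at most exponentially from a positive value, so it cannot reach zero.
  have step2 : ∀ s ∈ Icc α β, R s ≠ 0 := by
    by_contra! hcon
    obtain ⟨s₀, hs₀, hRs₀⟩ := hcon
    have hZ : IsCompact (Icc α β ∩ R ⁻¹' {0}) := isCompact_Icc.of_isClosed_subset
      (hR.preimage_isClosed_of_isClosed isClosed_Icc isClosed_singleton) inter_subset_left
    have hτ := hZ.sInf_mem ⟨s₀, hs₀, hRs₀⟩
    set τ := sInf (Icc α β ∩ R ⁻¹' {0})
    have hRτ : R τ = 0 := hτ.2
    have hlt : ∀ s ∈ Ioo α τ, R s ≠ 0 := fun s hs h0 =>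
      (csInf_le hZ.bddBelow ⟨⟨hs.1.le, hs.2.le.trans hτ.1.2⟩, h0⟩).not_gt hs.2
    have hsub : Ioo α τ ⊆ Ioo α β := Ioo_subset_Ioo_right hτ.1.2
    have hex : ∀ s ∈ Ioo α τ, ∃ d, HasDerivAt (fun s => -R s ^ 2) d s ∧
        d ≤ (-(2 * C)) * (-R s ^ 2) := by
      intro s hs
      obtain ⟨k1, k2⟩ := step1 s ⟨hs.1.le, hs.2.le.trans hτ.1.2⟩ fun r hr =>
        hlt r ⟨hr.1, hr.2.trans hs.2⟩
      obtain ⟨d, hd, hle⟩ := hR' s (hsub hs) k1 k2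
      refine ⟨-(2 * R s * d), ?_, ?_⟩
      · exact ((hd.pow 2).neg).congr_deriv (by simp)
      · have : -(R s * d) ≤ |R s| * (C * |R s|) := (neg_le_abs _).trans (by
          rw [abs_mul]; exact mul_le_mul_of_nonneg_left hle (abs_nonneg _))
        have e : |R s| * (C * |R s|) = C * R s ^ 2 := by rw [← sq_abs (R s)]; ring
        linarith
    choose! d hd hle using hex
    -- Applied to $-R^2$, the upper bound is a positive lower bound for $R(\tau)^2$.
    have := le_mul_exp_of_hasDerivAt_le (f := fun s => -R s ^ 2) hτ.1.1
      ((hR.mono (Icc_subset_Icc_right hτ.1.2)).pow 2).neg hd hle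
    simp only [hRτ] at this
    have hpos : 0 < R α ^ 2 * Real.exp (-(2 * C) * (τ - α)) := by positivity
    linarith
  intro s hs
  obtain ⟨k1, k2⟩ := step1 s hs fun r hr => step2 r ⟨hr.1.le, hr.2.le.trans hs.2⟩
  exact ⟨k1, k2, step2 s hs⟩

/-- The hypotheses bound only absolute values of derivatives, so they are invariant under the
reflection $s\mapsto\alpha+\beta-s$. -/
theorem coupled_linear_ode_backward {w₁ w₂ R : ℝ → ℝ} {α β C : ℝ}
    (hw₁ : ContinuousOn w₁ (Icc α β)) (hw₂ : ContinuousOn w₂ (Icc α β))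
    (hR : ContinuousOn R (Icc α β))
    (hw : ∀ s ∈ Ioo α β, R s ≠ 0 → ∃ d₁ d₂, HasDerivAt w₁ d₁ s ∧ HasDerivAt w₂ d₂ s ∧
      |d₁| ≤ C * (|w₁ s| + |w₂ s|) ∧ |d₂| ≤ C * (|w₁ s| + |w₂ s|))
    (hR' : ∀ s ∈ Ioo α β, w₁ s = 0 → w₂ s = 0 → ∃ d, HasDerivAt R d s ∧ |d| ≤ C * |R s|)
    (h₁ : w₁ β = 0) (h₂ : w₂ β = 0) (hRβ : R β ≠ 0) :
    ∀ s ∈ Icc α β, w₁ s = 0 ∧ w₂ s = 0 ∧ R s ≠ 0 := by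
  have hm : MapsTo (fun s => α + β - s) (Icc α β) (Icc α β) := fun s hs =>
    ⟨by linarith [hs.2], by linarith [hs.1]⟩
  have hm' : MapsTo (fun s => α + β - s) (Ioo α β) (Ioo α β) := fun s hs =>
    ⟨by linarith [hs.2], by linarith [hs.1]⟩
  have hc : ContinuousOn (fun s => α + β - s) (Icc α β) := by fun_prop
  have hd : ∀ s, HasDerivAt (fun s => α + β - s) (-1) s := fun s => by
    simpa using (hasDerivAt_id s).const_sub (α + β)
  have key := coupled_linear_ode (w₁ := fun s => w₁ (α + β - s)) (w₂ := fun s => w₂ (α + β - s))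
    (R := fun s => R (α + β - s)) (C := C) (hw₁.comp hc hm) (hw₂.comp hc hm) (hR.comp hc hm)
    (fun s hs hne => by
      obtain ⟨d₁, d₂, a1, a2, b1, b2⟩ := hw _ (hm' hs) hne
      refine ⟨d₁ * -1, d₂ * -1, a1.comp s (hd s), a2.comp s (hd s), ?_, ?_⟩ <;> simpa)
    (fun s hs k1 k2 => by
      obtain ⟨d, a, b⟩ := hR' _ (hm' hs) k1 k2
      exact ⟨d * -1, a.comp s (hd s), by simpa⟩)
    (by simpa) (by simpa) (by simpa)
  intro s hs
  have := key (α + β - s) (hm hs)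
  simpa using this

/-! ### Derivatives up to the initial time -/

theorem uniqueDiffOn_timeIco {T : EReal} (hT : 0 < T) : UniqueDiffOn ℝ (timeIco T) := by
  refine uniqueDiffOn_convex ?_ ?_
  · refine Set.OrdConnected.convex ⟨fun x hx y hy z hz => ⟨hx.1.trans hz.1, ?_⟩⟩
    exact (EReal.coe_le_coe_iff.2 hz.2).trans_lt hy.2
  · obtain ⟨t, ht, -⟩ := exists_gt_mem_timeIoo (zero_mem_timeIco hT)
    exact ⟨t, interior_maximal (timeIoo_subset_timeIco T) (isOpen_timeIoo T) ht⟩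

section UpToInitialTime

variable {E : Type*} [NormedAddCommGroup E] [NormedSpace ℝ E] {T : EReal} {M : ℝ → E → ℝ}

/-- Each time slice is the whole space, so the spatial derivative is an unrestricted one even at `t
= 0`; it is read off from the derivative within the slab. -/
theorem continuousOn_fderiv_slice_Ico (hT : 0 < T)
    (hM : ContDiffOn ℝ 1 (Function.uncurry M) (timeIco T ×ˢ univ)) (w : E) :
    ContinuousOn (fun p : ℝ × E => fderiv ℝ (M p.1) p.2 w) (timeIco T ×ˢ univ) := by
  have hu : UniqueDiffOn ℝ (timeIco T ×ˢ (univ : Set E)) :=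
    (uniqueDiffOn_timeIco hT).prod uniqueDiffOn_univ
  have h := (hM.continuousOn_fderivWithin hu le_rfl).clm_apply
    (continuousOn_const (c := ((0 : ℝ), w)))
  refine h.congr fun p hp => ?_
  have hd := ((hM.differentiableOn one_ne_zero) p hp).hasFDerivWithinAt
  have h2 := HasFDerivWithinAt.comp (f := fun r : E => (p.1, r)) (s := univ) p.2 hd
    (((hasFDerivAt_const p.1 p.2).prodMk (hasFDerivAt_id p.2)).hasFDerivWithinAt)
    fun z _ => ⟨hp.1, mem_univ _⟩
  rw [hasFDerivWithinAt_univ] at h2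
  have h3 : fderiv ℝ (M p.1) p.2 = _ := h2.fderiv
  rw [h3]; simp

/-- At `t = 0` the two-sided time derivative depends on values outside the slab. The derivative
within the slab is continuous up to that time and agrees with it for positive times. -/
theorem exists_continuousOn_deriv_time_Ico (hT : 0 < T)
    (hM : ContDiffOn ℝ 1 (Function.uncurry M) (timeIco T ×ˢ univ)) :
    ∃ g : ℝ → E → ℝ, ContinuousOn (Function.uncurry g) (timeIco T ×ˢ univ) ∧
      ∀ t ∈ timeIoo T, ∀ z, deriv (fun s => M s z) t = g t z := by
  have hu : UniqueDiffOn ℝ (timeIco T ×ˢ (univ : Set E)) :=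
    (uniqueDiffOn_timeIco hT).prod uniqueDiffOn_univ
  refine ⟨fun t z => fderivWithin ℝ (Function.uncurry M) (timeIco T ×ˢ univ) (t, z) (1, 0),
    (hM.continuousOn_fderivWithin hu le_rfl).clm_apply continuousOn_const, fun t ht z => ?_⟩
  have ho : (timeIco T ×ˢ (univ : Set E)) ∈ 𝓝 (t, z) :=
    mem_of_superset (((isOpen_timeIoo T).prod isOpen_univ).mem_nhds ⟨ht, mem_univ z⟩)
      (prod_mono (timeIoo_subset_timeIco T) le_rfl)
  change _ = fderivWithin ℝ (Function.uncurry M) (timeIco T ×ˢ univ) (t, z) (1, 0)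
  rw [fderivWithin_of_mem_nhds ho]
  exact deriv_timeSlice_eq ((hM.contDiffAt ho).differentiableAt one_ne_zero)

end UpToInitialTime

theorem continuousOn_partialX_Ico {T : EReal} {M : ℝ → ℝ × ℝ → ℝ} (hT : 0 < T)
    (hM : ContDiffOn ℝ 1 (Function.uncurry M) (timeIco T ×ˢ univ)) :
    ContinuousOn (Function.uncurry fun t z => partialX (M t) z) (timeIco T ×ˢ univ) :=
  (continuousOn_fderiv_slice_Ico hT hM (1, 0)).congr fun _ hp =>
    partialX_eq_fderiv ((hM.slab_slice hp.1).differentiable one_ne_zero _)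

theorem continuousOn_partialY_Ico {T : EReal} {M : ℝ → ℝ × ℝ → ℝ} (hT : 0 < T)
    (hM : ContDiffOn ℝ 1 (Function.uncurry M) (timeIco T ×ˢ univ)) :
    ContinuousOn (Function.uncurry fun t z => partialY (M t) z) (timeIco T ×ˢ univ) :=
  (continuousOn_fderiv_slice_Ico hT hM (0, 1)).congr fun _ hp =>
    partialY_eq_fderiv ((hM.slab_slice hp.1).differentiable one_ne_zero _)

theorem continuousOn_deriv_line_Ico {T : EReal} {x : ℝ → ℝ → ℝ} (hT : 0 < T)
    (hx : ContDiffOn ℝ 1 (Function.uncurry x) (timeIco T ×ˢ univ)) :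
    ContinuousOn (Function.uncurry fun t l => deriv (x t) l) (timeIco T ×ˢ univ) :=
  (continuousOn_fderiv_slice_Ico hT hx 1).congr fun _ _ => fderiv_apply_one_eq_deriv.symm

/-! ### The transport equations along straight lines -/

/-- Subtracting the velocity times the continuity equation from the momentum equations leaves the
density times a material derivative. The density factor is kept, since it may vanish at this stage.
-/
theorem FlowField.SolvesAt.transport {F : FlowField} {t : ℝ} {z : ℝ × ℝ} (h : F.SolvesAt t z)
    (hr : DifferentiableAt ℝ (Function.uncurry F.rho) (t, z))
    (hu : DifferentiableAt ℝ (Function.uncurry F.u) (t, z))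
    (hv : DifferentiableAt ℝ (Function.uncurry F.v) (t, z)) :
    (deriv (fun s => F.rho s z) t + partialX (F.rho t) z * F.u t z + partialY (F.rho t) z * F.v t z
      = -F.rho t z * (partialX (F.u t) z + partialY (F.v t) z)) ∧
    (F.rho t z * (deriv (fun s => F.u s z) t + partialX (F.u t) z * F.u t z
      + partialY (F.u t) z * F.v t z) = 0) ∧
    (F.rho t z * (deriv (fun s => F.v s z) t + partialX (F.v t) z * F.u t z
      + partialY (F.v t) z * F.v t z) = 0) := by
  obtain ⟨h1, h2, h3⟩ := h
  have r := hr.slice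
  have u := hu.slice
  have v := hv.slice
  have ru : DifferentiableAt ℝ (fun w => F.rho t w * F.u t w) z := r.mul u
  have rv : DifferentiableAt ℝ (fun w => F.rho t w * F.v t w) z := r.mul v
  have e1 : (fun w => F.rho t w * F.u t w ^ 2) = fun w => (F.rho t w * F.u t w) * F.u t w := by
    ext w; ring
  have e2 : (fun w => F.rho t w * F.v t w ^ 2) = fun w => (F.rho t w * F.v t w) * F.v t w := by
    ext w; ring
  have e3 : deriv (fun s => F.rho s z * F.u s z) t = _ :=
    (hr.timeSlice.hasDerivAt.mul hu.timeSlice.hasDerivAt).deriv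
  have e4 : deriv (fun s => F.rho s z * F.v s z) t = _ :=
    (hr.timeSlice.hasDerivAt.mul hv.timeSlice.hasDerivAt).deriv
  rw [partialX_mul r u, partialY_mul r v] at h1
  rw [e1, e3, partialX_mul ru u, partialX_mul r u, partialY_mul ru v,
    partialY_mul r u] at h2
  rw [e2, e4, partialX_mul ru v, partialX_mul r u, partialY_mul rv v,
    partialY_mul r v] at h3
  refine ⟨by linarith, ?_, ?_⟩
  · linear_combination h2 - F.u t z * h1
  · linear_combination h3 - F.v t z * h1

/-- One side of a front together with the characteristics that reach the front from it. -/
structure IsFrontSide (T : EReal) (S : ℝ → ℝ × ℝ → ℝ) (xs ys : ℝ → ℝ → ℝ) (Φ : FlowField) (σ : ℝ)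
    (s : PlaneState) (K : Set (ℝ × ℝ)) (a b : ℝ → ℝ → ℝ) : Prop where
  T_pos : 0 < T
  S_smooth : ContDiffOn ℝ 1 (Function.uncurry S) (timeIco T ×ˢ univ)
  xs_smooth : ContDiffOn ℝ 1 (Function.uncurry xs) (timeIco T ×ˢ univ)
  ys_smooth : ContDiffOn ℝ 1 (Function.uncurry ys) (timeIco T ×ˢ univ)
  surface : ∀ t ∈ timeIco T, ∀ z, S t z = 0 ↔ ∃ l, z = (xs t l, ys t l)
  field : Φ.IsSideField T S σ s K
  position : IsInitialPosition T S σ s xs ys a b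
  closed : IsClosed K
  mem_of_pos : ∀ z, 0 < σ * S 0 z → z ∈ K
  rho_pos : ∀ z ∈ K, 0 < s.rho z

namespace IsFrontSide

variable {T : EReal} {S : ℝ → ℝ × ℝ → ℝ} {xs ys : ℝ → ℝ → ℝ} {Φ : FlowField} {σ : ℝ}
  {s : PlaneState} {K : Set (ℝ × ℝ)} {a b : ℝ → ℝ → ℝ}

theorem continuousOn_line {M : ℝ → ℝ × ℝ → ℝ} {T : EReal}
    (hM : ContinuousOn (Function.uncurry M) (timeIco T ×ˢ univ)) {α β : ℝ} (hα : 0 ≤ α)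
    (hβ : β ∈ timeIco T) (x y c d : ℝ) :
    ContinuousOn (fun r => M r (x + r * c, y + r * d)) (Icc α β) :=
  hM.comp (f := fun r : ℝ => (r, (x + r * c, y + r * d))) (by fun_prop) fun _ hr =>
    ⟨mem_timeIco_of_le hβ (hα.trans hr.1) hr.2, mem_univ _⟩

/-- The hypotheses of `coupled_linear_ode` along a straight line in the region of smooth flow. -/
theorem line_ode (h : IsFrontSide T S xs ys Φ σ s K a b) {α β : ℝ} (hα : 0 ≤ α)
    (hβ : β ∈ timeIco T) (x y c d : ℝ)
    (hside : ∀ r ∈ Ioo α β, 0 < σ * S r (x + r * c, y + r * d)) :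
    ∃ C : ℝ, (∀ r ∈ Ioo α β, Φ.rho r (x + r * c, y + r * d) ≠ 0 → ∃ d₁ d₂,
        HasDerivAt (fun r => Φ.u r (x + r * c, y + r * d) - c) d₁ r ∧
        HasDerivAt (fun r => Φ.v r (x + r * c, y + r * d) - d) d₂ r ∧
        |d₁| ≤ C * (|Φ.u r (x + r * c, y + r * d) - c| + |Φ.v r (x + r * c, y + r * d) - d|) ∧
        |d₂| ≤ C * (|Φ.u r (x + r * c, y + r * d) - c| + |Φ.v r (x + r * c, y + r * d) - d|)) ∧
      (∀ r ∈ Ioo α β, Φ.u r (x + r * c, y + r * d) - c = 0 → Φ.v r (x + r * c, y + r * d) - d = 0 →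
        ∃ e, HasDerivAt (fun r => Φ.rho r (x + r * c, y + r * d)) e r ∧
          |e| ≤ C * |Φ.rho r (x + r * c, y + r * d)|) := by
  have bound : ∀ M : ℝ → ℝ × ℝ → ℝ, ContinuousOn (Function.uncurry M) (timeIco T ×ˢ univ) →
      ∃ C, ∀ r ∈ Icc α β, |M r (x + r * c, y + r * d)| ≤ C := fun M hM =>
    isCompact_Icc.exists_bound_of_continuousOn (continuousOn_line hM hα hβ x y c d)
  have hu := h.field.u_smooth
  have hv := h.field.v_smooth
  have hr := h.field.rho_smooth
  obtain ⟨C₁, hC₁⟩ := bound _ (continuousOn_partialX_Ico h.T_pos hu)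
  obtain ⟨C₂, hC₂⟩ := bound _ (continuousOn_partialY_Ico h.T_pos hu)
  obtain ⟨C₃, hC₃⟩ := bound _ (continuousOn_partialX_Ico h.T_pos hv)
  obtain ⟨C₄, hC₄⟩ := bound _ (continuousOn_partialY_Ico h.T_pos hv)
  have hJ := isOpen_timeIoo T
  have hl1 : ∀ r : ℝ, HasDerivAt (fun r => x + r * c) c r := fun r => by
    simpa using ((hasDerivAt_id r).mul_const c).const_add x
  have hl2 : ∀ r : ℝ, HasDerivAt (fun r => y + r * d) d r := fun r => by
    simpa using ((hasDerivAt_id r).mul_const d).const_add y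
  have hmem : ∀ r ∈ Ioo α β, r ∈ timeIoo T := fun r hr' =>
    mem_timeIoo_of_le hβ (hα.trans_lt hr'.1) hr'.2.le
  -- The bounds of the four spatial derivatives of the velocity along the segment; their sum serves
  -- all three estimates.
  refine ⟨C₁ + C₂ + C₃ + C₄, fun r hr' hne => ?_, fun r hr' hu0 hv0 => ?_⟩
  · obtain ⟨-, t2, t3⟩ := (h.field.solves r (hmem r hr') _ (hside r hr')).transport
      (hr.timeIoo.differentiableAt_slab hJ (hmem r hr') _)
      (hu.timeIoo.differentiableAt_slab hJ (hmem r hr') _)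
      (hv.timeIoo.differentiableAt_slab hJ (hmem r hr') _)
    replace t2 := (mul_eq_zero.1 t2).resolve_left hne
    replace t3 := (mul_eq_zero.1 t3).resolve_left hne
    have hI := Ioo_subset_Icc_self hr'
    have b1 := hC₁ r hI
    have b2 := hC₂ r hI
    have b3 := hC₃ r hI
    have b4 := hC₄ r hI
    refine ⟨_, _, (hasDerivAt_comp_flow (hu.timeIoo.differentiableAt_slab hJ (hmem r hr') _)
      (hl1 r) (hl2 r)).sub_const c, (hasDerivAt_comp_flow
      (hv.timeIoo.differentiableAt_slab hJ (hmem r hr') _) (hl1 r) (hl2 r)).sub_const d, ?_, ?_⟩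
    · generalize Φ.u r (x + r * c, y + r * d) = u₀ at *
      generalize Φ.v r (x + r * c, y + r * d) = v₀ at *
      generalize partialX (Φ.u r) (x + r * c, y + r * d) = p at *
      generalize partialY (Φ.u r) (x + r * c, y + r * d) = q at *
      -- The line has slope `(c, d)` instead of `(u, v)`. By the transport equation the derivative
      -- along it is linear in the differences `u - c`, `v - d`.
      have e : deriv (fun s => Φ.u s (x + r * c, y + r * d)) r + p * c + q * d
          = -(p * (u₀ - c)) - q * (v₀ - d) := by linear_combination t2
      rw [e]
      have k1 : |p * (u₀ - c)| ≤ C₁ * |u₀ - c| := by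
        rw [abs_mul]; exact mul_le_mul_of_nonneg_right b1 (abs_nonneg _)
      have k2 : |q * (v₀ - d)| ≤ C₂ * |v₀ - d| := by
        rw [abs_mul]; exact mul_le_mul_of_nonneg_right b2 (abs_nonneg _)
      have k3 : |-(p * (u₀ - c)) - q * (v₀ - d)| ≤ |p * (u₀ - c)| + |q * (v₀ - d)| := by
        simpa using abs_sub (-(p * (u₀ - c))) (q * (v₀ - d))
      have n1 := abs_nonneg (u₀ - c)
      have n2 := abs_nonneg (v₀ - d)
      have m1 := (abs_nonneg _).trans b1
      have m2 := (abs_nonneg _).trans b2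
      have m3 := (abs_nonneg _).trans b3
      have m4 := (abs_nonneg _).trans b4
      nlinarith [mul_nonneg m1 n2, mul_nonneg m2 n1, mul_nonneg m3 n1, mul_nonneg m3 n2,
        mul_nonneg m4 n1, mul_nonneg m4 n2]
    · generalize Φ.u r (x + r * c, y + r * d) = u₀ at *
      generalize Φ.v r (x + r * c, y + r * d) = v₀ at *
      generalize partialX (Φ.v r) (x + r * c, y + r * d) = p at *
      generalize partialY (Φ.v r) (x + r * c, y + r * d) = q at *
      have e : deriv (fun s => Φ.v s (x + r * c, y + r * d)) r + p * c + q * d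
          = -(p * (u₀ - c)) - q * (v₀ - d) := by linear_combination t3
      rw [e]
      have k1 : |p * (u₀ - c)| ≤ C₃ * |u₀ - c| := by
        rw [abs_mul]; exact mul_le_mul_of_nonneg_right b3 (abs_nonneg _)
      have k2 : |q * (v₀ - d)| ≤ C₄ * |v₀ - d| := by
        rw [abs_mul]; exact mul_le_mul_of_nonneg_right b4 (abs_nonneg _)
      have k3 : |-(p * (u₀ - c)) - q * (v₀ - d)| ≤ |p * (u₀ - c)| + |q * (v₀ - d)| := by
        simpa using abs_sub (-(p * (u₀ - c))) (q * (v₀ - d))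
      have n1 := abs_nonneg (u₀ - c)
      have n2 := abs_nonneg (v₀ - d)
      have m1 := (abs_nonneg _).trans b1
      have m2 := (abs_nonneg _).trans b2
      have m3 := (abs_nonneg _).trans b3
      have m4 := (abs_nonneg _).trans b4
      nlinarith [mul_nonneg m1 n2, mul_nonneg m2 n1, mul_nonneg m3 n2, mul_nonneg m1 n1,
        mul_nonneg m4 n1, mul_nonneg m2 n2]
  · obtain ⟨t1, -, -⟩ := (h.field.solves r (hmem r hr') _ (hside r hr')).transport
      (hr.timeIoo.differentiableAt_slab hJ (hmem r hr') _)
      (hu.timeIoo.differentiableAt_slab hJ (hmem r hr') _)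
      (hv.timeIoo.differentiableAt_slab hJ (hmem r hr') _)
    have hI := Ioo_subset_Icc_self hr'
    have b1 := hC₁ r hI
    have b2 := hC₂ r hI
    have b3 := hC₃ r hI
    have b4 := hC₄ r hI
    refine ⟨_, hasDerivAt_comp_flow (hr.timeIoo.differentiableAt_slab hJ (hmem r hr') _)
      (hl1 r) (hl2 r), ?_⟩
    -- Where the velocity equals the slope, the derivative along the line is the material
    -- derivative, and the continuity equation makes it proportional to the density.
    rw [sub_eq_zero.1 hu0, sub_eq_zero.1 hv0] at t1
    rw [t1, abs_mul, abs_neg, mul_comm]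
    refine mul_le_mul_of_nonneg_right ?_ (abs_nonneg _)
    have m2 := (abs_nonneg _).trans b2
    have m3 := (abs_nonneg _).trans b3
    exact (abs_add_le _ _).trans (by linarith)

/-- The velocity stays equal to the slope as long as the density is nonzero, and the density stays
nonzero as long as the velocity equals the slope; the coupled lemma closes this circle. Positivity
then follows from the intermediate value theorem. -/
theorem forward_line (h : IsFrontSide T S xs ys Φ σ s K a b) {α β : ℝ} (hα : 0 ≤ α)
    (hβ : β ∈ timeIco T) {x y c d : ℝ}
    (hside : ∀ r ∈ Ioo α β, 0 < σ * S r (x + r * c, y + r * d))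
    (hu : Φ.u α (x + α * c, y + α * d) = c) (hv : Φ.v α (x + α * c, y + α * d) = d)
    (hr : 0 < Φ.rho α (x + α * c, y + α * d)) :
    ∀ r ∈ Icc α β, Φ.u r (x + r * c, y + r * d) = c ∧ Φ.v r (x + r * c, y + r * d) = d ∧
      0 < Φ.rho r (x + r * c, y + r * d) := by
  obtain ⟨C, h1, h2⟩ := h.line_ode hα hβ x y c d hside
  have cr := continuousOn_line h.field.rho_smooth.continuousOn hα hβ x y c d
  have key := coupled_linear_ode
    ((continuousOn_line h.field.u_smooth.continuousOn hα hβ x y c d).sub continuousOn_const)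
    ((continuousOn_line h.field.v_smooth.continuousOn hα hβ x y c d).sub continuousOn_const)
    cr h1 h2 (sub_eq_zero.2 hu) (sub_eq_zero.2 hv) hr.ne'
  intro r hrI
  refine ⟨sub_eq_zero.1 (key r hrI).1, sub_eq_zero.1 (key r hrI).2.1, ?_⟩
  by_contra hneg
  obtain ⟨q, hq, hq0⟩ := intermediate_value_Icc' hrI.1 (cr.mono (Icc_subset_Icc_right hrI.2))
    (show (0 : ℝ) ∈ Icc _ _ from ⟨not_lt.1 hneg, hr.le⟩)
  exact (key q ⟨hq.1, hq.2.trans hrI.2⟩).2.2 hq0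

/-- A negative density would be carried back along its straight characteristic. This is the tool for
excluding negative densities at points not known to lie on a characteristic from the data. -/
theorem backward_line (h : IsFrontSide T S xs ys Φ σ s K a b) {α β : ℝ} (hα : 0 ≤ α)
    (hαβ : α ≤ β) (hβ : β ∈ timeIco T) {x y c d : ℝ}
    (hside : ∀ r ∈ Ioo α β, 0 < σ * S r (x + r * c, y + r * d))
    (hu : Φ.u β (x + β * c, y + β * d) = c) (hv : Φ.v β (x + β * c, y + β * d) = d)
    (hr : Φ.rho β (x + β * c, y + β * d) < 0) : Φ.rho α (x + α * c, y + α * d) < 0 := by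
  obtain ⟨C, h1, h2⟩ := h.line_ode hα hβ x y c d hside
  have cr := continuousOn_line h.field.rho_smooth.continuousOn hα hβ x y c d
  have key := coupled_linear_ode_backward
    ((continuousOn_line h.field.u_smooth.continuousOn hα hβ x y c d).sub continuousOn_const)
    ((continuousOn_line h.field.v_smooth.continuousOn hα hβ x y c d).sub continuousOn_const)
    cr h1 h2 (sub_eq_zero.2 hu) (sub_eq_zero.2 hv) hr.ne
  by_contra hneg
  obtain ⟨q, hq, hq0⟩ := intermediate_value_Icc' hαβ cr
    (show (0 : ℝ) ∈ Icc _ _ from ⟨hr.le, not_lt.1 hneg⟩)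
  exact (key q hq).2.2 hq0

theorem initial_mem_of_pos (h : IsFrontSide T S xs ys Φ σ s K a b) {t : ℝ} (ht : t ∈ timeIoo T)
    (l : ℝ) : 0 < σ * S 0 (a t l, b t l) := by
  simpa using h.position.from_side t ht l 0 le_rfl ht.1

/-- For positive times the foot of the characteristic lies strictly on the side; at `t = 0` it is a
limit of such feet, and `K` is closed. -/
theorem initial_mem (h : IsFrontSide T S xs ys Φ σ s K a b) {t : ℝ} (ht : t ∈ timeIco T)
    (l : ℝ) : (a t l, b t l) ∈ K := by
  have hpos : ∀ t ∈ timeIoo T, (a t l, b t l) ∈ K := fun t ht =>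
    h.mem_of_pos _ (h.initial_mem_of_pos ht l)
  rcases ht.1.eq_or_lt with h0 | h0
  · have hc : ContinuousWithinAt (fun t => (a t l, b t l)) (timeIoo T) t :=
      ((h.position.a_smooth.continuousOn.slab_time l t ht).prodMk
        (h.position.b_smooth.continuousOn.slab_time l t ht)).mono (timeIoo_subset_timeIco T)
    have hne : (𝓝[timeIoo T] t).NeBot := by
      rw [← mem_closure_iff_nhdsWithin_neBot, ← h0]
      obtain ⟨t₁, ht₁, -⟩ := exists_gt_mem_timeIoo (zero_mem_timeIco h.T_pos)
      have hsub : Ioo 0 t₁ ⊆ timeIoo T := fun r hr =>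
        mem_timeIoo_of_le (timeIoo_subset_timeIco T ht₁) hr.1 hr.2.le
      refine closure_mono hsub ?_
      rw [closure_Ioo ht₁.1.ne]
      exact left_mem_Icc.2 ht₁.1.le
    exact h.closed.mem_of_tendsto hc (eventually_of_mem self_mem_nhdsWithin hpos)
  · exact hpos t ⟨h0, ht.2⟩

/-- The velocity is constant and the density is positive along the characteristics that reach the
front. -/
theorem characteristic (h : IsFrontSide T S xs ys Φ σ s K a b) {t : ℝ} (ht : t ∈ timeIco T)
    (l : ℝ) {τ : ℝ} (hτ : τ ∈ Icc 0 t) :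
    Φ.u τ (a t l + τ * s.u (a t l, b t l), b t l + τ * s.v (a t l, b t l)) = s.u (a t l, b t l) ∧
    Φ.v τ (a t l + τ * s.u (a t l, b t l), b t l + τ * s.v (a t l, b t l)) = s.v (a t l, b t l) ∧
    0 < Φ.rho τ (a t l + τ * s.u (a t l, b t l), b t l + τ * s.v (a t l, b t l)) := by
  have hm := h.initial_mem ht l
  refine h.forward_line le_rfl ht ?_ ?_ ?_ ?_ τ hτ
  · intro r hr
    exact h.position.from_side t ⟨hr.1.trans hr.2, ht.2⟩ l r hr.1.le hr.2
  · simpa using h.field.u_initial _ hm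
  · simpa using h.field.v_initial _ hm
  · have := h.field.rho_initial _ hm
    simpa [this] using h.rho_pos _ hm

theorem at_front (h : IsFrontSide T S xs ys Φ σ s K a b) {t : ℝ} (ht : t ∈ timeIco T) (l : ℝ) :
    Φ.u t (xs t l, ys t l) = s.u (a t l, b t l) ∧ Φ.v t (xs t l, ys t l) = s.v (a t l, b t l) ∧
    0 < Φ.rho t (xs t l, ys t l) := by
  have := h.characteristic ht l (right_mem_Icc.2 ht.1)
  rwa [← h.position.reach_x t ht, ← h.position.reach_y t ht] at this

/-- The density of the smooth flow is nonnegative. -/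
theorem rho_nonneg (h : IsFrontSide T S xs ys Φ σ s K a b) {t : ℝ} (ht : t ∈ timeIoo T)
    {z : ℝ × ℝ} (hz : 0 < σ * S t z) : 0 ≤ Φ.rho t z := by
  by_contra hneg
  rw [not_le] at hneg
  -- The line through `z` with the velocity of the flow there is followed backwards in time.
  obtain ⟨x, hx⟩ : ∃ x, z.1 = x + t * Φ.u t z := ⟨z.1 - t * Φ.u t z, by ring⟩
  obtain ⟨y, hy⟩ : ∃ y, z.2 = y + t * Φ.v t z := ⟨z.2 - t * Φ.v t z, by ring⟩
  obtain ⟨c, hc⟩ : ∃ c, Φ.u t z = c := ⟨_, rfl⟩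
  obtain ⟨d, hd⟩ : ∃ d, Φ.v t z = d := ⟨_, rfl⟩
  rw [hc] at hx
  rw [hd] at hy
  have hzz : z = (x + t * c, y + t * d) := Prod.ext hx hy
  rw [hzz] at hc hd hneg hz
  have ht' := timeIoo_subset_timeIco T ht
  have cS : ContinuousOn (fun r => σ * S r (x + r * c, y + r * d)) (Icc 0 t) :=
    continuousOn_const.mul (continuousOn_line h.S_smooth.continuousOn le_rfl ht' x y c d)
  -- Take `α` as the last time at which the line is not strictly inside the side, or zero if there
  -- is none. At `α` the line is on the front or at an initial point of the side, and the density is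
  -- positive in both cases.
  obtain ⟨α, hα, hside, hcase⟩ : ∃ α ∈ Icc 0 t,
      (∀ r ∈ Ioo α t, 0 < σ * S r (x + r * c, y + r * d)) ∧
      (α = 0 ∧ 0 < σ * S 0 (x + 0 * c, y + 0 * d) ∨ S α (x + α * c, y + α * d) = 0) := by
    by_cases hne : (Icc 0 t ∩ (fun r => σ * S r (x + r * c, y + r * d)) ⁻¹' Iic 0).Nonempty
    · have hcomp : IsCompact (Icc 0 t ∩ (fun r => σ * S r (x + r * c, y + r * d)) ⁻¹' Iic 0) :=
        isCompact_Icc.of_isClosed_subset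
          (cS.preimage_isClosed_of_isClosed isClosed_Icc isClosed_Iic) inter_subset_left
      have hmem := hcomp.sSup_mem hne
      set α := sSup (Icc 0 t ∩ (fun r => σ * S r (x + r * c, y + r * d)) ⁻¹' Iic 0)
      have hpos : ∀ r ∈ Ioc α t, 0 < σ * S r (x + r * c, y + r * d) := fun r hr => by
        by_contra hn
        exact (le_csSup hcomp.bddAbove ⟨⟨hmem.1.1.trans hr.1.le, hr.2⟩, not_lt.1 hn⟩).not_gt hr.1
      refine ⟨α, hmem.1, fun r hr => hpos r ⟨hr.1, hr.2.le⟩, .inr ?_⟩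
      have hσS : σ * S α (x + α * c, y + α * d) = 0 := by
        refine le_antisymm hmem.2 ?_
        by_contra hn
        rw [not_le] at hn
        obtain ⟨q, hq, hq0⟩ := intermediate_value_Icc hmem.1.2
          (cS.mono (Icc_subset_Icc_left hmem.1.1)) (show (0 : ℝ) ∈ Icc _ _ from ⟨hn.le, hz.le⟩)
        rcases hq.1.eq_or_lt with h0 | h0
        · rw [← h0] at hq0
          exact hn.ne hq0
        · exact (hpos q ⟨h0, hq.2⟩).ne' hq0
      have hσ : σ ≠ 0 := by
        rintro rfl
        simp at hz
      exact (mul_eq_zero.1 hσS).resolve_left hσ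
    · have hpos : ∀ r ∈ Icc 0 t, 0 < σ * S r (x + r * c, y + r * d) := fun r hr => by
        by_contra hn
        exact hne ⟨r, hr, not_lt.1 hn⟩
      exact ⟨0, left_mem_Icc.2 ht.1.le, fun r hr => hpos r (Ioo_subset_Icc_self hr),
        .inl ⟨rfl, hpos 0 (left_mem_Icc.2 ht.1.le)⟩⟩
  have hb := h.backward_line hα.1 hα.2 ht' hside hc hd hneg
  rcases hcase with ⟨rfl, hS⟩ | hS
  · have hm := h.mem_of_pos _ hS
    rw [h.field.rho_initial _ hm] at hb
    exact (h.rho_pos _ hm).not_gt hb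
  · have hαT := mem_timeIco_of_le ht' hα.1 hα.2
    obtain ⟨l, hl⟩ := (h.surface α hαT _).1 hS
    rw [hl] at hb
    exact (h.at_front hαT l).2.2.not_gt hb

end IsFrontSide

/-! ### The flux into the front and its sign -/

/-- The area swept per unit of time and unit of `l` by the curve relative to the flow `(u, v)`. -/
noncomputable def relativeSweep (xs ys : ℝ → ℝ → ℝ) (u v : ℝ → ℝ × ℝ → ℝ) (t l : ℝ) : ℝ :=
  (deriv (fun s => xs s l) t - u t (xs t l, ys t l)) * deriv (ys t) l
    - (deriv (fun s => ys s l) t - v t (xs t l, ys t l)) * deriv (xs t) l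

/-- A version continuous up to `t = 0`, needed because the accumulated flux is integrated from the
initial time. -/
theorem exists_continuousOn_relativeSweep {T : EReal} (hT : 0 < T) {xs ys : ℝ → ℝ → ℝ}
    {u v : ℝ → ℝ × ℝ → ℝ} (hx : ContDiffOn ℝ 1 (Function.uncurry xs) (timeIco T ×ˢ univ))
    (hy : ContDiffOn ℝ 1 (Function.uncurry ys) (timeIco T ×ˢ univ))
    (hu : ContinuousOn (Function.uncurry u) (timeIco T ×ˢ univ))
    (hv : ContinuousOn (Function.uncurry v) (timeIco T ×ˢ univ)) :
    ∃ R : ℝ → ℝ → ℝ, ContinuousOn (Function.uncurry R) (timeIco T ×ˢ univ) ∧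
      ∀ t ∈ timeIoo T, ∀ l, relativeSweep xs ys u v t l = R t l := by
  obtain ⟨gx, cgx, hgx⟩ := exists_continuousOn_deriv_time_Ico hT hx
  obtain ⟨gy, cgy, hgy⟩ := exists_continuousOn_deriv_time_Ico hT hy
  refine ⟨fun t l => (gx t l - u t (xs t l, ys t l)) * deriv (ys t) l
    - (gy t l - v t (xs t l, ys t l)) * deriv (xs t) l, ?_, fun t ht l => ?_⟩
  · have h1 := cgx.sub (continuousOn_curve_comp hx.continuousOn hy.continuousOn hu)
    have h2 := cgy.sub (continuousOn_curve_comp hx.continuousOn hy.continuousOn hv)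
    exact (h1.mul (continuousOn_deriv_line_Ico hT hy)).sub
      (h2.mul (continuousOn_deriv_line_Ico hT hx))
  · simp only [relativeSweep, hgx t ht, hgy t ht]

theorem nonpos_of_hasDerivAt_of_pos_left {f : ℝ → ℝ} {f' t c : ℝ} (hct : c < t)
    (hf : HasDerivAt f f' t) (h0 : f t = 0) (hpos : ∀ r ∈ Ioo c t, 0 < f r) : f' ≤ 0 := by
  refine le_of_tendsto (hasDerivWithinAt_iff_tendsto_slope' (by simp) |>.1
    (hf.hasDerivWithinAt (s := Iio t))) ?_
  filter_upwards [Ioo_mem_nhdsLT hct] with r hr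
  rw [slope_def_field, h0, sub_zero]
  exact div_nonpos_of_nonneg_of_nonpos (hpos r hr).le (by linarith [hr.2])

namespace IsFrontSide

variable {T : EReal} {S : ℝ → ℝ × ℝ → ℝ} {xs ys : ℝ → ℝ → ℝ} {Φ : FlowField} {σ : ℝ}
  {s : PlaneState} {K : Set (ℝ × ℝ)} {a b : ℝ → ℝ → ℝ}

theorem state_eq (h : IsFrontSide T S xs ys Φ σ s K a b) {t : ℝ} (ht : t ∈ timeIco T) (l : ℝ) :
    s.u (a t l, b t l) = Φ.u 0 (a t l, b t l) ∧ s.v (a t l, b t l) = Φ.v 0 (a t l, b t l) :=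
  ⟨(h.field.u_initial _ (h.initial_mem ht l)).symm, (h.field.v_initial _ (h.initial_mem ht l)).symm⟩

/-- Linearization of the family of characteristics. -/
theorem linearized (h : IsFrontSide T S xs ys Φ σ s K a b) {r : ℝ} (hr : r ∈ timeIco T)
    {A B U V : ℝ → ℝ} {A' B' U' V' q : ℝ} (hA : HasDerivAt A A' q) (hB : HasDerivAt B B' q)
    (hU : HasDerivAt U U' q) (hV : HasDerivAt V V' q)
    (hu : ∀ᶠ m in 𝓝 q, Φ.u r (A m + r * U m, B m + r * V m) = U m)
    (hv : ∀ᶠ m in 𝓝 q, Φ.v r (A m + r * U m, B m + r * V m) = V m) :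
    partialX (Φ.u r) (A q + r * U q, B q + r * V q) * (A' + r * U')
      + partialY (Φ.u r) (A q + r * U q, B q + r * V q) * (B' + r * V') = U' ∧
    partialX (Φ.v r) (A q + r * U q, B q + r * V q) * (A' + r * U')
      + partialY (Φ.v r) (A q + r * U q, B q + r * V q) * (B' + r * V') = V' := by
  have hX := hA.add (hU.const_mul r)
  have hY := hB.add (hV.const_mul r)
  have h1 := hasDerivAt_comp_plane (f := Φ.u r) (X := fun m => A m + r * U m)
    (Y := fun m => B m + r * V m)
    ((h.field.u_smooth.slab_slice hr).differentiable one_ne_zero _) hX hY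
  have h2 := hasDerivAt_comp_plane (f := Φ.v r) (X := fun m => A m + r * U m)
    (Y := fun m => B m + r * V m)
    ((h.field.v_smooth.slab_slice hr).differentiable one_ne_zero _) hX hY
  exact ⟨(h1.congr_of_eventuallyEq (hu.mono fun _ e => e.symm)).unique hU,
    (h2.congr_of_eventuallyEq (hv.mono fun _ e => e.symm)).unique hV⟩

/-- Conservation of mass along the characteristics, in Lagrangian form. -/
theorem rho_mul_relativeSweep (h : IsFrontSide T S xs ys Φ σ s K a b) {t : ℝ}
    (ht : t ∈ timeIoo T) (l : ℝ) :
    Φ.rho t (xs t l, ys t l) * relativeSweep xs ys Φ.u Φ.v t l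
      = s.rho (a t l, b t l) * ShockFront.jac a b t l := by
  have hJ := isOpen_timeIoo T
  have ht' := timeIoo_subset_timeIco T ht
  have h0 := zero_mem_timeIco h.T_pos
  have da := h.position.a_smooth.timeIoo.differentiableAt_slab hJ ht l
  have db := h.position.b_smooth.timeIoo.differentiableAt_slab hJ ht l
  have at' := da.timeSlice.hasDerivAt
  have bt' := db.timeSlice.hasDerivAt
  have al' := hasDerivAt_slice_line da
  have bl' := hasDerivAt_slice_line db
  have du0 := (h.field.u_smooth.slab_slice h0).differentiable one_ne_zero (a t l, b t l)
  have dv0 := (h.field.v_smooth.slab_slice h0).differentiable one_ne_zero (a t l, b t l)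
  -- The data are smooth only on a closed side. The field at time zero agrees with them there and is
  -- differentiable on the whole plane, so the chain rule applies to it.
  obtain ⟨U, hU⟩ : ∃ U : ℝ → ℝ → ℝ, U = fun t l => Φ.u 0 (a t l, b t l) := ⟨_, rfl⟩
  obtain ⟨V, hV⟩ : ∃ V : ℝ → ℝ → ℝ, V = fun t l => Φ.v 0 (a t l, b t l) := ⟨_, rfl⟩
  have sU : ∀ t ∈ timeIco T, ∀ l, s.u (a t l, b t l) = U t l := fun t ht l => by
    rw [hU]; exact (h.state_eq ht l).1
  have sV : ∀ t ∈ timeIco T, ∀ l, s.v (a t l, b t l) = V t l := fun t ht l => by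
    rw [hV]; exact (h.state_eq ht l).2
  obtain ⟨U₁, hU₁⟩ : ∃ d, HasDerivAt (fun m => U m l) d t := by
    rw [hU]; exact ⟨_, hasDerivAt_comp_plane du0 at' bt'⟩
  obtain ⟨U₂, hU₂⟩ : ∃ d, HasDerivAt (U t) d l := by
    rw [hU]; exact ⟨_, hasDerivAt_comp_plane du0 al' bl'⟩
  obtain ⟨V₁, hV₁⟩ : ∃ d, HasDerivAt (fun m => V m l) d t := by
    rw [hV]; exact ⟨_, hasDerivAt_comp_plane dv0 at' bt'⟩
  obtain ⟨V₂, hV₂⟩ : ∃ d, HasDerivAt (V t) d l := by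
    rw [hV]; exact ⟨_, hasDerivAt_comp_plane dv0 al' bl'⟩
  obtain ⟨c, hc⟩ : ∃ c, U t l = c := ⟨_, rfl⟩
  obtain ⟨d, hd⟩ : ∃ d, V t l = d := ⟨_, rfl⟩
  have char : ∀ t' ∈ timeIco T, ∀ l', ∀ r ∈ Icc 0 t',
      Φ.u r (a t' l' + r * U t' l', b t' l' + r * V t' l') = U t' l' ∧
      Φ.v r (a t' l' + r * U t' l', b t' l' + r * V t' l') = V t' l' := fun t' ht' l' r hr => by
    have := h.characteristic ht' l' hr
    rw [sU t' ht', sV t' ht'] at this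
    exact ⟨this.1, this.2.1⟩
  have ext_ : xs t l = a t l + t * c ∧ ys t l = b t l + t * d := by
    rw [h.position.reach_x t ht', h.position.reach_y t ht', sU t ht', sV t ht', hc, hd]
    exact ⟨rfl, rfl⟩
  have xt : deriv (fun m => xs m l) t = deriv (fun m => a m l) t + (c + t * U₁) := by
    have e : (fun m => xs m l) =ᶠ[𝓝 t] fun m => a m l + m * U m l := by
      filter_upwards [hJ.mem_nhds ht] with m hm
      rw [h.position.reach_x m (timeIoo_subset_timeIco T hm), sU m (timeIoo_subset_timeIco T hm)]
    rw [e.deriv_eq]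
    refine ((at'.add ((hasDerivAt_id t).mul hU₁)).congr_deriv ?_).deriv
    simp [hc]
  have yt : deriv (fun m => ys m l) t = deriv (fun m => b m l) t + (d + t * V₁) := by
    have e : (fun m => ys m l) =ᶠ[𝓝 t] fun m => b m l + m * V m l := by
      filter_upwards [hJ.mem_nhds ht] with m hm
      rw [h.position.reach_y m (timeIoo_subset_timeIco T hm), sV m (timeIoo_subset_timeIco T hm)]
    rw [e.deriv_eq]
    refine ((bt'.add ((hasDerivAt_id t).mul hV₁)).congr_deriv ?_).deriv
    simp [hd]
  have xl : deriv (xs t) l = deriv (a t) l + t * U₂ := by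
    have e : xs t = fun m => a t m + t * U t m := by
      ext m; rw [h.position.reach_x t ht', sU t ht']
    rw [e]
    exact (al'.add (hU₂.const_mul t)).deriv
  have yl : deriv (ys t) l = deriv (b t) l + t * V₂ := by
    have e : ys t = fun m => b t m + t * V t m := by
      ext m; rw [h.position.reach_y t ht', sV t ht']
    rw [e]
    exact (bl'.add (hV₂.const_mul t)).deriv
  set a₁ := deriv (fun m => a m l) t
  set b₁ := deriv (fun m => b m l) t
  set a₂ := deriv (a t) l
  set b₂ := deriv (b t) l
  -- The density times the Jacobian of the family of characteristics at time `r`. At `r = 0` it is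
  -- the right-hand side. At `r = t` it is the left-hand side, because subtracting the flow velocity
  -- from $x^s_t$ leaves $a_t+t\,\partial_tU$.
  set E : ℝ → ℝ := fun r => Φ.rho r (a t l + r * c, b t l + r * d)
    * ((a₁ + r * U₁) * (b₂ + r * V₂) - (b₁ + r * V₁) * (a₂ + r * U₂)) with hE
  have cE : ContinuousOn E (Icc 0 t) := by
    refine (continuousOn_line h.field.rho_smooth.continuousOn le_rfl ht' _ _ c d).mul ?_
    fun_prop
  have dE : ∀ r ∈ Ioo 0 t, HasDerivAt E 0 r := by
    intro r hr
    have hrT : r ∈ timeIoo T := mem_timeIoo_of_le ht' hr.1 hr.2.le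
    have hrT' := timeIoo_subset_timeIco T hrT
    -- Neighbouring characteristics reach the front at times `m` near `t`. They still exist at time
    -- `r` because `r < t` strictly, so the family can be differentiated in `m`.
    have ev : ∀ᶠ m in 𝓝 t, r < m ∧ m ∈ timeIoo T := (lt_mem_nhds hr.2).and (hJ.mem_nhds ht)
    obtain ⟨k1, k2⟩ := h.linearized hrT' at' bt' hU₁ hV₁
      (ev.mono fun m hm => (char m (timeIoo_subset_timeIco T hm.2) l r ⟨hr.1.le, hm.1.le⟩).1)
      (ev.mono fun m hm => (char m (timeIoo_subset_timeIco T hm.2) l r ⟨hr.1.le, hm.1.le⟩).2)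
    obtain ⟨k3, k4⟩ := h.linearized hrT' al' bl' hU₂ hV₂
      (Eventually.of_forall fun m => (char t ht' m r ⟨hr.1.le, hr.2.le⟩).1)
      (Eventually.of_forall fun m => (char t ht' m r ⟨hr.1.le, hr.2.le⟩).2)
    rw [hc, hd] at k1 k2 k3 k4
    have hside := h.position.from_side t ht l r hr.1.le hr.2
    obtain ⟨ku, kv⟩ := char t ht' l r ⟨hr.1.le, hr.2.le⟩
    rw [sU t ht', sV t ht', hc, hd] at hside
    rw [hc, hd] at ku kv
    have dr := h.field.rho_smooth.timeIoo.differentiableAt_slab hJ hrT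
      (a t l + r * c, b t l + r * d)
    obtain ⟨t1, -, -⟩ := (h.field.solves r hrT _ hside).transport dr
      (h.field.u_smooth.timeIoo.differentiableAt_slab hJ hrT _)
      (h.field.v_smooth.timeIoo.differentiableAt_slab hJ hrT _)
    rw [ku, kv] at t1
    have lin : ∀ p k : ℝ, HasDerivAt (fun r => p + r * k) k r := fun p k => by
      simpa using ((hasDerivAt_id r).mul_const k).const_add p
    have dR := hasDerivAt_comp_flow dr (lin (a t l) c) (lin (b t l) d)
    have dD := ((lin a₁ U₁).mul (lin b₂ V₂)).sub ((lin b₁ V₁).mul (lin a₂ U₂))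
    refine (dR.mul dD).congr_deriv ?_
    rw [t1]
    simp only [Pi.sub_apply, Pi.mul_apply]
    -- The linearized characteristics `k1`–`k4` make the Jacobian grow at the rate of the velocity
    -- divergence, which cancels the loss of density from the continuity equation.
    linear_combination Φ.rho r (a t l + r * c, b t l + r * d) * (-(b₂ + r * V₂) * k1
      + (a₂ + r * U₂) * k2 + (b₁ + r * V₁) * k3 - (a₁ + r * U₁) * k4)
  obtain ⟨r, hr, hr0⟩ := exists_hasDerivAt_eq_slope E (fun _ => 0) ht.1 cE dE
  have hEt : E t = E 0 := by
    have := (eq_div_iff (sub_ne_zero.2 ht.1.ne')).1 hr0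
    linarith
  obtain ⟨fu, fv, -⟩ := h.at_front ht' l
  rw [sU t ht', hc] at fu
  rw [sV t ht', hd] at fv
  have e1 : Φ.rho t (xs t l, ys t l) * relativeSweep xs ys Φ.u Φ.v t l = E t := by
    rw [hE, relativeSweep, fu, fv, xt, yt, xl, yl, ext_.1, ext_.2]
    ring
  have e2 : E 0 = s.rho (a t l, b t l) * ShockFront.jac a b t l := by
    have := h.field.rho_initial _ (h.initial_mem ht' l)
    simp only [hE, ShockFront.jac, zero_mul, add_zero, this]
    rfl
  rw [e1, hEt, e2]

theorem normalDeriv_relations (h : IsFrontSide T S xs ys Φ σ s K a b) {t : ℝ} (ht : t ∈ timeIco T)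
    (l : ℝ) : partialX (S t) (xs t l, ys t l) * deriv (xs t) l
      + partialY (S t) (xs t l, ys t l) * deriv (ys t) l = 0 := by
  have dS := (h.S_smooth.slab_slice ht).differentiable one_ne_zero (xs t l, ys t l)
  have dx := ((h.xs_smooth.slab_slice ht).differentiable one_ne_zero l).hasDerivAt
  have dy := ((h.ys_smooth.slab_slice ht).differentiable one_ne_zero l).hasDerivAt
  refine (hasDerivAt_comp_plane dS dx dy).unique ?_
  have : (fun m => S t (xs t m, ys t m)) = fun _ => 0 := by
    ext m; exact (h.surface t ht _).2 ⟨m, rfl⟩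
  rw [this]
  exact hasDerivAt_const _ _

/-- The flow on the side `{σ S > 0}` runs into the front. -/
theorem relativeSweep_sign (h : IsFrontSide T S xs ys Φ σ s K a b) {t : ℝ} (ht : t ∈ timeIoo T)
    (l : ℝ) : σ * (normalDeriv S xs ys t l * relativeSweep xs ys Φ.u Φ.v t l) ≤ 0 := by
  have hJ := isOpen_timeIoo T
  have ht' := timeIoo_subset_timeIco T ht
  have dS := h.S_smooth.timeIoo.differentiableAt_slab hJ ht (xs t l, ys t l)
  obtain ⟨fu, fv, -⟩ := h.at_front ht' l
  have r1 := h.normalDeriv_relations ht' l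
  have r2 : deriv (fun s => S s (xs t l, ys t l)) t
      + partialX (S t) (xs t l, ys t l) * deriv (fun s => xs s l) t
      + partialY (S t) (xs t l, ys t l) * deriv (fun s => ys s l) t = 0 := by
    refine (hasDerivAt_comp_flow (X := fun s => xs s l) (Y := fun s => ys s l) dS
      (h.xs_smooth.timeIoo.differentiableAt_slab hJ ht l).timeSlice.hasDerivAt
      (h.ys_smooth.timeIoo.differentiableAt_slab hJ ht l).timeSlice.hasDerivAt).unique
      ((hasDerivAt_const t 0).congr_of_eventuallyEq ?_)
    filter_upwards [hJ.mem_nhds ht] with m hm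
    exact (h.surface m (timeIoo_subset_timeIco T hm) _).2 ⟨l, rfl⟩
  -- Along the characteristic, $\sigma S$ is positive before time `t` and zero at `t`, so its
  -- derivative there is not positive.
  have r3 : σ * (deriv (fun s => S s (xs t l, ys t l)) t
      + partialX (S t) (xs t l, ys t l) * s.u (a t l, b t l)
      + partialY (S t) (xs t l, ys t l) * s.v (a t l, b t l)) ≤ 0 := by
    have lin : ∀ p k : ℝ, HasDerivAt (fun r => p + r * k) k t := fun p k => by
      simpa using ((hasDerivAt_id t).mul_const k).const_add p
    have ex := h.position.reach_x t ht' l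
    have ey := h.position.reach_y t ht' l
    rw [ex, ey] at dS
    have dL := (hasDerivAt_comp_flow dS (lin (a t l) (s.u (a t l, b t l)))
      (lin (b t l) (s.v (a t l, b t l)))).const_mul σ
    rw [← ex, ← ey] at dL
    refine nonpos_of_hasDerivAt_of_pos_left ht.1 dL ?_ fun r hr =>
      h.position.from_side t ht l r hr.1.le hr.2
    rw [← ex, ← ey, (h.surface t ht' _).2 ⟨l, rfl⟩, mul_zero]
  rw [relativeSweep, normalDeriv, fu, fv]
  generalize deriv (fun s => S s (xs t l, ys t l)) t = St at *
  generalize partialX (S t) (xs t l, ys t l) = Sx at *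
  generalize partialY (S t) (xs t l, ys t l) = Sy at *
  generalize deriv (fun s => xs s l) t = x₁ at *
  generalize deriv (fun s => ys s l) t = y₁ at *
  generalize deriv (xs t) l = x₂ at *
  generalize deriv (ys t) l = y₂ at *
  generalize s.u (a t l, b t l) = u at *
  generalize s.v (a t l, b t l) = v at *
  -- The gradient of `S` is normal to the curve by `r1`. So the product of normal derivative and
  -- relative sweep is $-(x_l^2+y_l^2)$ times $\nabla S$ applied to the front velocity minus the
  -- flow velocity, and `r2` replaces the front term by $-S_t$.
  have key : σ * ((Sy * x₂ - Sx * y₂) * ((x₁ - u) * y₂ - (y₁ - v) * x₂))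
      = (x₂ ^ 2 + y₂ ^ 2) * (σ * (St + Sx * u + Sy * v)) := by
    linear_combination (σ * ((x₁ - u) * x₂ + (y₁ - v) * y₂)) * r1 - (σ * (x₂ ^ 2 + y₂ ^ 2)) * r2
  rw [key]
  exact mul_nonpos_of_nonneg_of_nonpos (by positivity) r3

end IsFrontSide

/-- All currents are convective. The flux of mass relative to the front is the density times the
relative sweep, and momentum is the mass flux times the velocity component. -/
theorem FlowField.curveFlux_mass (Φ : FlowField) (xs ys : ℝ → ℝ → ℝ) (t l : ℝ) :
    curveFlux xs ys Φ.rho (fun t z => Φ.rho t z * Φ.u t z) (fun t z => Φ.rho t z * Φ.v t z) t l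
      = Φ.rho t (xs t l, ys t l) * relativeSweep xs ys Φ.u Φ.v t l := by
  unfold curveFlux relativeSweep; ring

theorem FlowField.curveFlux_momentum_x (Φ : FlowField) (xs ys : ℝ → ℝ → ℝ) (t l : ℝ) :
    curveFlux xs ys (fun t z => Φ.rho t z * Φ.u t z) (fun t z => Φ.rho t z * Φ.u t z ^ 2)
        (fun t z => Φ.rho t z * Φ.u t z * Φ.v t z) t l
      = Φ.u t (xs t l, ys t l) * (Φ.rho t (xs t l, ys t l) * relativeSweep xs ys Φ.u Φ.v t l) := by
  unfold curveFlux relativeSweep; ring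

theorem FlowField.curveFlux_momentum_y (Φ : FlowField) (xs ys : ℝ → ℝ → ℝ) (t l : ℝ) :
    curveFlux xs ys (fun t z => Φ.rho t z * Φ.v t z) (fun t z => Φ.rho t z * Φ.u t z * Φ.v t z)
        (fun t z => Φ.rho t z * Φ.v t z ^ 2) t l
      = Φ.v t (xs t l, ys t l) * (Φ.rho t (xs t l, ys t l) * relativeSweep xs ys Φ.u Φ.v t l) := by
  unfold curveFlux relativeSweep; ring

namespace ShockFront

variable {F : ShockFront} {T : EReal} {D : CauchyData}

theorem IsFrontFor.plusSide (hT : 0 < T) (hD : D.IsAdmissible) (hF : F.IsFrontFor T D) :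
    IsFrontSide T F.S F.xs F.ys F.plus 1 D.plus (closure D.sidePlus) F.ap F.bp where
  T_pos := hT
  S_smooth := hF.S_smooth
  xs_smooth := hF.xs_smooth
  ys_smooth := hF.ys_smooth
  surface := hF.surface
  field := hF.field_plus
  position := hF.position_plus
  closed := isClosed_closure
  mem_of_pos := fun z hz => subset_closure ((hF.S_initial_plus z).1 (by simpa using hz))
  rho_pos := hD.plus_smooth.rho_pos

theorem IsFrontFor.minusSide (hT : 0 < T) (hD : D.IsAdmissible) (hF : F.IsFrontFor T D) :
    IsFrontSide T F.S F.xs F.ys F.minus (-1) D.minus (closure D.sideMinus) F.am F.bm where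
  T_pos := hT
  S_smooth := hF.S_smooth
  xs_smooth := hF.xs_smooth
  ys_smooth := hF.ys_smooth
  surface := hF.surface
  field := hF.field_minus
  position := hF.position_minus
  closed := isClosed_closure
  mem_of_pos := fun z hz => subset_closure ((hF.S_initial_minus z).1 (by simpa using hz))
  rho_pos := hD.minus_smooth.rho_pos

/-! ### Orientation of the front -/

/-- The gradient of `S` annihilates the nonzero tangent; if it also annihilated the normal, it would
be zero, contrary to regularity. -/
theorem IsFrontFor.normalDeriv_ne_zero (hT : 0 < T) (hD : D.IsAdmissible) (hF : F.IsFrontFor T D)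
    {t : ℝ} (ht : t ∈ timeIco T) (l : ℝ) : normalDeriv F.S F.xs F.ys t l ≠ 0 := by
  intro h0
  have r1 := (hF.plusSide hT hD).normalDeriv_relations ht l
  have hz : F.S t (F.xs t l, F.ys t l) = 0 := (hF.surface t ht _).2 ⟨l, rfl⟩
  have dS := (hF.S_smooth.slab_slice ht).differentiable one_ne_zero (F.xs t l, F.ys t l)
  have himm := hF.immersion t ht l
  refine hF.S_regular t ht _ hz ?_
  rw [normalDeriv] at h0
  have hn : deriv (F.xs t) l ^ 2 + deriv (F.ys t) l ^ 2 ≠ 0 := by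
    intro hsum
    refine himm (Prod.ext ?_ ?_) <;> simp only <;> nlinarith [sq_nonneg (deriv (F.xs t) l),
      sq_nonneg (deriv (F.ys t) l)]
  have hx : partialX (F.S t) (F.xs t l, F.ys t l) = 0 := by
    refine (mul_eq_zero.1 (?_ : _ * (deriv (F.xs t) l ^ 2 + deriv (F.ys t) l ^ 2) = 0)).resolve_right hn
    linear_combination deriv (F.xs t) l * r1 - deriv (F.ys t) l * h0
  have hy : partialY (F.S t) (F.xs t l, F.ys t l) = 0 := by
    refine (mul_eq_zero.1 (?_ : _ * (deriv (F.xs t) l ^ 2 + deriv (F.ys t) l ^ 2) = 0)).resolve_right hn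
    linear_combination deriv (F.ys t) l * r1 + deriv (F.xs t) l * h0
  rw [partialX_eq_fderiv dS] at hx
  rw [partialY_eq_fderiv dS] at hy
  ext
  · simpa using hx
  · simpa using hy

theorem timeIoo_mem_nhdsGT (hT : 0 < T) : timeIoo T ∈ 𝓝[>] (0 : ℝ) := by
  obtain ⟨t₁, ht₁, -⟩ := exists_gt_mem_timeIoo (zero_mem_timeIco hT)
  filter_upwards [Ioo_mem_nhdsGT ht₁.1] with r hr
  exact mem_timeIoo_of_le (timeIoo_subset_timeIco T ht₁) hr.1 hr.2.le

/-- Restriction to positive times of a function that is continuous up to the initial time. -/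
theorem tendsto_initial (hT : 0 < T) {k : ℝ → ℝ} (hk : ContinuousOn k (timeIco T)) :
    Tendsto k (𝓝[>] 0) (𝓝 (k 0)) := by
  refine (hk 0 (zero_mem_timeIco hT)).mono_left ?_
  rw [nhdsWithin, nhdsWithin]
  refine le_inf inf_le_left (le_principal_iff.2 ?_)
  exact mem_of_superset (timeIoo_mem_nhdsGT hT) (timeIoo_subset_timeIco T)

/-- The front velocity, which is not known at `t = 0`, cancels in the difference. What remains is
the jump of $v\,x_l-u\,y_l$, continuous up to `t = 0`, where it is positive by the two compression
conditions. -/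
theorem IsFrontFor.sweep_difference_pos (hT : 0 < T) (hD : D.IsAdmissible)
    (hF : F.IsFrontFor T D) (l : ℝ) :
    ∀ᶠ t in 𝓝[>] (0 : ℝ), 0 < relativeSweep F.xs F.ys F.plus.u F.plus.v t l
      - relativeSweep F.xs F.ys F.minus.u F.minus.v t l := by
  have h0 := zero_mem_timeIco hT
  have cx := hF.xs_smooth.continuousOn
  have cy := hF.ys_smooth.continuousOn
  have comp : ∀ {M : ℝ → ℝ × ℝ → ℝ}, ContDiffOn ℝ 1 (Function.uncurry M) (timeIco T ×ˢ univ) →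
      ContinuousOn (fun t => M t (F.xs t l, F.ys t l)) (timeIco T) := fun {M} hM =>
    (continuousOn_curve_comp cx cy hM.continuousOn).slab_time
      (k := fun t l => M t (F.xs t l, F.ys t l)) l
  have dx := (continuousOn_deriv_line_Ico hT hF.xs_smooth).slab_time
    (k := fun t l => deriv (F.xs t) l) l
  have dy := (continuousOn_deriv_line_Ico hT hF.ys_smooth).slab_time
    (k := fun t l => deriv (F.ys t) l) l
  have lim := tendsto_initial hT
    ((((comp hF.field_plus.v_smooth).sub (comp hF.field_minus.v_smooth)).mul dx).sub
      (((comp hF.field_plus.u_smooth).sub (comp hF.field_minus.u_smooth)).mul dy))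
  have ex : F.xs 0 = D.A := funext hF.xs_initial
  have ey : F.ys 0 = D.B := funext hF.ys_initial
  obtain ⟨pu, pv, -⟩ := (hF.plusSide hT hD).at_front h0 l
  obtain ⟨mu, mv, -⟩ := (hF.minusSide hT hD).at_front h0 l
  have p1 : F.ap 0 l = D.A l := by simpa [ex] using (hF.position_plus.reach_x 0 h0 l).symm
  have p2 : F.bp 0 l = D.B l := by simpa [ey] using (hF.position_plus.reach_y 0 h0 l).symm
  have m1 : F.am 0 l = D.A l := by simpa [ex] using (hF.position_minus.reach_x 0 h0 l).symm
  have m2 : F.bm 0 l = D.B l := by simpa [ey] using (hF.position_minus.reach_y 0 h0 l).symm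
  rw [p1, p2] at pu pv
  rw [m1, m2] at mu mv
  have hpos : 0 < (F.plus.v 0 (F.xs 0 l, F.ys 0 l) - F.minus.v 0 (F.xs 0 l, F.ys 0 l))
        * deriv (F.xs 0) l
      - (F.plus.u 0 (F.xs 0 l, F.ys 0 l) - F.minus.u 0 (F.xs 0 l, F.ys 0 l))
        * deriv (F.ys 0) l := by
    rw [pu, pv, mu, mv, ex, ey]
    have c1 := hD.compress_minus l
    have c2 := hD.compress_plus l
    linarith
  filter_upwards [lim.eventually (lt_mem_nhds hpos)] with t ht
  unfold relativeSweep
  simp only [Pi.sub_apply, Pi.mul_apply] at ht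
  linarith

/-- Since each side runs into the front, the normal derivative times the difference of the sweeps is
not positive. Shortly after `t = 0` that difference is positive, so the initial normal derivative is
at most zero. It depends continuously on time and never vanishes, hence keeps a strict sign. -/
theorem IsFrontFor.normalDeriv_lt_zero (hT : 0 < T) (hD : D.IsAdmissible) (hF : F.IsFrontFor T D)
    {t : ℝ} (ht : t ∈ timeIco T) (l : ℝ) : normalDeriv F.S F.xs F.ys t l < 0 := by
  have h0 := zero_mem_timeIco hT
  have cω : ContinuousOn (fun t => normalDeriv F.S F.xs F.ys t l) (timeIco T) := by
    have c1 := (continuousOn_curve_comp hF.xs_smooth.continuousOn hF.ys_smooth.continuousOn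
      (continuousOn_partialX_Ico hT hF.S_smooth)).slab_time
      (k := fun t l => partialX (F.S t) (F.xs t l, F.ys t l)) l
    have c2 := (continuousOn_curve_comp hF.xs_smooth.continuousOn hF.ys_smooth.continuousOn
      (continuousOn_partialY_Ico hT hF.S_smooth)).slab_time
      (k := fun t l => partialY (F.S t) (F.xs t l, F.ys t l)) l
    have dx := (continuousOn_deriv_line_Ico hT hF.xs_smooth).slab_time
      (k := fun t l => deriv (F.xs t) l) l
    have dy := (continuousOn_deriv_line_Ico hT hF.ys_smooth).slab_time
      (k := fun t l => deriv (F.ys t) l) l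
    exact (c2.mul dx).sub (c1.mul dy)
  have hinit : normalDeriv F.S F.xs F.ys 0 l ≤ 0 := by
    refine le_of_tendsto (tendsto_initial hT cω) ?_
    filter_upwards [hF.sweep_difference_pos hT hD l, timeIoo_mem_nhdsGT hT] with r hr hrT
    have s1 := (hF.plusSide hT hD).relativeSweep_sign hrT l
    have s2 := (hF.minusSide hT hD).relativeSweep_sign hrT l
    by_contra hn
    rw [not_le] at hn
    have := mul_pos hn hr
    linarith
  by_contra hn
  rw [not_lt] at hn
  have hsub : Icc 0 t ⊆ timeIco T := fun r hr => mem_timeIco_of_le ht hr.1 hr.2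
  obtain ⟨r, hr, hr0⟩ := intermediate_value_Icc ht.1 (cω.mono hsub)
    (show (0 : ℝ) ∈ Icc _ _ from ⟨hinit, hn⟩)
  exact hF.normalDeriv_ne_zero hT hD (hsub hr) l hr0

theorem IsFrontFor.sweep_plus_nonneg (hT : 0 < T) (hD : D.IsAdmissible) (hF : F.IsFrontFor T D)
    {t : ℝ} (ht : t ∈ timeIoo T) (l : ℝ) : 0 ≤ relativeSweep F.xs F.ys F.plus.u F.plus.v t l := by
  have s1 := (hF.plusSide hT hD).relativeSweep_sign ht l
  have ω := hF.normalDeriv_lt_zero hT hD (timeIoo_subset_timeIco T ht) l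
  by_contra hn
  have := mul_pos_of_neg_of_neg ω (not_le.1 hn)
  linarith

theorem IsFrontFor.sweep_minus_nonpos (hT : 0 < T) (hD : D.IsAdmissible) (hF : F.IsFrontFor T D)
    {t : ℝ} (ht : t ∈ timeIoo T) (l : ℝ) :
    relativeSweep F.xs F.ys F.minus.u F.minus.v t l ≤ 0 := by
  have s1 := (hF.minusSide hT hD).relativeSweep_sign ht l
  have ω := hF.normalDeriv_lt_zero hT hD (timeIoo_subset_timeIco T ht) l
  by_contra hn
  have := mul_neg_of_neg_of_pos ω (not_le.1 hn)
  linarith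

/-! ### Balanced quantities -/

/-- `mm`, `mp` are the densities on the two sides of the front of a quantity that is conserved
there, with currents `(pm, qm)` and `(pp, qp)`; `Q` is its net flux into the front. -/
structure IsBalanced (F : ShockFront) (T : EReal) (mm mp pm pp qm qp : ℝ → ℝ × ℝ → ℝ)
    (Q : ℝ → ℝ → ℝ) : Prop where
  mm_smooth : ContDiffOn ℝ 1 (Function.uncurry mm) (timeIco T ×ˢ univ)
  mp_smooth : ContDiffOn ℝ 1 (Function.uncurry mp) (timeIco T ×ˢ univ)
  pm_smooth : ContDiffOn ℝ 1 (Function.uncurry pm) (timeIco T ×ˢ univ)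
  pp_smooth : ContDiffOn ℝ 1 (Function.uncurry pp) (timeIco T ×ˢ univ)
  qm_smooth : ContDiffOn ℝ 1 (Function.uncurry qm) (timeIco T ×ˢ univ)
  qp_smooth : ContDiffOn ℝ 1 (Function.uncurry qp) (timeIco T ×ˢ univ)
  eq_minus : ∀ t ∈ timeIoo T, ∀ z, 0 < -F.S t z →
    deriv (fun s => mm s z) t + partialX (pm t) z + partialY (qm t) z = 0
  eq_plus : ∀ t ∈ timeIoo T, ∀ z, 0 < F.S t z →
    deriv (fun s => mp s z) t + partialX (pp t) z + partialY (qp t) z = 0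
  Q_cont : ContinuousOn (Function.uncurry Q) (timeIco T ×ˢ univ)
  flux : ∀ t ∈ timeIoo T, ∀ l,
    curveFlux F.xs F.ys mp pp qp t l - curveFlux F.xs F.ys mm pm qm t l = Q t l

/-- Positive times suffice: the integration runs over `(0, t]`, and the two-sided derivatives in
`jac` need not be meaningful at zero. -/
theorem influx_eq_integral {w : ℝ × ℝ → ℝ} {Q : ℝ → ℝ → ℝ}
    (h : ∀ t ∈ timeIoo T, ∀ l, w (F.ap t l, F.bp t l) * jac F.ap F.bp t l
      - w (F.am t l, F.bm t l) * jac F.am F.bm t l = Q t l) {t : ℝ} (ht : t ∈ timeIco T) (l : ℝ) :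
    F.influx w t l = ∫ τ in (0 : ℝ)..t, Q τ l := by
  refine intervalIntegral.integral_congr_ae (ae_of_all _ fun τ hτ => ?_)
  rw [uIoc_of_le ht.1] at hτ
  exact h τ (mem_timeIoo_of_le ht hτ.1 hτ.2) l

theorem IsFrontFor.data_at_plus (hT : 0 < T) (hD : D.IsAdmissible) (hF : F.IsFrontFor T D)
    {t : ℝ} (ht : t ∈ timeIoo T) (l : ℝ) :
    D.rho0 (F.ap t l, F.bp t l) = D.plus.rho (F.ap t l, F.bp t l) ∧
    D.u0 (F.ap t l, F.bp t l) = D.plus.u (F.ap t l, F.bp t l) ∧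
    D.v0 (F.ap t l, F.bp t l) = D.plus.v (F.ap t l, F.bp t l) := by
  have h1 : 0 < D.G (F.ap t l, F.bp t l) := (hF.S_initial_plus _).1
    (by simpa using (hF.plusSide hT hD).initial_mem_of_pos ht l)
  simp [CauchyData.rho0, CauchyData.u0, CauchyData.v0, heavi_of_pos h1]

theorem IsFrontFor.data_at_minus (hT : 0 < T) (hD : D.IsAdmissible) (hF : F.IsFrontFor T D)
    {t : ℝ} (ht : t ∈ timeIoo T) (l : ℝ) :
    D.rho0 (F.am t l, F.bm t l) = D.minus.rho (F.am t l, F.bm t l) ∧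
    D.u0 (F.am t l, F.bm t l) = D.minus.u (F.am t l, F.bm t l) ∧
    D.v0 (F.am t l, F.bm t l) = D.minus.v (F.am t l, F.bm t l) := by
  have h1 : D.G (F.am t l, F.bm t l) < 0 := (hF.S_initial_minus _).1
    (by simpa using (hF.minusSide hT hD).initial_mem_of_pos ht l)
  simp [CauchyData.rho0, CauchyData.u0, CauchyData.v0, heavi_of_nonpos h1.le]

variable (F) in
/-- The net flux of mass into the front. -/
noncomputable def massFlux (t l : ℝ) : ℝ :=
  F.plus.rho t (F.xs t l, F.ys t l) * relativeSweep F.xs F.ys F.plus.u F.plus.v t l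
    - F.minus.rho t (F.xs t l, F.ys t l) * relativeSweep F.xs F.ys F.minus.u F.minus.v t l

theorem IsFrontFor.massFlux_nonneg (hT : 0 < T) (hD : D.IsAdmissible) (hF : F.IsFrontFor T D)
    {t : ℝ} (ht : t ∈ timeIoo T) (l : ℝ) : 0 ≤ F.massFlux t l := by
  have ht' := timeIoo_subset_timeIco T ht
  have h1 := mul_nonneg ((hF.plusSide hT hD).at_front ht' l).2.2.le
    (hF.sweep_plus_nonneg hT hD ht l)
  have h2 := mul_nonpos_of_nonneg_of_nonpos ((hF.minusSide hT hD).at_front ht' l).2.2.le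
    (hF.sweep_minus_nonpos hT hD ht l)
  unfold massFlux
  linarith

/-- Both sides contribute with the same sign and positive densities. A vanishing total would make
both sweeps vanish, contrary to their positive difference. -/
theorem IsFrontFor.massFlux_pos (hT : 0 < T) (hD : D.IsAdmissible) (hF : F.IsFrontFor T D) (l : ℝ) :
    ∀ᶠ t in 𝓝[>] (0 : ℝ), 0 < F.massFlux t l := by
  filter_upwards [hF.sweep_difference_pos hT hD l, timeIoo_mem_nhdsGT hT] with t hpos ht
  have ht' := timeIoo_subset_timeIco T ht
  have r1 := ((hF.plusSide hT hD).at_front ht' l).2.2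
  have r2 := ((hF.minusSide hT hD).at_front ht' l).2.2
  have s1 := hF.sweep_plus_nonneg hT hD ht l
  have s2 := hF.sweep_minus_nonpos hT hD ht l
  have h1 := mul_nonneg r1.le s1
  have h2 := mul_nonpos_of_nonneg_of_nonpos r2.le s2
  refine (hF.massFlux_nonneg hT hD ht l).lt_of_ne fun h0 => ?_
  unfold massFlux at h0
  have z1 := (mul_eq_zero.1 (le_antisymm (by linarith) h1)).resolve_left r1.ne'
  have z2 := (mul_eq_zero.1 (le_antisymm h2 (by linarith))).resolve_left r2.ne'
  rw [z1, z2] at hpos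
  simp at hpos

theorem IsFrontFor.exists_sweeps (hT : 0 < T) (hF : F.IsFrontFor T D) :
    ∃ Rm Rp : ℝ → ℝ → ℝ, ContinuousOn (Function.uncurry Rm) (timeIco T ×ˢ univ) ∧
      ContinuousOn (Function.uncurry Rp) (timeIco T ×ˢ univ) ∧
      (∀ t ∈ timeIoo T, ∀ l, relativeSweep F.xs F.ys F.minus.u F.minus.v t l = Rm t l) ∧
      ∀ t ∈ timeIoo T, ∀ l, relativeSweep F.xs F.ys F.plus.u F.plus.v t l = Rp t l := by
  obtain ⟨Rm, h1, h2⟩ := exists_continuousOn_relativeSweep hT hF.xs_smooth hF.ys_smooth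
    hF.field_minus.u_smooth.continuousOn hF.field_minus.v_smooth.continuousOn
  obtain ⟨Rp, h3, h4⟩ := exists_continuousOn_relativeSweep hT hF.xs_smooth hF.ys_smooth
    hF.field_plus.u_smooth.continuousOn hF.field_plus.v_smooth.continuousOn
  exact ⟨Rm, Rp, h1, h3, h2, h4⟩

/-- `Q` is built from the versions of the sweeps that are continuous up to `t = 0`. The Lagrangian
identity turns its time integral into the influx of the initial density. -/
theorem IsFrontFor.exists_balanced_mass (hT : 0 < T) (hD : D.IsAdmissible)
    (hF : F.IsFrontFor T D) : ∃ Q : ℝ → ℝ → ℝ,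
      F.IsBalanced T F.minus.rho F.plus.rho
        (fun t z => F.minus.rho t z * F.minus.u t z) (fun t z => F.plus.rho t z * F.plus.u t z)
        (fun t z => F.minus.rho t z * F.minus.v t z) (fun t z => F.plus.rho t z * F.plus.v t z) Q ∧
      (∀ t ∈ timeIco T, ∀ l, F.influx D.rho0 t l = ∫ τ in (0 : ℝ)..t, Q τ l) ∧
      ∀ t ∈ timeIoo T, ∀ l, Q t l = F.massFlux t l := by
  obtain ⟨Rm, Rp, cRm, cRp, hRm, hRp⟩ := hF.exists_sweeps hT
  have sm := hF.field_minus
  have sp := hF.field_plus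
  have cx := hF.xs_smooth.continuousOn
  have cy := hF.ys_smooth.continuousOn
  let Q : ℝ → ℝ → ℝ := fun t l => F.plus.rho t (F.xs t l, F.ys t l) * Rp t l
    - F.minus.rho t (F.xs t l, F.ys t l) * Rm t l
  refine ⟨Q, ⟨sm.rho_smooth, sp.rho_smooth,
    sm.rho_smooth.mul sm.u_smooth, sp.rho_smooth.mul sp.u_smooth, sm.rho_smooth.mul sm.v_smooth,
    sp.rho_smooth.mul sp.v_smooth, fun t ht z hz => (sm.solves t ht z (by simpa using hz)).1,
    fun t ht z hz => (sp.solves t ht z (by simpa using hz)).1,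
    ((continuousOn_curve_comp cx cy sp.rho_smooth.continuousOn).mul cRp).sub
      ((continuousOn_curve_comp cx cy sm.rho_smooth.continuousOn).mul cRm), fun t ht l => ?_⟩,
    fun t ht l => influx_eq_integral (Q := Q) (fun t ht l => ?_) ht l, fun t ht l => ?_⟩
  · simp only [Q]
    rw [FlowField.curveFlux_mass, FlowField.curveFlux_mass, hRm t ht, hRp t ht]
  · simp only [Q]
    rw [← hRm t ht, ← hRp t ht, (hF.plusSide hT hD).rho_mul_relativeSweep ht,
      (hF.minusSide hT hD).rho_mul_relativeSweep ht, (hF.data_at_plus hT hD ht l).1,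
      (hF.data_at_minus hT hD ht l).1]
  · simp only [Q]
    rw [massFlux, hRm t ht, hRp t ht]

/-- The velocity at the front equals the initial velocity at the foot of the characteristic, so it
passes through the mass identity as a factor. -/
theorem IsFrontFor.exists_balanced_momentum_x (hT : 0 < T) (hD : D.IsAdmissible)
    (hF : F.IsFrontFor T D) : ∃ Q : ℝ → ℝ → ℝ,
      F.IsBalanced T
        (fun t z => F.minus.rho t z * F.minus.u t z) (fun t z => F.plus.rho t z * F.plus.u t z)
        (fun t z => F.minus.rho t z * F.minus.u t z ^ 2)
        (fun t z => F.plus.rho t z * F.plus.u t z ^ 2)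
        (fun t z => F.minus.rho t z * F.minus.u t z * F.minus.v t z)
        (fun t z => F.plus.rho t z * F.plus.u t z * F.plus.v t z) Q ∧
      ∀ t ∈ timeIco T, ∀ l,
        F.influx (fun z => D.rho0 z * D.u0 z) t l = ∫ τ in (0 : ℝ)..t, Q τ l := by
  obtain ⟨Rm, Rp, cRm, cRp, hRm, hRp⟩ := hF.exists_sweeps hT
  have sm := hF.field_minus
  have sp := hF.field_plus
  have cx := hF.xs_smooth.continuousOn
  have cy := hF.ys_smooth.continuousOn
  let Q : ℝ → ℝ → ℝ := fun t l => F.plus.u t (F.xs t l, F.ys t l) * (F.plus.rho t (F.xs t l, F.ys t l) * Rp t l)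
    - F.minus.u t (F.xs t l, F.ys t l) * (F.minus.rho t (F.xs t l, F.ys t l) * Rm t l)
  refine ⟨Q,
    ⟨sm.rho_smooth.mul sm.u_smooth, sp.rho_smooth.mul sp.u_smooth,
    sm.rho_smooth.mul (sm.u_smooth.pow 2), sp.rho_smooth.mul (sp.u_smooth.pow 2),
    (sm.rho_smooth.mul sm.u_smooth).mul sm.v_smooth,
    (sp.rho_smooth.mul sp.u_smooth).mul sp.v_smooth,
    fun t ht z hz => (sm.solves t ht z (by simpa using hz)).2.1,
    fun t ht z hz => (sp.solves t ht z (by simpa using hz)).2.1,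
    ((continuousOn_curve_comp cx cy sp.u_smooth.continuousOn).mul
      ((continuousOn_curve_comp cx cy sp.rho_smooth.continuousOn).mul cRp)).sub
      ((continuousOn_curve_comp cx cy sm.u_smooth.continuousOn).mul
      ((continuousOn_curve_comp cx cy sm.rho_smooth.continuousOn).mul cRm)), fun t ht l => ?_⟩,
    fun t ht l => influx_eq_integral (Q := Q) (fun t ht l => ?_) ht l⟩
  · simp only [Q]
    rw [FlowField.curveFlux_momentum_x, FlowField.curveFlux_momentum_x, hRm t ht, hRp t ht]
  · have ht' := timeIoo_subset_timeIco T ht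
    simp only [Q]
    rw [← hRm t ht, ← hRp t ht, (hF.plusSide hT hD).rho_mul_relativeSweep ht,
      (hF.minusSide hT hD).rho_mul_relativeSweep ht, (hF.data_at_plus hT hD ht l).1,
      (hF.data_at_minus hT hD ht l).1, (hF.data_at_plus hT hD ht l).2.1,
      (hF.data_at_minus hT hD ht l).2.1, ((hF.plusSide hT hD).at_front ht' l).1,
      ((hF.minusSide hT hD).at_front ht' l).1]
    ring

theorem IsFrontFor.exists_balanced_momentum_y (hT : 0 < T) (hD : D.IsAdmissible)
    (hF : F.IsFrontFor T D) : ∃ Q : ℝ → ℝ → ℝ,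
      F.IsBalanced T
        (fun t z => F.minus.rho t z * F.minus.v t z) (fun t z => F.plus.rho t z * F.plus.v t z)
        (fun t z => F.minus.rho t z * F.minus.u t z * F.minus.v t z)
        (fun t z => F.plus.rho t z * F.plus.u t z * F.plus.v t z)
        (fun t z => F.minus.rho t z * F.minus.v t z ^ 2)
        (fun t z => F.plus.rho t z * F.plus.v t z ^ 2) Q ∧
      ∀ t ∈ timeIco T, ∀ l,
        F.influx (fun z => D.rho0 z * D.v0 z) t l = ∫ τ in (0 : ℝ)..t, Q τ l := by
  obtain ⟨Rm, Rp, cRm, cRp, hRm, hRp⟩ := hF.exists_sweeps hT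
  have sm := hF.field_minus
  have sp := hF.field_plus
  have cx := hF.xs_smooth.continuousOn
  have cy := hF.ys_smooth.continuousOn
  let Q : ℝ → ℝ → ℝ := fun t l => F.plus.v t (F.xs t l, F.ys t l) * (F.plus.rho t (F.xs t l, F.ys t l) * Rp t l)
    - F.minus.v t (F.xs t l, F.ys t l) * (F.minus.rho t (F.xs t l, F.ys t l) * Rm t l)
  refine ⟨Q,
    ⟨sm.rho_smooth.mul sm.v_smooth, sp.rho_smooth.mul sp.v_smooth,
    (sm.rho_smooth.mul sm.u_smooth).mul sm.v_smooth,
    (sp.rho_smooth.mul sp.u_smooth).mul sp.v_smooth,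
    sm.rho_smooth.mul (sm.v_smooth.pow 2), sp.rho_smooth.mul (sp.v_smooth.pow 2),
    fun t ht z hz => (sm.solves t ht z (by simpa using hz)).2.2,
    fun t ht z hz => (sp.solves t ht z (by simpa using hz)).2.2,
    ((continuousOn_curve_comp cx cy sp.v_smooth.continuousOn).mul
      ((continuousOn_curve_comp cx cy sp.rho_smooth.continuousOn).mul cRp)).sub
      ((continuousOn_curve_comp cx cy sm.v_smooth.continuousOn).mul
      ((continuousOn_curve_comp cx cy sm.rho_smooth.continuousOn).mul cRm)), fun t ht l => ?_⟩,
    fun t ht l => influx_eq_integral (Q := Q) (fun t ht l => ?_) ht l⟩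
  · simp only [Q]
    rw [FlowField.curveFlux_momentum_y, FlowField.curveFlux_momentum_y, hRm t ht, hRp t ht]
  · have ht' := timeIoo_subset_timeIco T ht
    simp only [Q]
    rw [← hRm t ht, ← hRp t ht, (hF.plusSide hT hD).rho_mul_relativeSweep ht,
      (hF.minusSide hT hD).rho_mul_relativeSweep ht, (hF.data_at_plus hT hD ht l).1,
      (hF.data_at_minus hT hD ht l).1, (hF.data_at_plus hT hD ht l).2.2,
      (hF.data_at_minus hT hD ht l).2.2, ((hF.plusSide hT hD).at_front ht' l).2.1,
      ((hF.minusSide hT hD).at_front ht' l).2.1]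
    ring

/-- The mass that has been swept up by the front is positive. -/
theorem IsFrontFor.influx_rho0_pos (hT : 0 < T) (hD : D.IsAdmissible) (hF : F.IsFrontFor T D)
    {t : ℝ} (ht : t ∈ timeIoo T) (l : ℝ) : 0 < F.influx D.rho0 t l := by
  have ht' := timeIoo_subset_timeIco T ht
  obtain ⟨Q, hQ, hin, hflux⟩ := hF.exists_balanced_mass hT hD
  have hsub : Icc 0 t ⊆ timeIco T := fun r hr => mem_timeIco_of_le ht' hr.1 hr.2
  have cQ := hQ.Q_cont.slab_time l
  have hmem : ∀ r ∈ Ioc 0 t, r ∈ timeIoo T := fun r hr => mem_timeIoo_of_le ht' hr.1 hr.2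
  -- The sign of the flux is known only for positive times and passes to the limit.
  have hQ0 : 0 ≤ Q 0 l := by
    refine ge_of_tendsto (tendsto_initial hT cQ) ?_
    filter_upwards [timeIoo_mem_nhdsGT hT] with r hr
    rw [hflux r hr]
    exact hF.massFlux_nonneg hT hD hr l
  rw [hin t ht' l]
  refine intervalIntegral.integral_pos ht.1 (cQ.mono hsub) (fun r hr => ?_) ?_
  · rw [hflux r (hmem r hr)]
    exact hF.massFlux_nonneg hT hD (hmem r hr) l
  · obtain ⟨r, hr1, hr2⟩ := ((hF.massFlux_pos hT hD l).and (Ioo_mem_nhdsGT ht.1)).exists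
    refine ⟨r, Ioo_subset_Icc_self hr2, ?_⟩
    rw [hflux r (hmem r ⟨hr2.1, hr2.2.le⟩)]
    exact hr1

end ShockFront

/-! ### Test functions near a properly embedded curve -/

/-- The rest of the curve, outside a parameter neighbourhood of `l₀`, is closed and misses `X l₀`. A
bump supported off it therefore sees no distant part of the curve that returns close to `X l₀`. -/
theorem exists_bump_on_curve {X : ℝ → ℝ × ℝ} (hX : IsClosedEmbedding X) {l₀ : ℝ} {U : Set ℝ}
    (hU : U ∈ 𝓝 l₀) : ∃ f : ℝ × ℝ → ℝ, ContDiff ℝ 1 f ∧ HasCompactSupport f ∧ (∀ z, 0 ≤ f z) ∧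
      f (X l₀) = 1 ∧ ∀ l, f (X l) ≠ 0 → l ∈ U := by
  obtain ⟨V, hVU, hV, hl₀⟩ := mem_nhds_iff.1 hU
  have hC : IsClosed (X '' Vᶜ) := hX.isClosedMap _ hV.isClosed_compl
  have hn : (X '' Vᶜ)ᶜ ∈ 𝓝 (X l₀) := hC.isOpen_compl.mem_nhds (by
    rintro ⟨l, hl, e⟩
    exact hl (hX.injective e ▸ hl₀))
  obtain ⟨f, h1, h2, h3, h4, h5⟩ := exists_contDiff_tsupport_subset (n := 1) hn
  refine ⟨f, by exact_mod_cast h3, h2, fun z => (h4 ⟨z, rfl⟩).1, h5, fun l hl => hVU ?_⟩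
  by_contra hlV
  exact h1 (subset_tsupport f hl) ⟨l, hlV, rfl⟩

theorem integral_curve_pos {X : ℝ → ℝ × ℝ} (hX : IsClosedEmbedding X) {k : ℝ → ℝ}
    (hk : Continuous k) {l₀ : ℝ} (hpos : 0 < k l₀) : ∃ f : ℝ × ℝ → ℝ, ContDiff ℝ 1 f ∧
      HasCompactSupport f ∧ (∀ z, 0 ≤ f z) ∧ 0 < ∫ l, f (X l) * k l := by
  obtain ⟨f, h1, h2, h3, h4, h5⟩ := exists_bump_on_curve hX
    (hk.continuousAt.eventually (lt_mem_nhds hpos))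
  refine ⟨f, h1, h2, h3, ?_⟩
  refine Continuous.integral_pos_of_hasCompactSupport_nonneg_nonzero (x := l₀)
    ((h1.continuous.comp hX.continuous).mul hk) (h2.comp_isClosedEmbedding hX).mul_right ?_ ?_
  · intro l
    by_cases h0 : f (X l) = 0
    · simp [h0]
    · exact mul_nonneg (h3 _) (le_of_lt (h5 l h0))
  · simp [h4, hpos.ne']

theorem eq_zero_of_integral_curve_eq_zero {X : ℝ → ℝ × ℝ} (hX : IsClosedEmbedding X) {k : ℝ → ℝ}
    (hk : Continuous k) (h : ∀ f : ℝ × ℝ → ℝ, ContDiff ℝ 1 f → HasCompactSupport f →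
      ∫ l, f (X l) * k l = 0) (l : ℝ) : k l = 0 := by
  by_contra hne
  rcases lt_or_gt_of_ne hne with hl | hl
  · obtain ⟨f, h1, h2, -, h4⟩ := integral_curve_pos hX hk.neg (l₀ := l) (by simpa using hl)
    have := h f h1 h2
    simp only [mul_neg, integral_neg, Pi.neg_apply] at h4
    linarith
  · obtain ⟨f, h1, h2, -, h4⟩ := integral_curve_pos hX hk hl
    exact h4.ne' (h f h1 h2)

theorem hasDerivAt_of_sub_eq_integral {T : EReal} {L R : ℝ → ℝ} (hR : ContinuousOn R (timeIoo T))
    (h : ∀ t₁ ∈ timeIoo T, ∀ t₂ ∈ timeIoo T, t₁ < t₂ → L t₂ - L t₁ = ∫ τ in t₁..t₂, R τ) {t : ℝ}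
    (ht : t ∈ timeIoo T) : HasDerivAt L (R t) t := by
  have hJ := isOpen_timeIoo T
  have ht2 : t / 2 < t := by linarith [ht.1]
  have ht1 : t / 2 ∈ timeIoo T := mem_timeIoo_of_le (timeIoo_subset_timeIco T ht) (half_pos ht.1)
    ht2.le
  have hsub : Icc (t / 2) t ⊆ timeIoo T := fun r hr => mem_timeIoo_of_le
    (timeIoo_subset_timeIco T ht) (ht1.1.trans_le hr.1) hr.2
  have hint : IntervalIntegrable R volume (t / 2) t :=
    ContinuousOn.intervalIntegrable (by rw [uIcc_of_le ht2.le]; exact hR.mono hsub)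
  have hd := intervalIntegral.integral_hasDerivAt_right hint
    (hR.stronglyMeasurableAtFilter hJ t ht) (hR.continuousAt (hJ.mem_nhds ht))
  refine (hd.const_add (L (t / 2))).congr_of_eventuallyEq ?_
  filter_upwards [hJ.mem_nhds ht, lt_mem_nhds ht2] with s hs hs2
  rw [← h _ ht1 s hs hs2]
  ring

/-! ### Balance laws and initial values in terms of the surface density -/

namespace ShockFront

variable {F : ShockFront} {T : EReal} {D : CauchyData}

theorem IsFrontFor.isClosedEmbedding (hF : F.IsFrontFor T D) {t : ℝ} (ht : t ∈ timeIco T) :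
    IsClosedEmbedding fun l => (F.xs t l, F.ys t l) := by
  have hc : Continuous fun l => (F.xs t l, F.ys t l) :=
    (hF.xs_smooth.continuousOn.slab_slice ht).prodMk (hF.ys_smooth.continuousOn.slab_slice ht)
  refine .of_continuous_injective_isClosedMap hc (hF.injective ht) (IsProperMap.isClosedMap ?_)
  refine isProperMap_iff_isCompact_preimage.2 ⟨hc, fun K hK => ?_⟩
  obtain ⟨L, hL⟩ := hF.isUniformlyProper t ht K hK
  exact isCompact_Icc.of_isClosed_subset (hK.isClosed.preimage hc)
    fun l hl => hL.self_of_nhdsWithin ht l hl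

/-- The rate of change of the action on `f` of a balanced quantity that is carried along by the
front. -/
noncomputable def actionRate (F : ShockFront) (pm pp qm qp : ℝ → ℝ × ℝ → ℝ) (w : ℝ → ℝ → ℝ)
    (f : ℝ × ℝ → ℝ) (t : ℝ) : ℝ :=
  F.action (pm t) (pp t) (fun l => deriv (fun s => F.xs s l) t * w t l) t (partialX f)
    + F.action (qm t) (qp t) (fun l => deriv (fun s => F.ys s l) t * w t l) t (partialY f)

section Balance

variable {mm mp pm pp qm qp : ℝ → ℝ × ℝ → ℝ} {Q w : ℝ → ℝ → ℝ}

theorem IsBalanced.continuousOn_actionRate (hB : F.IsBalanced T mm mp pm pp qm qp Q)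
    (hF : F.IsFrontFor T D) (hw : ContDiffOn ℝ 1 (Function.uncurry w) (timeIco T ×ˢ univ))
    {f : ℝ × ℝ → ℝ} (hf : ContDiff ℝ 1 f) (hfc : HasCompactSupport f) :
    ContinuousOn (F.actionRate pm pp qm qp w f) (timeIoo T) := by
  have hJ := isOpen_timeIoo T
  exact (hF.continuousOn_action_Ioo (w := fun t l => deriv (fun s => F.xs s l) t * w t l)
    hB.pm_smooth.continuousOn.timeIoo hB.pp_smooth.continuousOn.timeIoo
    ((continuousOn_deriv_timeSlice hJ hF.xs_smooth.timeIoo).mul hw.continuousOn.timeIoo)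
    hf.continuous_partialX hfc.partialX).add (hF.continuousOn_action_Ioo
    (w := fun t l => deriv (fun s => F.ys s l) t * w t l) hB.qm_smooth.continuousOn.timeIoo hB.qp_smooth.continuousOn.timeIoo
    ((continuousOn_deriv_timeSlice hJ hF.ys_smooth.timeIoo).mul hw.continuousOn.timeIoo)
    hf.continuous_partialY hfc.partialY)

theorem IsBalanced.hasDerivAt (hB : F.IsBalanced T mm mp pm pp qm qp Q) (hT : 0 < T)
    (hD : D.IsAdmissible) (hF : F.IsFrontFor T D)
    (hw : ContDiffOn ℝ 1 (Function.uncurry w) (timeIco T ×ˢ univ))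
    {f : ℝ × ℝ → ℝ} (hf : ContDiff ℝ 1 f) (hfc : HasCompactSupport f) {t : ℝ}
    (ht : t ∈ timeIoo T) :
    HasDerivAt (fun s => F.action (mm s) (mp s) (w s) s f) (F.actionRate pm pp qm qp w f t
      + ∫ l, f (F.xs t l, F.ys t l) * (deriv (fun s => w s l) t - Q t l)) t := by
  have h := hF.hasDerivAt_action
    (fun t ht l => hF.normalDeriv_lt_zero hT hD (timeIoo_subset_timeIco T ht) l)
    hB.mm_smooth.timeIoo hB.mp_smooth.timeIoo hB.pm_smooth.timeIoo hB.pp_smooth.timeIoo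
    hB.qm_smooth.timeIoo hB.qp_smooth.timeIoo hw.timeIoo ht (hB.eq_minus t ht) (hB.eq_plus t ht)
    hf hfc
  simpa only [hB.flux t ht, actionRate] using h

/-- The balance law holds if the surface density is the accumulated flux. -/
theorem IsBalanced.balance_of_eq_integral (hB : F.IsBalanced T mm mp pm pp qm qp Q) (hT : 0 < T)
    (hD : D.IsAdmissible) (hF : F.IsFrontFor T D)
    (hw : ContDiffOn ℝ 1 (Function.uncurry w) (timeIco T ×ˢ univ))
    (hwQ : ∀ t ∈ timeIco T, ∀ l, w t l = ∫ τ in (0 : ℝ)..t, Q τ l)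
    {f : ℝ × ℝ → ℝ} (hf : ContDiff ℝ 1 f) (hfc : HasCompactSupport f) {t₁ t₂ : ℝ}
    (ht₁ : t₁ ∈ timeIoo T) (ht₂ : t₂ ∈ timeIoo T) (hlt : t₁ < t₂) :
    IntervalIntegrable (F.actionRate pm pp qm qp w f) volume t₁ t₂ ∧
      F.action (mm t₂) (mp t₂) (w t₂) t₂ f - F.action (mm t₁) (mp t₁) (w t₁) t₁ f
        = ∫ τ in t₁..t₂, F.actionRate pm pp qm qp w f τ := by
  have hJ := isOpen_timeIoo T
  have hwd : ∀ t ∈ timeIoo T, ∀ l, deriv (fun s => w s l) t = Q t l := by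
    intro t ht l
    have cQ := hB.Q_cont.slab_time l
    have hsub : Icc 0 t ⊆ timeIco T := fun r hr =>
      mem_timeIco_of_le (timeIoo_subset_timeIco T ht) hr.1 hr.2
    have hint : IntervalIntegrable (fun τ => Q τ l) volume 0 t :=
      ContinuousOn.intervalIntegrable (by rw [uIcc_of_le ht.1.le]; exact cQ.mono hsub)
    have cQ' := cQ.mono (timeIoo_subset_timeIco T)
    have hd := intervalIntegral.integral_hasDerivAt_right hint
      (cQ'.stronglyMeasurableAtFilter hJ t ht) (cQ'.continuousAt (hJ.mem_nhds ht))
    refine (hd.congr_of_eventuallyEq ?_).deriv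
    filter_upwards [hJ.mem_nhds ht] with s hs using hwQ s (timeIoo_subset_timeIco T hs) l
  have hsub : uIcc t₁ t₂ ⊆ timeIoo T := by
    rw [uIcc_of_le hlt.le]
    exact fun r hr => mem_timeIoo_of_le (timeIoo_subset_timeIco T ht₂) (ht₁.1.trans_le hr.1) hr.2
  have hint : IntervalIntegrable (F.actionRate pm pp qm qp w f) volume t₁ t₂ :=
    ((hB.continuousOn_actionRate hF hw hf hfc).mono hsub).intervalIntegrable
  refine ⟨hint, (intervalIntegral.integral_eq_sub_of_hasDerivAt
    (f := fun s => F.action (mm s) (mp s) (w s) s f) (fun t ht => ?_) hint).symm⟩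
  simpa [hwd t (hsub ht)] using hB.hasDerivAt hT hD hF hw hf hfc (hsub ht)

/-- The surface density is the accumulated flux if the balance law holds. -/
theorem IsBalanced.eq_integral_of_balance (hB : F.IsBalanced T mm mp pm pp qm qp Q) (hT : 0 < T)
    (hD : D.IsAdmissible) (hF : F.IsFrontFor T D)
    (hw : ContDiffOn ℝ 1 (Function.uncurry w) (timeIco T ×ˢ univ)) (hw0 : ∀ l, w 0 l = 0)
    (hbal : ∀ f : ℝ × ℝ → ℝ, ContDiff ℝ 1 f → HasCompactSupport f →
      ∀ t₁ ∈ timeIoo T, ∀ t₂ ∈ timeIoo T, t₁ < t₂ →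
      F.action (mm t₂) (mp t₂) (w t₂) t₂ f - F.action (mm t₁) (mp t₁) (w t₁) t₁ f
        = ∫ τ in t₁..t₂, F.actionRate pm pp qm qp w f τ) {t : ℝ} (ht : t ∈ timeIco T) (l : ℝ) :
    w t l = ∫ τ in (0 : ℝ)..t, Q τ l := by
  have hJ := isOpen_timeIoo T
  have hwd : ∀ t ∈ timeIoo T, ∀ l, deriv (fun s => w s l) t = Q t l := by
    intro t ht l
    have ht' := timeIoo_subset_timeIco T ht
    have ck : Continuous fun l => deriv (fun s => w s l) t - Q t l :=
      ((continuousOn_deriv_timeSlice hJ hw.timeIoo).slab_slice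
        (k := fun t l => deriv (fun s => w s l) t) ht).sub (hB.Q_cont.slab_slice ht')
    -- The action has a derivative by the general formula and another expression for it by the
    -- balance law. They differ by the integral of `f` times $w_t-Q$ over the curve, and `f` is
    -- arbitrary.
    refine sub_eq_zero.1 (eq_zero_of_integral_curve_eq_zero (hF.isClosedEmbedding ht') ck
      (fun f hf hfc => ?_) l)
    have h1 := hB.hasDerivAt hT hD hF hw hf hfc ht
    have h2 := hasDerivAt_of_sub_eq_integral (hB.continuousOn_actionRate hF hw hf hfc)
      (L := fun s => F.action (mm s) (mp s) (w s) s f) (hbal f hf hfc) ht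
    linarith [h1.unique h2]
  have hsub : Icc 0 t ⊆ timeIco T := fun r hr => mem_timeIco_of_le ht hr.1 hr.2
  have hint : IntervalIntegrable (fun τ => Q τ l) volume 0 t :=
    ContinuousOn.intervalIntegrable (by
      rw [uIcc_of_le ht.1]; exact (hB.Q_cont.slab_time l).mono hsub)
  have := intervalIntegral.integral_eq_sub_of_hasDerivAt_of_le ht.1
    ((hw.continuousOn.slab_time l).mono hsub) (f' := fun τ => Q τ l) (fun r hr => by
      have hr' : r ∈ timeIoo T := mem_timeIoo_of_le ht hr.1 hr.2.le
      rw [← hwd r hr' l]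
      exact (hw.timeIoo.differentiableAt_slab hJ hr' l).timeSlice.hasDerivAt) hint
  rw [this, hw0, sub_zero]

end Balance

/-- The action at the initial time. -/
theorem IsFrontFor.action_zero (hT : 0 < T) (hF : F.IsFrontFor T D) {mm mp : ℝ × ℝ → ℝ}
    {w : ℝ → ℝ} {m₀ : ℝ × ℝ → ℝ} (hm : ∀ z ∈ D.sideMinus, mm z = m₀ z)
    (hp : ∀ z ∈ D.sidePlus, mp z = m₀ z) (φ : ℝ × ℝ → ℝ) :
    F.action mm mp w 0 φ = (∫ z, φ z * m₀ z) + ∫ l, φ (F.xs 0 l, F.ys 0 l) * w l := by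
  unfold action
  congr 1
  refine integral_congr_ae ?_
  have hne : ∀ᵐ z, F.S 0 z ≠ 0 := by
    rw [ae_iff]; simpa using hF.volume_surface (zero_mem_timeIco hT)
  filter_upwards [hne] with z hz
  rcases lt_or_gt_of_ne hz with h | h
  · rw [heavi_of_nonpos h.le, hm z ((hF.S_initial_minus z).1 h)]; ring
  · rw [heavi_of_pos h, ← hp z ((hF.S_initial_plus z).1 h)]; ring

/-- The surface density vanishes initially if the initial data are attained. -/
theorem IsFrontFor.eq_zero_of_tendsto (hT : 0 < T) (hF : F.IsFrontFor T D)
    {mm mp : ℝ → ℝ × ℝ → ℝ} {w : ℝ → ℝ → ℝ} {m₀ : ℝ × ℝ → ℝ}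
    (hmm : ContinuousOn (Function.uncurry mm) (timeIco T ×ˢ univ))
    (hmp : ContinuousOn (Function.uncurry mp) (timeIco T ×ˢ univ))
    (hw : ContinuousOn (Function.uncurry w) (timeIco T ×ˢ univ))
    (hm : ∀ z ∈ D.sideMinus, mm 0 z = m₀ z) (hp : ∀ z ∈ D.sidePlus, mp 0 z = m₀ z)
    (hlim : ∀ φ : ℝ × ℝ → ℝ, Continuous φ → HasCompactSupport φ →
      Tendsto (fun t => F.action (mm t) (mp t) (w t) t φ) (𝓝[>] 0) (𝓝 (∫ z, φ z * m₀ z))) (l : ℝ) :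
    w 0 l = 0 := by
  have h0 := zero_mem_timeIco hT
  refine eq_zero_of_integral_curve_eq_zero (hF.isClosedEmbedding h0) (hw.slab_slice h0)
    (fun f hf hfc => ?_) l
  have h1 := tendsto_nhds_unique (hlim f hf.continuous hfc)
    (tendsto_initial hT (hF.continuousOn_action hmm hmp hw hf.continuous hfc))
  rw [hF.action_zero hT hm hp] at h1
  linarith

/-- The initial data are attained if the surface density vanishes initially. -/
theorem IsFrontFor.tendsto_of_eq_zero (hT : 0 < T) (hF : F.IsFrontFor T D)
    {mm mp : ℝ → ℝ × ℝ → ℝ} {w : ℝ → ℝ → ℝ} {m₀ : ℝ × ℝ → ℝ}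
    (hmm : ContinuousOn (Function.uncurry mm) (timeIco T ×ˢ univ))
    (hmp : ContinuousOn (Function.uncurry mp) (timeIco T ×ˢ univ))
    (hw : ContinuousOn (Function.uncurry w) (timeIco T ×ˢ univ))
    (hm : ∀ z ∈ D.sideMinus, mm 0 z = m₀ z) (hp : ∀ z ∈ D.sidePlus, mp 0 z = m₀ z)
    (hw0 : ∀ l, w 0 l = 0) {φ : ℝ × ℝ → ℝ} (hφ : Continuous φ) (hφc : HasCompactSupport φ) :
    Tendsto (fun t => F.action (mm t) (mp t) (w t) t φ) (𝓝[>] 0) (𝓝 (∫ z, φ z * m₀ z)) := by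
  have h1 := tendsto_initial hT (hF.continuousOn_action hmm hmp hw hφ hφc)
  rw [hF.action_zero hT hm hp] at h1
  simpa [hw0] using h1

/-- The data on the two sides, as values of the fields at the initial time. -/
theorem IsFrontFor.initial_plus (hF : F.IsFrontFor T D) {z : ℝ × ℝ} (hz : z ∈ D.sidePlus) :
    F.plus.rho 0 z = D.rho0 z ∧ F.plus.u 0 z = D.u0 z ∧ F.plus.v 0 z = D.v0 z := by
  have hc := subset_closure hz
  have hG : 0 < D.G z := hz
  rw [hF.field_plus.rho_initial z hc, hF.field_plus.u_initial z hc, hF.field_plus.v_initial z hc]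
  simp [CauchyData.rho0, CauchyData.u0, CauchyData.v0, heavi_of_pos hG]

theorem IsFrontFor.initial_minus (hF : F.IsFrontFor T D) {z : ℝ × ℝ} (hz : z ∈ D.sideMinus) :
    F.minus.rho 0 z = D.rho0 z ∧ F.minus.u 0 z = D.u0 z ∧ F.minus.v 0 z = D.v0 z := by
  have hc := subset_closure hz
  have hG : D.G z < 0 := hz
  rw [hF.field_minus.rho_initial z hc, hF.field_minus.u_initial z hc,
    hF.field_minus.v_initial z hc]
  simp [CauchyData.rho0, CauchyData.u0, CauchyData.v0, heavi_of_nonpos hG.le]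

end ShockFront

/-! ### Measures with a density and a part carried by a curve -/

section WithDensity

variable {α : Type*} [MeasurableSpace α] {μ : Measure α} {f : α → ℝ}

theorem integral_withDensity_ofReal (hf : Measurable f) (h0 : ∀ᵐ x ∂μ, 0 ≤ f x) (g : α → ℝ) :
    ∫ x, g x ∂(μ.withDensity fun x => ENNReal.ofReal (f x)) = ∫ x, g x * f x ∂μ := by
  rw [integral_withDensity_eq_integral_toReal_smul hf.ennreal_ofReal
    (ae_of_all _ fun _ => ENNReal.ofReal_lt_top)]
  refine integral_congr_ae (h0.mono fun x hx => ?_)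
  simp [ENNReal.toReal_ofReal hx, mul_comm]

theorem integrable_withDensity_ofReal (hf : Measurable f) (h0 : ∀ᵐ x ∂μ, 0 ≤ f x) {g : α → ℝ} :
    Integrable g (μ.withDensity fun x => ENNReal.ofReal (f x)) ↔
      Integrable (fun x => g x * f x) μ := by
  rw [integrable_withDensity_iff_integrable_smul' hf.ennreal_ofReal
    (ae_of_all _ fun _ => ENNReal.ofReal_lt_top)]
  refine integrable_congr (h0.mono fun x hx => ?_)
  simp [ENNReal.toReal_ofReal hx, mul_comm]

theorem ae_withDensity_ofReal (hf : Measurable f) (h0 : ∀ᵐ x ∂μ, 0 ≤ f x) {p : α → Prop} :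
    (∀ᵐ x ∂(μ.withDensity fun x => ENNReal.ofReal (f x)), p x) ↔ ∀ᵐ x ∂μ, f x ≠ 0 → p x := by
  rw [ae_withDensity_iff hf.ennreal_ofReal]
  refine eventually_congr (h0.mono fun x hx => ?_)
  have : ENNReal.ofReal (f x) ≠ 0 ↔ f x ≠ 0 := by
    rw [Ne, ENNReal.ofReal_eq_zero, not_le]
    exact ⟨fun h => h.ne', fun h => hx.lt_of_ne h.symm⟩
  rw [this]

theorem isLocallyFiniteMeasure_withDensity_ofReal [TopologicalSpace α] [T2Space α]
    [OpensMeasurableSpace α] [WeaklyLocallyCompactSpace α] (hf : LocallyIntegrable f μ) :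
    IsLocallyFiniteMeasure (μ.withDensity fun x => ENNReal.ofReal (f x)) := by
  have : IsFiniteMeasureOnCompacts (μ.withDensity fun x => ENNReal.ofReal (f x)) := by
    refine ⟨fun K hK => ?_⟩
    rw [withDensity_apply _ hK.isClosed.measurableSet]
    exact (hf.integrableOn_isCompact hK).lintegral_lt_top
  exact isLocallyFiniteMeasure_of_isFiniteMeasureOnCompacts

end WithDensity

theorem locallyIntegrable_of_abs_le {α : Type*} [MeasurableSpace α] [TopologicalSpace α]
    [OpensMeasurableSpace α] {μ : Measure α} [IsLocallyFiniteMeasure μ] {f B : α → ℝ}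
    (hf : AEStronglyMeasurable f μ) (hB : Continuous B) (h : ∀ᵐ x ∂μ, |f x| ≤ B x) :
    LocallyIntegrable f μ := by
  intro x
  obtain ⟨s, hs, hfin⟩ := μ.finiteAt_nhds x
  have hs' : s ∩ {y | B y < B x + 1} ∈ 𝓝 x :=
    inter_mem hs (hB.continuousAt.eventually (gt_mem_nhds (by linarith)))
  obtain ⟨t, hts, hto, hxt⟩ := mem_nhds_iff.1 hs'
  refine ⟨t, hto.mem_nhds hxt, ?_⟩
  refine Measure.integrableOn_of_bounded (M := B x + 1)
    ((measure_mono (hts.trans inter_subset_left)).trans_lt hfin).ne hf ?_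
  refine (ae_restrict_iff' hto.measurableSet).2 (h.mono fun y hy hyt => ?_)
  exact hy.trans (hts hyt).2.le

section Curve

variable {X : ℝ → ℝ × ℝ} {r : ℝ × ℝ → ℝ} {w : ℝ → ℝ}

/-- The measure `r dx dy + w δ(X)`. -/
noncomputable def sheetMeasure (X : ℝ → ℝ × ℝ) (r : ℝ × ℝ → ℝ) (w : ℝ → ℝ) : Measure (ℝ × ℝ) :=
  (volume.withDensity fun z => ENNReal.ofReal (r z))
    + (volume.withDensity fun l => ENNReal.ofReal (w l)).map X

theorem isLocallyFiniteMeasure_sheetMeasure (hX : IsClosedEmbedding X)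
    (hr : LocallyIntegrable r) (hw : Continuous w) :
    IsLocallyFiniteMeasure (sheetMeasure X r w) := by
  have i1 := isLocallyFiniteMeasure_withDensity_ofReal hr
  have i2 := isLocallyFiniteMeasure_withDensity_ofReal (μ := (volume : Measure ℝ))
    hw.locallyIntegrable
  have : IsFiniteMeasureOnCompacts (sheetMeasure X r w) := by
    refine ⟨fun K hK => ?_⟩
    rw [sheetMeasure, Measure.add_apply, hX.measurableEmbedding.map_apply]
    exact ENNReal.add_lt_top.2 ⟨hK.measure_lt_top, (hX.isCompact_preimage hK).measure_lt_top⟩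
  exact isLocallyFiniteMeasure_of_isFiniteMeasureOnCompacts

theorem integrable_sheetMeasure (hX : IsClosedEmbedding X) (hr : Measurable r)
    (hr0 : ∀ᵐ z, 0 ≤ r z) (hw : Measurable w) (hw0 : ∀ l, 0 ≤ w l) {ψ : ℝ × ℝ → ℝ} :
    Integrable ψ (sheetMeasure X r w) ↔
      Integrable (fun z => ψ z * r z) ∧ Integrable fun l => ψ (X l) * w l := by
  rw [sheetMeasure, integrable_add_measure, hX.measurableEmbedding.integrable_map_iff,
    integrable_withDensity_ofReal hr hr0, integrable_withDensity_ofReal hw (ae_of_all _ hw0)]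
  rfl

theorem integral_sheetMeasure (hX : IsClosedEmbedding X) (hr : Measurable r)
    (hr0 : ∀ᵐ z, 0 ≤ r z) (hw : Measurable w) (hw0 : ∀ l, 0 ≤ w l) {ψ : ℝ × ℝ → ℝ}
    (hψ : Integrable ψ (sheetMeasure X r w)) :
    ∫ z, ψ z ∂(sheetMeasure X r w) = (∫ z, ψ z * r z) + ∫ l, ψ (X l) * w l := by
  rw [sheetMeasure, integrable_add_measure] at hψ
  rw [sheetMeasure, integral_add_measure hψ.1 hψ.2, integral_withDensity_ofReal hr hr0,
    hX.measurableEmbedding.integral_map, integral_withDensity_ofReal hw (ae_of_all _ hw0)]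

theorem ae_sheetMeasure (hX : IsClosedEmbedding X) (hr : Measurable r) (hr0 : ∀ᵐ z, 0 ≤ r z)
    (hw : Measurable w) (hw0 : ∀ l, 0 ≤ w l) {p : ℝ × ℝ → Prop} :
    (∀ᵐ z ∂(sheetMeasure X r w), p z) ↔
      (∀ᵐ z, r z ≠ 0 → p z) ∧ ∀ᵐ l, w l ≠ 0 → p (X l) := by
  rw [sheetMeasure, ae_add_measure_iff, hX.measurableEmbedding.ae_map_iff,
    ae_withDensity_ofReal hr hr0, ae_withDensity_ofReal hw (ae_of_all _ hw0)]

/-- A functional with a density on the plane and a density on a curve is nonnegative only if the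
density on the curve is. -/
theorem nonneg_of_integral_add_integral_curve (hX : IsClosedEmbedding X)
    (hX0 : volume (range X) = 0) {h : ℝ × ℝ → ℝ} (hh : LocallyIntegrable h) {k : ℝ → ℝ}
    (hk : Continuous k) (H : ∀ φ : ℝ × ℝ → ℝ, Continuous φ → HasCompactSupport φ → (∀ z, 0 ≤ φ z) →
      0 ≤ (∫ z, φ z * h z) + ∫ l, φ (X l) * k l) (l : ℝ) : 0 ≤ k l := by
  by_contra hneg
  obtain ⟨f, f1, f2, f3, f4⟩ := integral_curve_pos hX hk.neg (l₀ := l) (by simpa using hneg)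
  simp only [Pi.neg_apply, mul_neg, integral_neg] at f4
  -- Cutoffs equal to one on the curve that shrink onto it. The planar integral tends to zero
  -- because the curve is a closed null set, while the curve integral does not change.
  obtain ⟨ψ, hψ⟩ : ∃ ψ : ℕ → ℝ × ℝ → ℝ, ψ = fun (n : ℕ) z =>
      max 0 (1 - (n : ℝ) * Metric.infDist z (range X)) := ⟨_, rfl⟩
  have ψc : ∀ n, Continuous (ψ n) := fun n => by
    rw [hψ]
    have := Metric.continuous_infDist_pt (range X)
    fun_prop
  have ψ0 : ∀ n z, 0 ≤ ψ n z := fun n z => by rw [hψ]; exact le_max_left _ _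
  have ψ1 : ∀ n z, ψ n z ≤ 1 := fun n z => by
    rw [hψ]
    have := mul_nonneg (Nat.cast_nonneg (α := ℝ) n) (Metric.infDist_nonneg (s := range X) (x := z))
    exact max_le zero_le_one (by linarith)
  have ψX : ∀ n l, ψ n (X l) = 1 := fun n l => by
    rw [hψ]
    simp [Metric.infDist_zero_of_mem (mem_range_self (f := X) l)]
  have key : ∀ n, 0 ≤ (∫ z, (f z * ψ n z) * h z) + ∫ l, f (X l) * k l := fun n => by
    have := H (fun z => f z * ψ n z) (f1.continuous.mul (ψc n)) f2.mul_right
      fun z => mul_nonneg (f3 z) (ψ0 n z)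
    simpa only [ψX, mul_one] using this
  have hint : Integrable fun z => f z * h z := by
    simpa using hh.integrable_smul_left_of_hasCompactSupport f1.continuous f2
  have lim : Tendsto (fun n => ∫ z, (f z * ψ n z) * h z) atTop (𝓝 (∫ _ : ℝ × ℝ, (0 : ℝ))) := by
    refine tendsto_integral_of_dominated_convergence (fun z => |f z * h z|) (fun n => ?_) hint.abs
      (fun n => ae_of_all _ fun z => ?_) ?_
    · have : (fun z => (f z * ψ n z) * h z) = fun z => ψ n z * (f z * h z) := by ext z; ring
      rw [this]
      exact (ψc n).aestronglyMeasurable.mul hint.aestronglyMeasurable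
    · have : (f z * ψ n z) * h z = ψ n z * (f z * h z) := by ring
      rw [this, norm_mul, Real.norm_of_nonneg (ψ0 n z)]
      exact mul_le_of_le_one_left (abs_nonneg _) (ψ1 n z)
    · have hne : ∀ᵐ z, z ∉ range X := measure_eq_zero_iff_ae_notMem.1 hX0
      filter_upwards [hne] with z hz
      have hpos : 0 < Metric.infDist z (range X) :=
        (hX.isClosed_range.notMem_iff_infDist_pos (range_nonempty X)).1 hz
      refine tendsto_const_nhds.congr' ?_
      obtain ⟨N, hN⟩ := exists_nat_gt (1 / Metric.infDist z (range X))
      filter_upwards [eventually_ge_atTop N] with n hn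
      have h1 : 1 < n * Metric.infDist z (range X) := by
        rw [div_lt_iff₀ hpos] at hN
        exact hN.trans_le (mul_le_mul_of_nonneg_right (by exact_mod_cast hn) hpos.le)
      rw [hψ]
      simp only
      rw [max_eq_left (by linarith)]
      ring
  have := ge_of_tendsto' (lim.add_const (∫ l, f (X l) * k l)) key
  simp only [integral_zero, zero_add] at this
  linarith

/-- Both signs of the functional make the curve density vanish; the fundamental lemma of the
calculus of variations then applies to the planar density. This gives uniqueness of the two
densities of a sheet measure. -/
theorem eq_zero_of_integral_add_integral_curve (hX : IsClosedEmbedding X)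
    (hX0 : volume (range X) = 0) {h : ℝ × ℝ → ℝ} (hh : LocallyIntegrable h) {k : ℝ → ℝ}
    (hk : Continuous k) (H : ∀ φ : ℝ × ℝ → ℝ, Continuous φ → HasCompactSupport φ →
      (∫ z, φ z * h z) + ∫ l, φ (X l) * k l = 0) : (∀ l, k l = 0) ∧ ∀ᵐ z, h z = 0 := by
  have hk0 : ∀ l, k l = 0 := fun l => by
    refine le_antisymm ?_ (nonneg_of_integral_add_integral_curve hX hX0 hh hk
      (fun φ h1 h2 _ => (H φ h1 h2).ge) l)
    have := nonneg_of_integral_add_integral_curve hX hX0 hh.neg hk.neg (fun φ h1 h2 _ => by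
      have := H φ h1 h2
      simp only [Pi.neg_apply, mul_neg, integral_neg]
      linarith) l
    simpa using this
  refine ⟨hk0, ae_eq_zero_of_integral_contDiff_smul_eq_zero hh fun g hg hgc => ?_⟩
  simpa [hk0] using H g hg.continuous hgc

/-- A Radon measure with a density on the plane and a density on a curve. -/
theorem eq_sheetMeasure (hX : IsClosedEmbedding X) (hX0 : volume (range X) = 0)
    (hr : Measurable r) (hr0 : ∀ᵐ z, 0 ≤ r z) (hrl : LocallyIntegrable r) (hw : Continuous w)
    {P : Measure (ℝ × ℝ)} [IsLocallyFiniteMeasure P]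
    (hP : ∀ φ : ℝ × ℝ → ℝ, Continuous φ → HasCompactSupport φ →
      ∫ z, φ z ∂P = (∫ z, φ z * r z) + ∫ l, φ (X l) * w l) :
    (∀ l, 0 ≤ w l) ∧ P = sheetMeasure X r w := by
  have hw0 : ∀ l, 0 ≤ w l := nonneg_of_integral_add_integral_curve hX hX0 hrl hw
    fun φ h1 h2 h3 => by rw [← hP φ h1 h2]; exact integral_nonneg h3
  have := isLocallyFiniteMeasure_sheetMeasure hX hrl hw
  refine ⟨hw0, Measure.ext_of_integral_eq_on_compactlySupported fun φ => ?_⟩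
  rw [hP φ φ.continuous φ.hasCompactSupport, integral_sheetMeasure hX hr hr0 hw.measurable hw0]
  exact φ.continuous.integrable_of_hasCompactSupport φ.hasCompactSupport

end Curve

/-! ### Signed Radon measures and their densities -/

namespace SignedRadonMeasure

variable {I : SignedRadonMeasure} {P : Measure (ℝ × ℝ)} {ψ : ℝ × ℝ → ℝ}

theorem isLocallyFiniteMeasure_totalVar (I : SignedRadonMeasure) :
    IsLocallyFiniteMeasure I.totalVar := by
  have := I.pos_locallyFinite
  have := I.neg_locallyFinite
  have : IsFiniteMeasureOnCompacts (I.pos + I.neg) := ⟨fun K hK => by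
    rw [Measure.add_apply]
    exact ENNReal.add_lt_top.2 ⟨hK.measure_lt_top, hK.measure_lt_top⟩⟩
  exact isLocallyFiniteMeasure_of_isFiniteMeasureOnCompacts (μ := I.pos + I.neg)

theorem AbsCont.left (h : I.AbsCont P) : I.pos ≪ P :=
  (Measure.absolutelyContinuous_of_le (Measure.le_add_right le_rfl)).trans h

theorem AbsCont.right (h : I.AbsCont P) : I.neg ≪ P :=
  (Measure.absolutelyContinuous_of_le (Measure.le_add_left le_rfl)).trans h

theorem measurable_density (I : SignedRadonMeasure) (P : Measure (ℝ × ℝ)) :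
    Measurable (I.density P) :=
  (Measure.measurable_rnDeriv _ _).ennreal_toReal.sub (Measure.measurable_rnDeriv _ _).ennreal_toReal

theorem locallyIntegrable_density (I : SignedRadonMeasure) (P : Measure (ℝ × ℝ)) :
    LocallyIntegrable (I.density P) P := by
  have := I.pos_locallyFinite
  have := I.neg_locallyFinite
  exact locallyIntegrable_iff.2 fun K hK => (Measure.integrableOn_toReal_rnDeriv
    hK.measure_lt_top.ne).sub (Measure.integrableOn_toReal_rnDeriv hK.measure_lt_top.ne)

theorem AbsCont.integrable_mul_density [IsLocallyFiniteMeasure P] (h : I.AbsCont P)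
    (hψ : Integrable ψ I.totalVar) : Integrable (fun z => ψ z * I.density P z) P := by
  have := I.pos_locallyFinite
  have := I.neg_locallyFinite
  obtain ⟨h1, h2⟩ := integrable_add_measure.1 hψ
  have := ((integrable_rnDeriv_smul_iff h.left).2 h1).sub
    ((integrable_rnDeriv_smul_iff h.right).2 h2)
  refine this.congr (ae_of_all _ fun z => ?_)
  simp only [Pi.sub_apply, smul_eq_mul, density]
  ring

theorem AbsCont.integral_eq [IsLocallyFiniteMeasure P] (h : I.AbsCont P)
    (hψ : Integrable ψ I.totalVar) : I.integral ψ = ∫ z, ψ z * I.density P z ∂P := by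
  have := I.pos_locallyFinite
  have := I.neg_locallyFinite
  obtain ⟨h1, h2⟩ := integrable_add_measure.1 hψ
  rw [integral, ← integral_rnDeriv_smul h.left, ← integral_rnDeriv_smul h.right,
    ← integral_sub ((integrable_rnDeriv_smul_iff h.left).2 h1)
      ((integrable_rnDeriv_smul_iff h.right).2 h2)]
  congr 1
  ext z
  simp only [smul_eq_mul, density]
  ring

/-- The signed Radon measure `V P`. -/
theorem exists_eq_withDensity (P : Measure (ℝ × ℝ)) [IsLocallyFiniteMeasure P] {V B : ℝ × ℝ → ℝ}
    (hV : Measurable V) (hB : Continuous B) (hVB : ∀ z, |V z| ≤ B z) :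
    ∃ I : SignedRadonMeasure, I.AbsCont P ∧ ∀ᵐ z ∂P, I.density P z = V z := by
  have hl : LocallyIntegrable V P :=
    locallyIntegrable_of_abs_le hV.aestronglyMeasurable hB (ae_of_all _ hVB)
  refine ⟨⟨P.withDensity fun z => ENNReal.ofReal (V z), P.withDensity fun z => ENNReal.ofReal (-V z),
    isLocallyFiniteMeasure_withDensity_ofReal hl, isLocallyFiniteMeasure_withDensity_ofReal hl.neg,
    withDensity_ofReal_mutuallySingular hV⟩, ?_, ?_⟩
  · exact Measure.AbsolutelyContinuous.add_left (withDensity_absolutelyContinuous _ _)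
      (withDensity_absolutelyContinuous _ _)
  · filter_upwards [Measure.rnDeriv_withDensity P hV.ennreal_ofReal,
      Measure.rnDeriv_withDensity P hV.neg.ennreal_ofReal] with z h1 h2
    simp only [density]
    simp only [Pi.neg_apply] at h2
    rw [h1, h2, ENNReal.toReal_ofReal', ENNReal.toReal_ofReal']
    rcases le_total 0 (V z) with h | h
    · rw [max_eq_left h, max_eq_right (by linarith)]; ring
    · rw [max_eq_right h, max_eq_left (by linarith)]; ring

end SignedRadonMeasure

/-! ### Densities and momentum fluxes relative to a sheet measure -/

section Sheet

variable {X : ℝ → ℝ × ℝ} {r : ℝ × ℝ → ℝ} {w : ℝ → ℝ} {I : SignedRadonMeasure}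

/-- A signed measure with a density on the plane and a density on a curve, whose velocity on the
curve is prescribed. -/
theorem SignedRadonMeasure.AbsCont.density_of_form (hX : IsClosedEmbedding X)
    (hX0 : volume (range X) = 0) (hr : Measurable r) (hr0 : ∀ᵐ z, 0 ≤ r z)
    (hrl : LocallyIntegrable r) (hw : Continuous w) (hw0 : ∀ l, 0 ≤ w l)
    (hI : I.AbsCont (sheetMeasure X r w)) {G : ℝ × ℝ → ℝ} (hG : LocallyIntegrable G) {k c : ℝ → ℝ}
    (hk : Continuous k) (hc : Continuous c)
    (hform : ∀ φ : ℝ × ℝ → ℝ, Continuous φ → HasCompactSupport φ →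
      I.integral φ = (∫ z, φ z * G z) + ∫ l, φ (X l) * k l)
    (hfol : ∀ᵐ z ∂(sheetMeasure X r w), ∀ l, z = X l → c l = I.density (sheetMeasure X r w) z) :
    (∀ l, k l = c l * w l) ∧ ∀ᵐ z, I.density (sheetMeasure X r w) z * r z = G z := by
  have lf := isLocallyFiniteMeasure_sheetMeasure hX hrl hw
  have lfI := I.isLocallyFiniteMeasure_totalVar
  set Dn := I.density (sheetMeasure X r w) with hDn
  have hDr : LocallyIntegrable fun z => Dn z * r z := locallyIntegrable_iff.2 fun K hK => by
    have h1 := (I.locallyIntegrable_density (sheetMeasure X r w)).integrableOn_isCompact hK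
    have hKm := hK.isClosed.measurableSet
    rw [← integrable_indicator_iff hKm,
      integrable_sheetMeasure hX hr hr0 hw.measurable hw0] at h1
    rw [← integrable_indicator_iff hKm]
    refine h1.1.congr (ae_of_all _ fun z => ?_)
    by_cases hz : z ∈ K <;> simp [hz, Dn]
  -- The velocity is prescribed only almost everywhere for the measure, hence on the curve only
  -- where `w ≠ 0`; after multiplication by `w` this restriction disappears.
  have hcurve : ∀ᵐ l, Dn (X l) * w l = c l * w l := by
    filter_upwards [((ae_sheetMeasure hX hr hr0 hw.measurable hw0).1 hfol).2] with l hl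
    by_cases h0 : w l = 0
    · simp [h0]
    · rw [hl h0 l rfl]
  -- The signed measure is expressed once through its density and once through the given form;
  -- uniqueness of the planar and curve densities compares the two.
  have key := eq_zero_of_integral_add_integral_curve hX hX0 (h := fun z => Dn z * r z - G z)
    (hDr.sub hG) (k := fun l => c l * w l - k l) ((hc.mul hw).sub hk) fun φ h1 h2 => by
    have hφ : Integrable φ I.totalVar := h1.integrable_of_hasCompactSupport h2
    have e1 := hI.integral_eq hφ
    have e2 := hI.integrable_mul_density hφ
    rw [integral_sheetMeasure hX hr hr0 hw.measurable hw0 e2, hform φ h1 h2] at e1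
    have e3 : ∫ l, φ (X l) * I.density (sheetMeasure X r w) (X l) * w l
        = ∫ l, φ (X l) * (c l * w l) := by
      refine integral_congr_ae (hcurve.mono fun l hl => ?_)
      simp only
      rw [mul_assoc, ← hDn, hl]
    have hφX := h2.comp_isClosedEmbedding hX
    have i1 : Integrable fun z => φ z * (Dn z * r z) := by
      simpa using hDr.integrable_smul_left_of_hasCompactSupport h1 h2
    have i2 : Integrable fun z => φ z * G z := by
      simpa using hG.integrable_smul_left_of_hasCompactSupport h1 h2
    have i3 : Integrable fun l => φ (X l) * (c l * w l) :=
      ((h1.comp hX.continuous).mul (hc.mul hw)).integrable_of_hasCompactSupport hφX.mul_right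
    have i4 : Integrable fun l => φ (X l) * k l :=
      ((h1.comp hX.continuous).mul hk).integrable_of_hasCompactSupport hφX.mul_right
    simp only [mul_sub]
    rw [integral_sub i1 i2, integral_sub i3 i4, ← e3]
    simp only [mul_assoc] at e1 ⊢
    rw [← hDn] at e1 ⊢
    linarith
  exact ⟨fun l => (sub_eq_zero.1 (key.1 l)).symm, key.2.mono fun z hz => sub_eq_zero.1 hz⟩

/-- The flux of momentum in terms of the densities. -/
theorem SignedRadonMeasure.AbsCont.integral_mul_velocity (hX : IsClosedEmbedding X)
    (hr : Measurable r) (hr0 : ∀ᵐ z, 0 ≤ r z)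
    (hrl : LocallyIntegrable r) (hw : Continuous w) (hw0 : ∀ l, 0 ≤ w l)
    (hI : I.AbsCont (sheetMeasure X r w)) {G H V : ℝ × ℝ → ℝ} {k c d : ℝ → ℝ}
    (hV : LocallyIntegrable V I.totalVar)
    (hfol : ∀ᵐ z ∂(sheetMeasure X r w), ∀ l, z = X l → c l = I.density (sheetMeasure X r w) z)
    (hfolV : ∀ᵐ z ∂(sheetMeasure X r w), ∀ l, z = X l → d l = V z)
    (hk : ∀ l, k l = c l * w l) (hG : ∀ᵐ z, I.density (sheetMeasure X r w) z * r z = G z)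
    (hH : ∀ᵐ z, V z * G z = H z) {ψ : ℝ × ℝ → ℝ} (hψ : Continuous ψ) (hψc : HasCompactSupport ψ) :
    I.integral (fun z => ψ z * V z) = (∫ z, ψ z * H z) + ∫ l, ψ (X l) * (d l * k l) := by
  have lf := isLocallyFiniteMeasure_sheetMeasure hX hrl hw
  have hφ : Integrable (fun z => ψ z * V z) I.totalVar := by
    simpa using hV.integrable_smul_left_of_hasCompactSupport hψ hψc
  rw [hI.integral_eq hφ, integral_sheetMeasure hX hr hr0 hw.measurable hw0
    (hI.integrable_mul_density hφ)]
  congr 1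
  · refine integral_congr_ae ?_
    filter_upwards [hG, hH] with z h1 h2
    rw [← h2, ← h1]
    ring
  · refine integral_congr_ae ?_
    filter_upwards [((ae_sheetMeasure hX hr hr0 hw.measurable hw0).1 hfol).2,
      ((ae_sheetMeasure hX hr hr0 hw.measurable hw0).1 hfolV).2] with l h1 h2
    rw [hk]
    by_cases h0 : w l = 0
    · simp [h0]
    · rw [h1 h0 l rfl, h2 h0 l rfl]
      ring

end Sheet

/-- The function that equals `mm` where `S ≤ 0` and `mp` where `S > 0`. -/
noncomputable def sides (S mm mp : ℝ × ℝ → ℝ) (z : ℝ × ℝ) : ℝ := mm z + (mp z - mm z) * heavi (S z)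

theorem sides_of_pos {S mm mp : ℝ × ℝ → ℝ} {z : ℝ × ℝ} (h : 0 < S z) : sides S mm mp z = mp z := by
  rw [sides, heavi_of_pos h]; ring

theorem sides_of_neg {S mm mp : ℝ × ℝ → ℝ} {z : ℝ × ℝ} (h : S z < 0) : sides S mm mp z = mm z := by
  rw [sides, heavi_of_nonpos h.le]; ring

theorem measurable_sides {S mm mp : ℝ × ℝ → ℝ} (hS : Measurable S) (hm : Continuous mm)
    (hp : Continuous mp) : Measurable (sides S mm mp) :=
  hm.measurable.add ((hp.measurable.sub hm.measurable).mul (measurable_heavi.comp hS))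

theorem abs_sides_le (S mm mp : ℝ × ℝ → ℝ) (z : ℝ × ℝ) :
    |sides S mm mp z| ≤ |mm z| + |mp z - mm z| := by
  refine (abs_add_le _ _).trans (add_le_add le_rfl ?_)
  rw [abs_mul]
  exact mul_le_of_le_one_right (abs_nonneg _) (abs_heavi_le_one _)

theorem locallyIntegrable_sides {S mm mp : ℝ × ℝ → ℝ} (hS : Measurable S) (hm : Continuous mm)
    (hp : Continuous mp) : LocallyIntegrable (sides S mm mp) :=
  locallyIntegrable_of_abs_le (B := fun z => |mm z| + |mp z - mm z|)
    (measurable_sides hS hm hp).aestronglyMeasurable (by fun_prop)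
    (ae_of_all _ (abs_sides_le S mm mp))

/-! ### Solutions of the given form at a fixed time -/

namespace ShockFront

variable {F : ShockFront} {T : EReal} {D : CauchyData}

/-- The properties, at the single time `t`, of the solutions of the form considered. -/
structure IsSheetAt (F : ShockFront) (t : ℝ) (P : Measure (ℝ × ℝ)) (I J : SignedRadonMeasure) :
    Prop where
  radon : IsLocallyFiniteMeasure P
  absCont_I : I.AbsCont P
  absCont_J : J.AbsCont P
  locallyIntegrable_II : LocallyIntegrable (I.density P) I.totalVar
  locallyIntegrable_JI : LocallyIntegrable (J.density P) I.totalVar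
  locallyIntegrable_IJ : LocallyIntegrable (I.density P) J.totalVar
  locallyIntegrable_JJ : LocallyIntegrable (J.density P) J.totalVar
  form : ∀ φ : ℝ × ℝ → ℝ, Continuous φ → HasCompactSupport φ →
    (∫ z, φ z ∂P) = F.action (F.minus.rho t) (F.plus.rho t) (F.Pt t) t φ ∧
    I.integral φ = F.action (fun z => F.minus.rho t z * F.minus.u t z)
      (fun z => F.plus.rho t z * F.plus.u t z) (F.It t) t φ ∧
    J.integral φ = F.action (fun z => F.minus.rho t z * F.minus.v t z)
      (fun z => F.plus.rho t z * F.plus.v t z) (F.Jt t) t φ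
  follows : ∀ᵐ z ∂P, ∀ l, z = (F.xs t l, F.ys t l) →
    deriv (fun s => F.xs s l) t = I.density P z ∧ deriv (fun s => F.ys s l) t = J.density P z

/-- What the solution at time `t` satisfies besides its form. -/
structure IsSheetRelationAt (F : ShockFront) (t : ℝ) (P : Measure (ℝ × ℝ))
    (I J : SignedRadonMeasure) : Prop where
  It_eq : ∀ l, F.It t l = deriv (fun s => F.xs s l) t * F.Pt t l
  Jt_eq : ∀ l, F.Jt t l = deriv (fun s => F.ys s l) t * F.Pt t l
  flux_II : ∀ ψ : ℝ × ℝ → ℝ, Continuous ψ → HasCompactSupport ψ →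
    I.integral (fun z => ψ z * I.density P z) =
      F.action (fun z => F.minus.rho t z * F.minus.u t z ^ 2)
        (fun z => F.plus.rho t z * F.plus.u t z ^ 2)
        (fun l => deriv (fun s => F.xs s l) t * F.It t l) t ψ
  flux_IJ : ∀ ψ : ℝ × ℝ → ℝ, Continuous ψ → HasCompactSupport ψ →
    I.integral (fun z => ψ z * J.density P z) =
      F.action (fun z => F.minus.rho t z * F.minus.u t z * F.minus.v t z)
        (fun z => F.plus.rho t z * F.plus.u t z * F.plus.v t z)
        (fun l => deriv (fun s => F.ys s l) t * F.It t l) t ψ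
  flux_JI : ∀ ψ : ℝ × ℝ → ℝ, Continuous ψ → HasCompactSupport ψ →
    J.integral (fun z => ψ z * I.density P z) =
      F.action (fun z => F.minus.rho t z * F.minus.u t z * F.minus.v t z)
        (fun z => F.plus.rho t z * F.plus.u t z * F.plus.v t z)
        (fun l => deriv (fun s => F.xs s l) t * F.Jt t l) t ψ
  flux_JJ : ∀ ψ : ℝ × ℝ → ℝ, Continuous ψ → HasCompactSupport ψ →
    J.integral (fun z => ψ z * J.density P z) =
      F.action (fun z => F.minus.rho t z * F.minus.v t z ^ 2)
        (fun z => F.plus.rho t z * F.plus.v t z ^ 2)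
        (fun l => deriv (fun s => F.ys s l) t * F.Jt t l) t ψ

theorem IsFrontFor.ae_sides (hF : F.IsFrontFor T D) {t : ℝ} (ht : t ∈ timeIco T) :
    ∀ᵐ z, F.S t z < 0 ∨ 0 < F.S t z := by
  have hne : ∀ᵐ z, F.S t z ≠ 0 := by
    rw [ae_iff]; simpa using hF.volume_surface ht
  exact hne.mono fun z hz => lt_or_gt_of_ne hz

theorem IsFrontFor.volume_range (hF : F.IsFrontFor T D) {t : ℝ} (ht : t ∈ timeIco T) :
    volume (range fun l => (F.xs t l, F.ys t l)) = 0 :=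
  volume_range_curve_eq_zero (hF.xs_smooth.slab_slice ht) (hF.ys_smooth.slab_slice ht)

theorem IsFrontFor.rho_nonneg (hT : 0 < T) (hD : D.IsAdmissible) (hF : F.IsFrontFor T D) {t : ℝ}
    (ht : t ∈ timeIoo T) :
    ∀ᵐ z, 0 ≤ sides (F.S t) (F.minus.rho t) (F.plus.rho t) z := by
  refine (hF.ae_sides (timeIoo_subset_timeIco T ht)).mono fun z hz => ?_
  rcases hz with h | h
  · rw [sides_of_neg h]
    exact (hF.minusSide hT hD).rho_nonneg ht (by simpa using h)
  · rw [sides_of_pos h]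
    exact (hF.plusSide hT hD).rho_nonneg ht (by simpa using h)

theorem IsFrontFor.continuous_velocity (hF : F.IsFrontFor T D) {t : ℝ} (ht : t ∈ timeIoo T) :
    (Continuous fun l => deriv (fun s => F.xs s l) t) ∧
      Continuous fun l => deriv (fun s => F.ys s l) t :=
  ⟨(continuousOn_deriv_timeSlice (isOpen_timeIoo T) hF.xs_smooth.timeIoo).slab_slice
    (k := fun t l => deriv (fun s => F.xs s l) t) ht,
  (continuousOn_deriv_timeSlice (isOpen_timeIoo T) hF.ys_smooth.timeIoo).slab_slice
    (k := fun t l => deriv (fun s => F.ys s l) t) ht⟩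

/-- The form identifies `P` as a sheet measure, and uniqueness of densities gives the momentum on
the front and the products of velocity and mass density off it. The quadratic fluxes follow without
dividing by the density: for instance $V\varrho u=u\,(V\varrho)=\varrho uv$ when $V\varrho=\varrho
v$. -/
theorem IsSheetAt.relation {t : ℝ} {P : Measure (ℝ × ℝ)} {I J : SignedRadonMeasure}
    (h : F.IsSheetAt t P I J) (hT : 0 < T) (hD : D.IsAdmissible) (hF : F.IsFrontFor T D)
    (ht : t ∈ timeIoo T) : F.IsSheetRelationAt t P I J := by
  have ht' := timeIoo_subset_timeIco T ht
  have hX := hF.isClosedEmbedding ht'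
  have hX0 := hF.volume_range ht'
  have cS : Measurable (F.S t) := (hF.S_smooth.continuousOn.slab_slice ht').measurable
  have rm := hF.field_minus.rho_smooth.continuousOn.slab_slice ht'
  have um := hF.field_minus.u_smooth.continuousOn.slab_slice ht'
  have vm := hF.field_minus.v_smooth.continuousOn.slab_slice ht'
  have rp := hF.field_plus.rho_smooth.continuousOn.slab_slice ht'
  have up := hF.field_plus.u_smooth.continuousOn.slab_slice ht'
  have vp := hF.field_plus.v_smooth.continuousOn.slab_slice ht'
  have cP := hF.Pt_smooth.continuousOn.slab_slice ht'
  have cI := hF.It_smooth.continuousOn.slab_slice ht'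
  have cJ := hF.Jt_smooth.continuousOn.slab_slice ht'
  obtain ⟨cx, cy⟩ := hF.continuous_velocity ht
  have hr := measurable_sides cS rm rp
  have hr0 := hF.rho_nonneg hT hD ht
  have hrl := locallyIntegrable_sides cS rm rp
  have := h.radon
  obtain ⟨hw0, rfl⟩ := eq_sheetMeasure hX hX0 hr hr0 hrl cP
    fun φ h1 h2 => (h.form φ h1 h2).1
  have folI := h.follows.mono fun z hz l hl => (hz l hl).1
  have folJ := h.follows.mono fun z hz l hl => (hz l hl).2
  obtain ⟨kI, gI⟩ := h.absCont_I.density_of_form hX hX0 hr hr0 hrl cP hw0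
    (locallyIntegrable_sides cS (rm.mul um) (rp.mul up)) cI cx
    (fun φ h1 h2 => (h.form φ h1 h2).2.1) folI
  obtain ⟨kJ, gJ⟩ := h.absCont_J.density_of_form hX hX0 hr hr0 hrl cP hw0
    (locallyIntegrable_sides cS (rm.mul vm) (rp.mul vp)) cJ cy
    (fun φ h1 h2 => (h.form φ h1 h2).2.2) folJ
  have hne := hF.ae_sides ht'
  refine ⟨kI, kJ, fun ψ h1 h2 => ?_, fun ψ h1 h2 => ?_, fun ψ h1 h2 => ?_, fun ψ h1 h2 => ?_⟩
  · refine h.absCont_I.integral_mul_velocity hX hr hr0 hrl cP hw0 h.locallyIntegrable_II folI folI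
      kI gI ?_ h1 h2
    filter_upwards [gI, hne] with z hz hs
    rcases hs with hs | hs
    · rw [sides_of_neg hs, sides_of_neg hs] at hz
      rw [sides_of_neg hs, heavi_of_nonpos hs.le]
      simp only [Pi.mul_apply] at hz ⊢
      linear_combination F.minus.u t z * hz
    · rw [sides_of_pos hs, sides_of_pos hs] at hz
      rw [sides_of_pos hs, heavi_of_pos hs]
      simp only [Pi.mul_apply] at hz ⊢
      linear_combination F.plus.u t z * hz
  · refine h.absCont_I.integral_mul_velocity hX hr hr0 hrl cP hw0 h.locallyIntegrable_JI folI folJ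
      kI gI ?_ h1 h2
    filter_upwards [gJ, hne] with z hz hs
    rcases hs with hs | hs
    · rw [sides_of_neg hs, sides_of_neg hs] at hz
      rw [sides_of_neg hs, heavi_of_nonpos hs.le]
      simp only [Pi.mul_apply] at hz ⊢
      linear_combination F.minus.u t z * hz
    · rw [sides_of_pos hs, sides_of_pos hs] at hz
      rw [sides_of_pos hs, heavi_of_pos hs]
      simp only [Pi.mul_apply] at hz ⊢
      linear_combination F.plus.u t z * hz
  · refine h.absCont_J.integral_mul_velocity hX hr hr0 hrl cP hw0 h.locallyIntegrable_IJ folJ folI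
      kJ gJ ?_ h1 h2
    filter_upwards [gI, hne] with z hz hs
    rcases hs with hs | hs
    · rw [sides_of_neg hs, sides_of_neg hs] at hz
      rw [sides_of_neg hs, heavi_of_nonpos hs.le]
      simp only [Pi.mul_apply] at hz ⊢
      linear_combination F.minus.v t z * hz
    · rw [sides_of_pos hs, sides_of_pos hs] at hz
      rw [sides_of_pos hs, heavi_of_pos hs]
      simp only [Pi.mul_apply] at hz ⊢
      linear_combination F.plus.v t z * hz
  · refine h.absCont_J.integral_mul_velocity hX hr hr0 hrl cP hw0 h.locallyIntegrable_JJ folJ folJ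
      kJ gJ ?_ h1 h2
    filter_upwards [gJ, hne] with z hz hs
    rcases hs with hs | hs
    · rw [sides_of_neg hs, sides_of_neg hs] at hz
      rw [sides_of_neg hs, heavi_of_nonpos hs.le]
      simp only [Pi.mul_apply] at hz ⊢
      linear_combination F.minus.v t z * hz
    · rw [sides_of_pos hs, sides_of_pos hs] at hz
      rw [sides_of_pos hs, heavi_of_pos hs]
      simp only [Pi.mul_apply] at hz ⊢
      linear_combination F.plus.v t z * hz

/-- A measurable velocity with given values on the sides of the front and on the front. -/
theorem IsFrontFor.exists_velocity (hF : F.IsFrontFor T D) {t : ℝ} (ht : t ∈ timeIco T)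
    {um up : ℝ × ℝ → ℝ} (hm : Continuous um) (hp : Continuous up) {c : ℝ → ℝ} (hc : Continuous c) :
    ∃ V B : ℝ × ℝ → ℝ, Measurable V ∧ Continuous B ∧ (∀ z, |V z| ≤ B z) ∧
      (∀ l, V (F.xs t l, F.ys t l) = c l) ∧ (∀ z, F.S t z < 0 → V z = um z) ∧
      ∀ z, 0 < F.S t z → V z = up z := by
  -- Tietze extension from the closed curve. It gives a function on the plane with the prescribed
  -- values on the front and, with the side fields, a continuous bound for the glued velocity.
  obtain ⟨e, he⟩ := ContinuousMap.exists_extension (hF.isClosedEmbedding ht) ⟨c, hc⟩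
  have cS : Measurable (F.S t) := (hF.S_smooth.continuousOn.slab_slice ht).measurable
  classical
  refine ⟨fun z => if F.S t z = 0 then e z else sides (F.S t) um up z,
    fun z => |e z| + (|um z| + |up z - um z|), ?_, by fun_prop, fun z => ?_, fun l => ?_,
    fun z hz => ?_, fun z hz => ?_⟩
  · exact Measurable.ite (cS (measurableSet_singleton 0)) e.continuous.measurable
      (measurable_sides cS hm hp)
  · have h1 := abs_nonneg (e z)
    have h2 := abs_sides_le (F.S t) um up z
    have h3 : 0 ≤ |um z| + |up z - um z| := by positivity
    beta_reduce
    split_ifs <;> linarith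
  · beta_reduce
    rw [if_pos ((hF.surface t ht _).2 ⟨l, rfl⟩)]
    exact DFunLike.congr_fun he l
  · beta_reduce
    rw [if_neg hz.ne, sides_of_neg hz]
  · beta_reduce
    rw [if_neg hz.ne', sides_of_pos hz]

/-- The measure is `V P` for the glued velocity `V`. The relation `k = c * Pt` makes its sheet part
the prescribed one, and the bound `B` later yields local integrability of the velocities. -/
theorem IsFrontFor.exists_momentum (hT : 0 < T) (hD : D.IsAdmissible) (hF : F.IsFrontFor T D)
    {t : ℝ} (ht : t ∈ timeIoo T) (hP : ∀ l, 0 ≤ F.Pt t l) {um up : ℝ × ℝ → ℝ}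
    (hm : Continuous um) (hp : Continuous up) {c k : ℝ → ℝ} (hc : Continuous c)
    (hk : ∀ l, k l = c l * F.Pt t l) {P : Measure (ℝ × ℝ)}
    (hPs : P = sheetMeasure (fun l => (F.xs t l, F.ys t l))
      (sides (F.S t) (F.minus.rho t) (F.plus.rho t)) (F.Pt t)) :
    ∃ (I : SignedRadonMeasure) (B : ℝ × ℝ → ℝ), I.AbsCont P ∧ Continuous B ∧
      (∀ᵐ z ∂P, |I.density P z| ≤ B z) ∧
      (∀ᵐ z ∂P, ∀ l, z = (F.xs t l, F.ys t l) → c l = I.density P z) ∧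
      ∀ φ : ℝ × ℝ → ℝ, Continuous φ → HasCompactSupport φ →
        I.integral φ = F.action (fun z => F.minus.rho t z * um z)
          (fun z => F.plus.rho t z * up z) k t φ := by
  have ht' := timeIoo_subset_timeIco T ht
  have hX := hF.isClosedEmbedding ht'
  have cS : Measurable (F.S t) := (hF.S_smooth.continuousOn.slab_slice ht').measurable
  have rm := hF.field_minus.rho_smooth.continuousOn.slab_slice ht'
  have rp := hF.field_plus.rho_smooth.continuousOn.slab_slice ht'
  have cP := hF.Pt_smooth.continuousOn.slab_slice ht'
  have hr := measurable_sides cS rm rp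
  have hr0 := hF.rho_nonneg hT hD ht
  have hrl := locallyIntegrable_sides cS rm rp
  have lf : IsLocallyFiniteMeasure P := by
    rw [hPs]; exact isLocallyFiniteMeasure_sheetMeasure hX hrl cP
  obtain ⟨V, B, mV, cB, hVB, hVX, hVm, hVp⟩ := hF.exists_velocity ht' hm hp hc
  obtain ⟨I, hI, hV⟩ := SignedRadonMeasure.exists_eq_withDensity P mV cB hVB
  refine ⟨I, B, hI, cB, ?_, ?_, fun φ h1 h2 => ?_⟩
  · filter_upwards [hV] with z hz
    rw [hz]; exact hVB z
  · filter_upwards [hV] with z hz l hl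
    rw [hz, hl, hVX]
  · have lfI := I.isLocallyFiniteMeasure_totalVar
    have hφ : Integrable φ I.totalVar := h1.integrable_of_hasCompactSupport h2
    have e1 : ∀ᵐ z ∂P, φ z * I.density P z = φ z * V z := hV.mono fun z hz => by rw [hz]
    have e2 : Integrable (fun z => φ z * V z) P := (hI.integrable_mul_density hφ).congr e1
    rw [hI.integral_eq hφ, integral_congr_ae e1]
    rw [hPs] at e2 ⊢
    rw [integral_sheetMeasure hX hr hr0 cP.measurable hP e2, action]
    congr 1
    · refine integral_congr_ae ?_
      filter_upwards [hF.ae_sides ht'] with z hs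
      rcases hs with hs | hs
      · rw [sides_of_neg hs, heavi_of_nonpos hs.le, hVm z hs]; ring
      · rw [sides_of_pos hs, heavi_of_pos hs, hVp z hs]; ring
    · congr 1
      ext l
      rw [hVX, hk]; ring

theorem IsFrontFor.exists_isSheetAt (hT : 0 < T) (hD : D.IsAdmissible) (hF : F.IsFrontFor T D)
    {t : ℝ} (ht : t ∈ timeIoo T) (hP : ∀ l, 0 ≤ F.Pt t l)
    (hI : ∀ l, F.It t l = deriv (fun s => F.xs s l) t * F.Pt t l)
    (hJ : ∀ l, F.Jt t l = deriv (fun s => F.ys s l) t * F.Pt t l) :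
    ∃ (P : Measure (ℝ × ℝ)) (I J : SignedRadonMeasure), F.IsSheetAt t P I J := by
  have ht' := timeIoo_subset_timeIco T ht
  have hX := hF.isClosedEmbedding ht'
  have cS : Measurable (F.S t) := (hF.S_smooth.continuousOn.slab_slice ht').measurable
  have rm := hF.field_minus.rho_smooth.continuousOn.slab_slice ht'
  have rp := hF.field_plus.rho_smooth.continuousOn.slab_slice ht'
  have cP := hF.Pt_smooth.continuousOn.slab_slice ht'
  obtain ⟨cx, cy⟩ := hF.continuous_velocity ht
  obtain ⟨P, hPs⟩ : ∃ P, P = sheetMeasure (fun l => (F.xs t l, F.ys t l))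
      (sides (F.S t) (F.minus.rho t) (F.plus.rho t)) (F.Pt t) := ⟨_, rfl⟩
  have lf : IsLocallyFiniteMeasure P := by
    rw [hPs]
    exact isLocallyFiniteMeasure_sheetMeasure hX (locallyIntegrable_sides cS rm rp) cP
  obtain ⟨I, B, I1, I2, I3, I4, I5⟩ := hF.exists_momentum hT hD ht hP
    (hF.field_minus.u_smooth.continuousOn.slab_slice ht')
    (hF.field_plus.u_smooth.continuousOn.slab_slice ht') cx hI hPs
  obtain ⟨J, B', J1, J2, J3, J4, J5⟩ := hF.exists_momentum hT hD ht hP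
    (hF.field_minus.v_smooth.continuousOn.slab_slice ht')
    (hF.field_plus.v_smooth.continuousOn.slab_slice ht') cy hJ hPs
  have lfI := I.isLocallyFiniteMeasure_totalVar
  have lfJ := J.isLocallyFiniteMeasure_totalVar
  have mI := (I.measurable_density P).aestronglyMeasurable (μ := I.totalVar)
  have mI' := (I.measurable_density P).aestronglyMeasurable (μ := J.totalVar)
  have mJ := (J.measurable_density P).aestronglyMeasurable (μ := I.totalVar)
  have mJ' := (J.measurable_density P).aestronglyMeasurable (μ := J.totalVar)
  refine ⟨P, I, J, lf, I1, J1, locallyIntegrable_of_abs_le mI I2 (I3.filter_mono I1.ae_le),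
    locallyIntegrable_of_abs_le mJ J2 (J3.filter_mono I1.ae_le), locallyIntegrable_of_abs_le mI' I2 (I3.filter_mono J1.ae_le),
    locallyIntegrable_of_abs_le mJ' J2 (J3.filter_mono J1.ae_le), fun φ h1 h2 => ⟨?_, I5 φ h1 h2, J5 φ h1 h2⟩, ?_⟩
  · have hφ : Integrable φ P := h1.integrable_of_hasCompactSupport h2
    rw [hPs] at hφ ⊢
    rw [integral_sheetMeasure hX (measurable_sides cS rm rp) (hF.rho_nonneg hT hD ht)
      cP.measurable hP hφ]
    rfl
  · filter_upwards [I4, J4] with z h1 h2 l hl using ⟨h1 l hl, h2 l hl⟩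

end ShockFront

/-! ### The two implications -/

namespace ShockFront

variable {F : ShockFront} {T : EReal} {D : CauchyData}

section SolutionToFront

variable {P : ℝ → Measure (ℝ × ℝ)} {I J : ℝ → SignedRadonMeasure}

theorem ae_isSheetAt (hsol : IsGeneralizedSolution T D.rho0 D.u0 D.v0 P I J)
    (hform : F.HasForm T P I J) (hfol : F.FollowsVelocity T P I J) :
    ∀ᵐ t : ℝ, t ∈ timeIoo T → F.IsSheetAt t (P t) (I t) (J t) := by
  filter_upwards [hsol.absCont, hsol.locallyIntegrable_I, hsol.locallyIntegrable_J, hfol]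
    with t h1 h2 h3 h4 ht
  exact ⟨hsol.radon t ht, (h1 ht).1, (h1 ht).2, (h2 ht).1, (h2 ht).2, (h3 ht).1, (h3 ht).2,
    hform t ht, h4 ht⟩

/-- A relation between continuous functions that holds at almost every time holds at every time. -/
theorem eq_of_ae_timeIoo {f g : ℝ → ℝ} (hf : ContinuousOn f (timeIoo T))
    (hg : ContinuousOn g (timeIoo T)) (h : ∀ᵐ t : ℝ, t ∈ timeIoo T → f t = g t) :
    ∀ t ∈ timeIoo T, f t = g t :=
  Measure.eqOn_open_of_ae_eq ((ae_restrict_iff' (isOpen_timeIoo T).measurableSet).2 h)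
    (isOpen_timeIoo T) hf hg

theorem intervalIntegral_congr_timeIoo {f g : ℝ → ℝ} {t₁ t₂ : ℝ} (ht₁ : t₁ ∈ timeIoo T)
    (ht₂ : t₂ ∈ timeIoo T) (hlt : t₁ < t₂) (h : ∀ᵐ t : ℝ, t ∈ timeIoo T → f t = g t) :
    ∫ τ in t₁..t₂, f τ = ∫ τ in t₁..t₂, g τ := by
  refine intervalIntegral.integral_congr_ae (h.mono fun τ hτ hm => hτ ?_)
  rw [uIoc_of_le hlt.le] at hm
  exact mem_timeIoo_of_le (timeIoo_subset_timeIco T ht₂) (ht₁.1.trans hm.1) hm.2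

/-- The fixed-time relations hold for almost every `t`. They identify the fluxes in the balance
laws, so each surface density has the net flux as its time derivative, and the initial condition
makes it start from zero. -/
theorem rankineHugoniot_of_solution (hT : 0 < T) (hD : D.IsAdmissible) (hF : F.IsFrontFor T D)
    (hsol : IsGeneralizedSolution T D.rho0 D.u0 D.v0 P I J)
    (hform : F.HasForm T P I J) (hfol : F.FollowsVelocity T P I J) :
    (∀ t ∈ timeIoo T, ∀ l, F.Pt t l ≠ 0 ∧
      deriv (fun s => F.xs s l) t = F.It t l / F.Pt t l ∧
      deriv (fun s => F.ys s l) t = F.Jt t l / F.Pt t l) ∧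
    (∀ t ∈ timeIco T, ∀ l,
      F.Pt t l = F.influx D.rho0 t l ∧
      F.It t l = F.influx (fun z => D.rho0 z * D.u0 z) t l ∧
      F.Jt t l = F.influx (fun z => D.rho0 z * D.v0 z) t l) := by
  have hJ := isOpen_timeIoo T
  have hrel : ∀ᵐ t : ℝ, t ∈ timeIoo T → F.IsSheetRelationAt t (P t) (I t) (J t) :=
    (ae_isSheetAt hsol hform hfol).mono fun t h ht => (h ht).relation hT hD hF ht
  -- For fixed `l` both sides are continuous in time, so the almost-everywhere relation holds for
  -- all times in the open interval.
  have hI : ∀ t ∈ timeIoo T, ∀ l, F.It t l = deriv (fun s => F.xs s l) t * F.Pt t l :=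
    fun t ht l => eq_of_ae_timeIoo (hF.It_smooth.continuousOn.timeIoo.slab_time l)
      (((continuousOn_deriv_timeSlice hJ hF.xs_smooth.timeIoo).slab_time
        (k := fun t l => deriv (fun s => F.xs s l) t) l).mul
        (hF.Pt_smooth.continuousOn.timeIoo.slab_time l))
      (hrel.mono fun t h ht => (h ht).It_eq l) t ht
  have hJ' : ∀ t ∈ timeIoo T, ∀ l, F.Jt t l = deriv (fun s => F.ys s l) t * F.Pt t l :=
    fun t ht l => eq_of_ae_timeIoo (hF.Jt_smooth.continuousOn.timeIoo.slab_time l)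
      (((continuousOn_deriv_timeSlice hJ hF.ys_smooth.timeIoo).slab_time
        (k := fun t l => deriv (fun s => F.ys s l) t) l).mul
        (hF.Pt_smooth.continuousOn.timeIoo.slab_time l))
      (hrel.mono fun t h ht => (h ht).Jt_eq l) t ht
  have sm := hF.field_minus
  have sp := hF.field_plus
  have near := timeIoo_mem_nhdsGT hT
  have hP0 : ∀ l, F.Pt 0 l = 0 := hF.eq_zero_of_tendsto hT sm.rho_smooth.continuousOn
    sp.rho_smooth.continuousOn hF.Pt_smooth.continuousOn (fun z hz => (hF.initial_minus hz).1)
    (fun z hz => (hF.initial_plus hz).1) fun φ h1 h2 => by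
      refine (hsol.initial_P φ h1 h2).congr' ?_
      filter_upwards [near] with t ht using (hform t ht φ h1 h2).1
  have hI0 : ∀ l, F.It 0 l = 0 := hF.eq_zero_of_tendsto hT
    (sm.rho_smooth.mul sm.u_smooth).continuousOn (sp.rho_smooth.mul sp.u_smooth).continuousOn
    (mm := fun t z => F.minus.rho t z * F.minus.u t z)
    (mp := fun t z => F.plus.rho t z * F.plus.u t z) hF.It_smooth.continuousOn
    (m₀ := fun z => D.rho0 z * D.u0 z)
    (fun z hz => by rw [(hF.initial_minus hz).1, (hF.initial_minus hz).2.1])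
    (fun z hz => by rw [(hF.initial_plus hz).1, (hF.initial_plus hz).2.1]) fun φ h1 h2 => by
      refine (hsol.initial_I φ h1 h2).congr' ?_
      filter_upwards [near] with t ht using (hform t ht φ h1 h2).2.1
  have hJ0 : ∀ l, F.Jt 0 l = 0 := hF.eq_zero_of_tendsto hT
    (sm.rho_smooth.mul sm.v_smooth).continuousOn (sp.rho_smooth.mul sp.v_smooth).continuousOn
    (mm := fun t z => F.minus.rho t z * F.minus.v t z)
    (mp := fun t z => F.plus.rho t z * F.plus.v t z) hF.Jt_smooth.continuousOn
    (m₀ := fun z => D.rho0 z * D.v0 z)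
    (fun z hz => by rw [(hF.initial_minus hz).1, (hF.initial_minus hz).2.2])
    (fun z hz => by rw [(hF.initial_plus hz).1, (hF.initial_plus hz).2.2]) fun φ h1 h2 => by
      refine (hsol.initial_J φ h1 h2).congr' ?_
      filter_upwards [near] with t ht using (hform t ht φ h1 h2).2.2
  have hPin : ∀ t ∈ timeIco T, ∀ l, F.Pt t l = F.influx D.rho0 t l := fun t ht l => by
    obtain ⟨Q, hQ, hin, -⟩ := hF.exists_balanced_mass hT hD
    rw [hin t ht l]
    refine hQ.eq_integral_of_balance hT hD hF hF.Pt_smooth hP0 (fun f hf hfc t₁ h1 t₂ h2 hlt => ?_)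
      ht l
    rw [← (hform t₁ h1 f hf.continuous hfc).1, ← (hform t₂ h2 f hf.continuous hfc).1,
      (hsol.mass f hf hfc t₁ h1 t₂ h2 hlt).2]
    refine intervalIntegral_congr_timeIoo h1 h2 hlt (ae_of_all _ fun τ hτ => ?_)
    -- The mass currents are `I` and `J` themselves; `hI` and `hJ'` write their sheet parts as the
    -- mass carried with the velocity of the front.
    rw [(hform τ hτ _ hf.continuous_partialX hfc.partialX).2.1,
      (hform τ hτ _ hf.continuous_partialY hfc.partialY).2.2, actionRate, funext (hI τ hτ),
      funext (hJ' τ hτ)]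
  refine ⟨fun t ht l => ?_, fun t ht l => ⟨hPin t ht l, ?_, ?_⟩⟩
  -- The quotients require the mass law first: the surface mass is the accumulated influx, which is
  -- positive.
  · have hne : F.Pt t l ≠ 0 := by
      rw [hPin t (timeIoo_subset_timeIco T ht) l]
      exact (hF.influx_rho0_pos hT hD ht l).ne'
    rw [hI t ht l, hJ' t ht l, mul_div_cancel_right₀ _ hne, mul_div_cancel_right₀ _ hne]
    exact ⟨hne, rfl, rfl⟩
  · obtain ⟨Q, hQ, hin⟩ := hF.exists_balanced_momentum_x hT hD
    rw [hin t ht l]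
    refine hQ.eq_integral_of_balance hT hD hF hF.It_smooth hI0 (fun f hf hfc t₁ h1 t₂ h2 hlt => ?_)
      ht l
    rw [← (hform t₁ h1 f hf.continuous hfc).2.1, ← (hform t₂ h2 f hf.continuous hfc).2.1,
      (hsol.momentum_x f hf hfc t₁ h1 t₂ h2 hlt).2]
    refine intervalIntegral_congr_timeIoo h1 h2 hlt (hrel.mono fun τ h hτ => ?_)
    rw [(h hτ).flux_II _ hf.continuous_partialX hfc.partialX,
      (h hτ).flux_IJ _ hf.continuous_partialY hfc.partialY, actionRate]
  · obtain ⟨Q, hQ, hin⟩ := hF.exists_balanced_momentum_y hT hD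
    rw [hin t ht l]
    refine hQ.eq_integral_of_balance hT hD hF hF.Jt_smooth hJ0 (fun f hf hfc t₁ h1 t₂ h2 hlt => ?_)
      ht l
    rw [← (hform t₁ h1 f hf.continuous hfc).2.2, ← (hform t₂ h2 f hf.continuous hfc).2.2,
      (hsol.momentum_y f hf hfc t₁ h1 t₂ h2 hlt).2]
    refine intervalIntegral_congr_timeIoo h1 h2 hlt (hrel.mono fun τ h hτ => ?_)
    rw [(h hτ).flux_JI _ hf.continuous_partialX hfc.partialX,
      (h hτ).flux_JJ _ hf.continuous_partialY hfc.partialY, actionRate]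

end SolutionToFront

theorem intervalIntegrable_congr_timeIoo {f g : ℝ → ℝ} {t₁ t₂ : ℝ} (ht₁ : t₁ ∈ timeIoo T)
    (ht₂ : t₂ ∈ timeIoo T) (hlt : t₁ < t₂) (h : ∀ t ∈ timeIoo T, f t = g t)
    (hf : IntervalIntegrable f volume t₁ t₂) : IntervalIntegrable g volume t₁ t₂ := by
  refine hf.congr fun τ hm => h τ ?_
  rw [uIoc_of_le hlt.le] at hm
  exact mem_timeIoo_of_le (timeIoo_subset_timeIco T ht₂) (ht₁.1.trans hm.1) hm.2

/-- Positivity of the accumulated mass makes the sheet a nonnegative measure. The measures can be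
chosen separately at each time, because every continuity and balance statement depends on them only
through the prescribed actions and the fluxes these determine. -/
theorem exists_solution_of_rankineHugoniot (hT : 0 < T) (hD : D.IsAdmissible)
    (hF : F.IsFrontFor T D)
    (hv : ∀ t ∈ timeIoo T, ∀ l, F.Pt t l ≠ 0 ∧
      deriv (fun s => F.xs s l) t = F.It t l / F.Pt t l ∧
      deriv (fun s => F.ys s l) t = F.Jt t l / F.Pt t l)
    (hin : ∀ t ∈ timeIco T, ∀ l,
      F.Pt t l = F.influx D.rho0 t l ∧
      F.It t l = F.influx (fun z => D.rho0 z * D.u0 z) t l ∧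
      F.Jt t l = F.influx (fun z => D.rho0 z * D.v0 z) t l) :
    ∃ (P : ℝ → Measure (ℝ × ℝ)) (I J : ℝ → SignedRadonMeasure),
      IsGeneralizedSolution T D.rho0 D.u0 D.v0 P I J ∧
      F.HasForm T P I J ∧ F.FollowsVelocity T P I J := by
  have hI : ∀ t ∈ timeIoo T, ∀ l, F.It t l = deriv (fun s => F.xs s l) t * F.Pt t l :=
    fun t ht l => by rw [(hv t ht l).2.1, div_mul_cancel₀ _ (hv t ht l).1]
  have hJ : ∀ t ∈ timeIoo T, ∀ l, F.Jt t l = deriv (fun s => F.ys s l) t * F.Pt t l :=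
    fun t ht l => by rw [(hv t ht l).2.2, div_mul_cancel₀ _ (hv t ht l).1]
  have hex : ∀ t, ∃ (P : Measure (ℝ × ℝ)) (I J : SignedRadonMeasure),
      t ∈ timeIoo T → F.IsSheetAt t P I J := by
    intro t
    by_cases ht : t ∈ timeIoo T
    · obtain ⟨P, I, J, h⟩ := hF.exists_isSheetAt hT hD ht (fun l => by
        rw [(hin t (timeIoo_subset_timeIco T ht) l).1]
        exact (hF.influx_rho0_pos hT hD ht l).le) (hI t ht) (hJ t ht)
      exact ⟨P, I, J, fun _ => h⟩
    -- Nothing is required outside the time interval, so zero measures serve there.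
    · let Z : SignedRadonMeasure := ⟨0, 0, inferInstance, inferInstance, .zero_left⟩
      exact ⟨0, Z, Z, fun h => absurd h ht⟩
  choose P I J hS using hex
  have hrel : ∀ t ∈ timeIoo T, F.IsSheetRelationAt t (P t) (I t) (J t) :=
    fun t ht => (hS t ht).relation hT hD hF ht
  have hform : F.HasForm T P I J := fun t ht => (hS t ht).form
  have sm := hF.field_minus
  have sp := hF.field_plus
  have near := timeIoo_mem_nhdsGT hT
  have h0 := zero_mem_timeIco hT
  have influx_zero : ∀ w l, F.influx w 0 l = 0 := fun w l => intervalIntegral.integral_same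
  have sub := timeIoo_subset_timeIco T
  refine ⟨P, I, J, ?_, hform, ae_of_all _ fun t ht => (hS t ht).follows⟩
  refine
    { radon := fun t ht => (hS t ht).radon
      weakCont_P := fun φ h1 h2 => ?_
      weakCont_I := fun φ h1 h2 => ?_
      weakCont_J := fun φ h1 h2 => ?_
      absCont := ae_of_all _ fun t ht => ⟨(hS t ht).absCont_I, (hS t ht).absCont_J⟩
      locallyIntegrable_I := ae_of_all _ fun t ht =>
        ⟨(hS t ht).locallyIntegrable_II, (hS t ht).locallyIntegrable_JI⟩
      locallyIntegrable_J := ae_of_all _ fun t ht =>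
        ⟨(hS t ht).locallyIntegrable_IJ, (hS t ht).locallyIntegrable_JJ⟩
      mass := fun f hf hfc t₁ h1 t₂ h2 hlt => ?_
      momentum_x := fun f hf hfc t₁ h1 t₂ h2 hlt => ?_
      momentum_y := fun f hf hfc t₁ h1 t₂ h2 hlt => ?_
      initial_P := fun φ h1 h2 => ?_
      initial_I := fun φ h1 h2 => ?_
      initial_J := fun φ h1 h2 => ?_ }
  · exact ((hF.continuousOn_action sm.rho_smooth.continuousOn sp.rho_smooth.continuousOn
      hF.Pt_smooth.continuousOn h1 h2).mono sub).congr fun t ht => (hform t ht φ h1 h2).1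
  · exact ((hF.continuousOn_action (mm := fun t z => F.minus.rho t z * F.minus.u t z)
      (mp := fun t z => F.plus.rho t z * F.plus.u t z)
      (sm.rho_smooth.mul sm.u_smooth).continuousOn (sp.rho_smooth.mul sp.u_smooth).continuousOn
      hF.It_smooth.continuousOn h1 h2).mono sub).congr fun t ht => (hform t ht φ h1 h2).2.1
  · exact ((hF.continuousOn_action (mm := fun t z => F.minus.rho t z * F.minus.v t z)
      (mp := fun t z => F.plus.rho t z * F.plus.v t z)
      (sm.rho_smooth.mul sm.v_smooth).continuousOn (sp.rho_smooth.mul sp.v_smooth).continuousOn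
      hF.Jt_smooth.continuousOn h1 h2).mono sub).congr fun t ht => (hform t ht φ h1 h2).2.2
  · obtain ⟨Q, hQ, hQin, -⟩ := hF.exists_balanced_mass hT hD
    obtain ⟨b1, b2⟩ := hQ.balance_of_eq_integral hT hD hF hF.Pt_smooth
      (fun t ht l => by rw [(hin t ht l).1, hQin t ht l]) hf hfc h1 h2 hlt
    have e : ∀ τ ∈ timeIoo T, F.actionRate (fun t z => F.minus.rho t z * F.minus.u t z)
        (fun t z => F.plus.rho t z * F.plus.u t z) (fun t z => F.minus.rho t z * F.minus.v t z)
        (fun t z => F.plus.rho t z * F.plus.v t z) F.Pt f τ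
        = (I τ).integral (partialX f) + (J τ).integral (partialY f) := fun τ hτ => by
      rw [(hform τ hτ _ hf.continuous_partialX hfc.partialX).2.1,
        (hform τ hτ _ hf.continuous_partialY hfc.partialY).2.2, actionRate, funext (hI τ hτ),
        funext (hJ τ hτ)]
    refine ⟨intervalIntegrable_congr_timeIoo h1 h2 hlt e b1, ?_⟩
    rw [(hform t₁ h1 f hf.continuous hfc).1, (hform t₂ h2 f hf.continuous hfc).1, b2]
    exact intervalIntegral_congr_timeIoo h1 h2 hlt (ae_of_all _ e)
  · obtain ⟨Q, hQ, hQin⟩ := hF.exists_balanced_momentum_x hT hD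
    obtain ⟨b1, b2⟩ := hQ.balance_of_eq_integral hT hD hF hF.It_smooth
      (fun t ht l => by rw [(hin t ht l).2.1, hQin t ht l]) hf hfc h1 h2 hlt
    have e : ∀ τ ∈ timeIoo T, F.actionRate (fun t z => F.minus.rho t z * F.minus.u t z ^ 2)
        (fun t z => F.plus.rho t z * F.plus.u t z ^ 2)
        (fun t z => F.minus.rho t z * F.minus.u t z * F.minus.v t z)
        (fun t z => F.plus.rho t z * F.plus.u t z * F.plus.v t z) F.It f τ
        = (I τ).integral (fun z => partialX f z * (I τ).density (P τ) z)
          + (I τ).integral (fun z => partialY f z * (J τ).density (P τ) z) := fun τ hτ => by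
      rw [(hrel τ hτ).flux_II _ hf.continuous_partialX hfc.partialX,
        (hrel τ hτ).flux_IJ _ hf.continuous_partialY hfc.partialY, actionRate]
    refine ⟨intervalIntegrable_congr_timeIoo h1 h2 hlt e b1, ?_⟩
    rw [(hform t₁ h1 f hf.continuous hfc).2.1, (hform t₂ h2 f hf.continuous hfc).2.1, b2]
    exact intervalIntegral_congr_timeIoo h1 h2 hlt (ae_of_all _ e)
  · obtain ⟨Q, hQ, hQin⟩ := hF.exists_balanced_momentum_y hT hD
    obtain ⟨b1, b2⟩ := hQ.balance_of_eq_integral hT hD hF hF.Jt_smooth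
      (fun t ht l => by rw [(hin t ht l).2.2, hQin t ht l]) hf hfc h1 h2 hlt
    have e : ∀ τ ∈ timeIoo T, F.actionRate
        (fun t z => F.minus.rho t z * F.minus.u t z * F.minus.v t z)
        (fun t z => F.plus.rho t z * F.plus.u t z * F.plus.v t z)
        (fun t z => F.minus.rho t z * F.minus.v t z ^ 2)
        (fun t z => F.plus.rho t z * F.plus.v t z ^ 2) F.Jt f τ
        = (J τ).integral (fun z => partialX f z * (I τ).density (P τ) z)
          + (J τ).integral (fun z => partialY f z * (J τ).density (P τ) z) := fun τ hτ => by
      rw [(hrel τ hτ).flux_JI _ hf.continuous_partialX hfc.partialX,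
        (hrel τ hτ).flux_JJ _ hf.continuous_partialY hfc.partialY, actionRate]
    refine ⟨intervalIntegrable_congr_timeIoo h1 h2 hlt e b1, ?_⟩
    rw [(hform t₁ h1 f hf.continuous hfc).2.2, (hform t₂ h2 f hf.continuous hfc).2.2, b2]
    exact intervalIntegral_congr_timeIoo h1 h2 hlt (ae_of_all _ e)
  · refine (hF.tendsto_of_eq_zero hT sm.rho_smooth.continuousOn sp.rho_smooth.continuousOn
      hF.Pt_smooth.continuousOn (fun z hz => (hF.initial_minus hz).1)
      (fun z hz => (hF.initial_plus hz).1)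
      (fun l => by rw [(hin 0 h0 l).1, influx_zero]) h1 h2).congr' ?_
    filter_upwards [near] with t ht using (hform t ht φ h1 h2).1.symm
  · refine (hF.tendsto_of_eq_zero hT (mm := fun t z => F.minus.rho t z * F.minus.u t z)
      (mp := fun t z => F.plus.rho t z * F.plus.u t z) (m₀ := fun z => D.rho0 z * D.u0 z)
      (sm.rho_smooth.mul sm.u_smooth).continuousOn (sp.rho_smooth.mul sp.u_smooth).continuousOn
      hF.It_smooth.continuousOn
      (fun z hz => by rw [(hF.initial_minus hz).1, (hF.initial_minus hz).2.1])
      (fun z hz => by rw [(hF.initial_plus hz).1, (hF.initial_plus hz).2.1])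
      (fun l => by rw [(hin 0 h0 l).2.1, influx_zero]) h1 h2).congr' ?_
    filter_upwards [near] with t ht using (hform t ht φ h1 h2).2.1.symm
  · refine (hF.tendsto_of_eq_zero hT (mm := fun t z => F.minus.rho t z * F.minus.v t z)
      (mp := fun t z => F.plus.rho t z * F.plus.v t z) (m₀ := fun z => D.rho0 z * D.v0 z)
      (sm.rho_smooth.mul sm.v_smooth).continuousOn (sp.rho_smooth.mul sp.v_smooth).continuousOn
      hF.Jt_smooth.continuousOn
      (fun z hz => by rw [(hF.initial_minus hz).1, (hF.initial_minus hz).2.2])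
      (fun z hz => by rw [(hF.initial_plus hz).1, (hF.initial_plus hz).2.2])
      (fun l => by rw [(hin 0 h0 l).2.2, influx_zero]) h1 h2).congr' ?_
    filter_upwards [near] with t ht using (hform t ht φ h1 h2).2.2.symm

end ShockFront

theorem theorem2p1 (T : EReal) (hT : 0 < T) (D : CauchyData) (hD : D.IsAdmissible)
    (F : ShockFront) (hF : F.IsFrontFor T D) :
    (∃ (P : ℝ → Measure (ℝ × ℝ)) (I J : ℝ → SignedRadonMeasure),
      IsGeneralizedSolution T D.rho0 D.u0 D.v0 P I J ∧
      F.HasForm T P I J ∧ F.FollowsVelocity T P I J) ↔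
    ((∀ t ∈ timeIoo T, ∀ l, F.Pt t l ≠ 0 ∧
      deriv (fun s => F.xs s l) t = F.It t l / F.Pt t l ∧
      deriv (fun s => F.ys s l) t = F.Jt t l / F.Pt t l) ∧
    (∀ t ∈ timeIco T, ∀ l,
      F.Pt t l = F.influx D.rho0 t l ∧
      F.It t l = F.influx (fun z => D.rho0 z * D.u0 z) t l ∧
      F.Jt t l = F.influx (fun z => D.rho0 z * D.v0 z) t l)) := by
  constructor
  · rintro ⟨P, I, J, hsol, hform, hfol⟩
    exact ShockFront.rankineHugoniot_of_solution hT hD hF hsol hform hfol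
  · rintro ⟨hv, hin⟩
    exact ShockFront.exists_solution_of_rankineHugoniot hT hD hF hv hin
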